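/- Let $(M,\pi)$ be a (finite-dimensional, Hausdorff, smooth) Poisson manifold, $q:T^*M\to M$ its cotangent bundle, $\theta_0$ the Liouville one-form on $T^*M$ and $\omega_0=d\theta_0$ (locally $\omega_0=dp_i\wedge dx^i$). Let $\pi^\sharp:T^*M\to TM$ be given by $\langle\beta,\pi^\sharp(\alpha)\rangle=\pi(\alpha,\beta)$, so that $\{f,g\}=\pi(df,dg)=dg(\pi^\sharp df)$. Let $V$ be a Poisson spray, i.e. a smooth vector field on $T^*M$ with $T_\xi q(V_\xi)=\pi^\sharp(\xi)$ for all $\xi\in T^*M$ and $m_t^*V=tV$ for all $t\neq 0$, where $m_t$ is fibrewise multiplication by $t$. Denote by $\varphi_s$ the flow of $V$, and for $\epsilon\in[0,1]$ put $$\theta_{V,\epsilon}=\frac1\epsilon\int_0^\epsilon \varphi_s^*\theta_0\,ds,\qquad \omega_{V,\epsilon}=\frac1\epsilon\int_0^\epsilon\varphi_s^*\omega_0\,ds\qquad(\theta_{V,0}=\theta_0,\ \omega_{V,0}=\omega_0).$$ There is an open neighbourhood $U\subset T^*M$ of the zero section on which $\varphi_s$ is defined for all $s\in[0,1]$ and on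 which $\omega_{V,\epsilon}$ is non-degenerate for every $\epsilon\in[0,1]$. For every such $U$ the following holds. The equation $$i_{X_\epsilon}\omega_{V,\epsilon}=-\frac{d}{d\epsilon}\theta_{V,\epsilon}$$ defines a unique $\epsilon$-dependent vector field $X_\epsilon$ ($\epsilon\in[0,1]$) on $U$, smooth in $\epsilon$ and in the point (the derivatives being one-sided at $\epsilon=0,1$), and there is an open neighbourhood $W\subset U$ of the zero section such that the flow $\Phi_\epsilon$ of $X_\epsilon$ (with $\Phi_0=\mathrm{id}$) is defined on $W$, with values in $U$, for all $\epsilon\in[0,1]$, is smooth in $\epsilon$ and in the point, and for every $\epsilon\in[0,1]$: 1. $\Phi_\epsilon$ is a diffeomorphism of $W$ onto an open subset of $U$, and $\Phi_\epsilon^*\omega_{V,\epsilon}=\omega_0$ on $W$; 2. $q\circ\Phi_\epsilon:(W,\omega_0)\to(M,-\epsilon\pi)$ is a symplectic realization, i.e. a surjective submersion and a Poisson map from the symplectic manifold $(W,\omega_0)$. Here the Poisson bracket of a symplectic form $\omega$ is $\{F,G\}=dG(Y_F)$ with $i_{Y_F}\omega=dF$ (with the opposite convention for the bracket of $\omega$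 the target is $(M,\epsilon\pi)$). -/

import Mathlib

open Set Bundle
open scoped Manifold ContDiff Topology

noncomputable section

/-! ### Differential forms on manifolds -/

section Forms

variable {F : Type*} [NormedAddCommGroup F] [NormedSpace ℝ F]
  {H : Type*} [TopologicalSpace H] (I : ModelWithCorners ℝ F H)
  {F' : Type*} [NormedAddCommGroup F'] [NormedSpace ℝ F']
  {H' : Type*} [TopologicalSpace H'] (I' : ModelWithCorners ℝ F' H')

/-- A (not necessarily smooth) differential form of degree `k` on the manifold `N`. -/
abbrev DiffForm (N : Type*) [TopologicalSpace N] [ChartedSpace H N] (k : ℕ) :=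
  Π x : N, TangentSpace I x [⋀^Fin k]→L[ℝ] ℝ

variable {N : Type*} [TopologicalSpace N] [ChartedSpace H N]
  {N' : Type*} [TopologicalSpace N'] [ChartedSpace H' N'] {k : ℕ}

/-- The pullback `f^* β` of a differential form. -/
def formPullback (f : N → N') (β : DiffForm I' N' k) : DiffForm I N k :=
  fun x ↦ (β (f x)).compContinuousLinearMap (mfderiv I I' f x)

/-- The expression of the form `β` in the preferred chart at `x₀`, a form on the model space. -/
def formInChart (x₀ : N) (β : DiffForm I N k) : F → F [⋀^Fin k]→L[ℝ] ℝ :=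
  fun y ↦ (β ((extChartAt I x₀).symm y)).compContinuousLinearMap
    ((mfderivWithin 𝓘(ℝ, F) I (extChartAt I x₀).symm (range I) y).comp
      ((NormedSpace.fromTangentSpace (𝕜 := ℝ) y).symm : F →L[ℝ] TangentSpace 𝓘(ℝ, F) y))

/-- The form `β` is smooth at `x`. -/
def SmoothFormAt (β : DiffForm I N k) (x : N) : Prop :=
  ContDiffWithinAt ℝ ∞ (formInChart I x β) (range I) (extChartAt I x x)

/-- The exterior derivative `dβ`: at the point `x` it is computed in the preferred chart at `x`. -/
def mextDeriv (β : DiffForm I N k) : DiffForm I N (k + 1) :=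
  fun x ↦ (extDerivWithin (formInChart I x β) (range I) (extChartAt I x x)).compContinuousLinearMap
    (mvfderiv I (extChartAt I x) x)

/-- The 2-form `β` is non-degenerate at every point of `U`. -/
def NondegenerateOn (β : DiffForm I N 2) (U : Set N) : Prop :=
  ∀ x ∈ U, ∀ v : TangentSpace I x, (∀ w : TangentSpace I x, β x ![v, w] = 0) → v = 0

/-- The 2-form `β` is a symplectic form on the set `U` (which will be open). -/
structure IsSymplecticOn (β : DiffForm I N 2) (U : Set N) : Prop where
  smooth : ∀ x ∈ U, SmoothFormAt I β x
  closed : ∀ x ∈ U, mextDeriv I β x = 0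
  nondegenerate : NondegenerateOn I β U

/-- `Φ` is, for the times `t ∈ [0, 1]` and the initial points in `W`, the flow (starting at time
`0`) of the time-dependent vector field `X` defined on `D`; in particular the integral curves
starting in `W` exist, and remain in `D`, for all times in `[0, 1]`. -/
structure IsFlowOn (X : ℝ → Π x : N, TangentSpace I x) (D : Set N)
    (Φ : ℝ → N → N) (W : Set N) : Prop where
  initial : ∀ x ∈ W, Φ 0 x = x
  mem : ∀ x ∈ W, ∀ t ∈ Icc (0 : ℝ) 1, Φ t x ∈ D
  deriv : ∀ x ∈ W, ∀ t ∈ Icc (0 : ℝ) 1,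
    HasMFDerivWithinAt 𝓘(ℝ, ℝ) I (fun s ↦ Φ s x) (Icc 0 1) t
      ((1 : ℝ →L[ℝ] ℝ).smulRight (X t (Φ t x)))

/-- The identification of the tangent space `T_xN` with the model space `F`, under which tangent
spaces are defined. It only serves to integrate families of forms on `T_xN`. -/
def tangentIdent (x : N) : F ≃L[ℝ] TangentSpace I x :=
  ContinuousLinearEquiv.refl ℝ F

/-- The average `(1/ε) ∫₀^ε (φ_s)^* β ds` of the pullbacks of `β` under the flow `φ`; for `ε = 0`
it is its limit, the form `β` itself. -/
def flowAverage (φ : ℝ → N → N) (β : DiffForm I N k) (ε : ℝ) : DiffForm I N k :=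
  fun x ↦ if ε = 0 then β x
    else (ε⁻¹ • ∫ s in (0 : ℝ)..ε, (formPullback I I (φ s) β x).compContinuousLinearMap
      (tangentIdent I x : F →L[ℝ] TangentSpace I x)).compContinuousLinearMap
        ((tangentIdent I x).symm : TangentSpace I x →L[ℝ] F)

end Forms

/-! ### The cotangent bundle -/

section Cotangent

variable (E : Type*) [NormedAddCommGroup E] [NormedSpace ℝ E]
  (M : Type*) [TopologicalSpace M] [ChartedSpace E M] [IsManifold 𝓘(ℝ, E) ∞ M]

/-- The cotangent bundle `T^*M` of a manifold modelled on `E`. -/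
abbrev Cotangent :=
  TotalSpace (E →L[ℝ] ℝ) (fun x : M ↦ TangentSpace 𝓘(ℝ, E) x →L[ℝ] ℝ)

/-- The model with corners of the manifold `T^*M`. -/
abbrev cotangentModel := (𝓘(ℝ, E)).prod 𝓘(ℝ, E →L[ℝ] ℝ)

/-- The bundle projection `q : T^*M → M`. -/
abbrev cotangentProj : Cotangent E M → M := fun ξ ↦ ξ.proj

/-- The zero section, as a subset of `T^*M`. -/
def cotangentZero : Set (Cotangent E M) := {ξ | ξ.2 = 0}

/-- Fibrewise multiplication `m_t : T^*M → T^*M`. -/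
def fiberMul (t : ℝ) : Cotangent E M → Cotangent E M := fun ξ ↦ ⟨ξ.proj, t • ξ.2⟩

/-- The Liouville 1-form `θ₀`, given by `θ₀(v) = ξ(Tq v)` for `v ∈ T_ξ(T^*M)`. -/
def liouville : DiffForm (cotangentModel E) (Cotangent E M) 1 :=
  fun ξ ↦ ContinuousAlternatingMap.ofSubsingleton ℝ (TangentSpace (cotangentModel E) ξ) ℝ (0 : Fin 1)
    (ξ.2.comp (mfderiv (cotangentModel E) 𝓘(ℝ, E) (cotangentProj E M) ξ))

/-- The canonical symplectic form `ω₀ = dθ₀`. -/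
def canonicalForm : DiffForm (cotangentModel E) (Cotangent E M) 2 :=
  mextDeriv (cotangentModel E) (liouville E M)

variable {E M}

/-! ### Poisson structures, sprays and symplectic realizations -/

/-- A field of bivectors `π`, given by its sharp maps `P x = π^♯ : T_x^*M → T_xM`,
where `⟨β, π^♯ α⟩ = π(α, β)`. -/
abbrev SharpField (E M : Type*) [NormedAddCommGroup E] [NormedSpace ℝ E]
    [TopologicalSpace M] [ChartedSpace E M] :=
  Π x : M, (TangentSpace 𝓘(ℝ, E) x →L[ℝ] ℝ) →L[ℝ] TangentSpace 𝓘(ℝ, E) x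

/-- The bracket `{f, g} = π(df, dg)`. -/
def poissonBracket (P : SharpField E M) (f g : M → ℝ) : M → ℝ :=
  fun x ↦ mvfderiv 𝓘(ℝ, E) g x (P x (mvfderiv 𝓘(ℝ, E) f x))

/-- `P` is a Poisson structure: a smooth bivector field whose bracket satisfies Jacobi's
identity. -/
structure IsPoisson (P : SharpField E M) : Prop where
  smooth : ContMDiff (cotangentModel E) (𝓘(ℝ, E)).tangent ∞
    (fun ξ : Cotangent E M ↦ (⟨ξ.proj, P ξ.proj ξ.2⟩ : TangentBundle 𝓘(ℝ, E) M))
  skew : ∀ (x : M) (α β : TangentSpace 𝓘(ℝ, E) x →L[ℝ] ℝ), β (P x α) = -α (P x β)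
  jacobi : ∀ f g h : M → ℝ, ContMDiff 𝓘(ℝ, E) 𝓘(ℝ, ℝ) ∞ f → ContMDiff 𝓘(ℝ, E) 𝓘(ℝ, ℝ) ∞ g →
    ContMDiff 𝓘(ℝ, E) 𝓘(ℝ, ℝ) ∞ h → ∀ x : M,
      poissonBracket P f (poissonBracket P g h) x + poissonBracket P g (poissonBracket P h f) x
        + poissonBracket P h (poissonBracket P f g) x = 0

/-- `V` is a Poisson spray for `P`: it lifts `P` (that is, `Tq(V_ξ) = P(ξ)`) and is homogeneous, `m_t^* V = t V`. -/
structure IsPoissonSpray (P : SharpField E M)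
    (V : Π ξ : Cotangent E M, TangentSpace (cotangentModel E) ξ) : Prop where
  smooth : ContMDiff (cotangentModel E) (cotangentModel E).tangent ∞
    (fun ξ : Cotangent E M ↦ (⟨ξ, V ξ⟩ : TangentBundle (cotangentModel E) (Cotangent E M)))
  proj : ∀ ξ : Cotangent E M,
    mfderiv (cotangentModel E) 𝓘(ℝ, E) (cotangentProj E M) ξ (V ξ) = P ξ.proj ξ.2
  homogeneous : ∀ t : ℝ, t ≠ 0 → ∀ ξ : Cotangent E M,
    VectorField.mpullback (cotangentModel E) (cotangentModel E) (fiberMul E M t) V ξ = t • V ξ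

/-- `f : (S, Ω) → (M, P)` is a symplectic realization: `Ω` is symplectic on `S` and `f` is a
surjective submersion and a Poisson map. The Poisson structure of `Ω` is the one for which the
Hamiltonian vector field `Y = Ω^♯ dF` of `F` is given by `i_Y Ω = dF`, so `{F, G} = dG(Y)`. -/
structure IsSymplecticRealization {F H N : Type*} [NormedAddCommGroup F] [NormedSpace ℝ F]
    [TopologicalSpace H] (I : ModelWithCorners ℝ F H) [TopologicalSpace N] [ChartedSpace H N]
    (Ω : DiffForm I N 2) (S : Set N) (P : SharpField E M) (f : N → M) : Prop where
  symplectic : IsSymplecticOn I Ω S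
  smooth : ContMDiffOn I 𝓘(ℝ, E) ∞ f S
  surjective : f '' S = univ
  submersion : ∀ x ∈ S, Function.Surjective (mfderiv I 𝓘(ℝ, E) f x)
  poisson : ∀ x ∈ S, ∀ α : TangentSpace 𝓘(ℝ, E) (f x) →L[ℝ] ℝ, ∃ Y : TangentSpace I x,
    (∀ w : TangentSpace I x, Ω x ![Y, w] = α (mfderiv I 𝓘(ℝ, E) f x w)) ∧
      mfderiv I 𝓘(ℝ, E) f x Y = P (f x) α

/-- The forms `θ_{V,ε}`, in terms of the flow `φ` of `V`. -/
def thetaForm (φ : ℝ → Cotangent E M → Cotangent E M) (ε : ℝ) :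
    DiffForm (cotangentModel E) (Cotangent E M) 1 :=
  flowAverage (cotangentModel E) φ (liouville E M) ε

/-- The forms `ω_{V,ε}`, in terms of the flow `φ` of `V`. -/
def omegaForm (φ : ℝ → Cotangent E M → Cotangent E M) (ε : ℝ) :
    DiffForm (cotangentModel E) (Cotangent E M) 2 :=
  flowAverage (cotangentModel E) φ (canonicalForm E M) ε

/-- `U` is an open neighbourhood of the zero section on which the flow `φ` of `V` is defined for
all times in `[0, 1]` and all the forms `ω_{V,ε}`, `ε ∈ [0, 1]`, are non-degenerate. -/
structure IsSprayDomain (V : Π ξ : Cotangent E M, TangentSpace (cotangentModel E) ξ)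
    (φ : ℝ → Cotangent E M → Cotangent E M) (U : Set (Cotangent E M)) : Prop where
  isOpen : IsOpen U
  zero_subset : cotangentZero E M ⊆ U
  flow : IsFlowOn (cotangentModel E) (fun _ ↦ V) univ φ U
  nondegenerate : ∀ ε ∈ Icc (0 : ℝ) 1, NondegenerateOn (cotangentModel E) (omegaForm φ ε) U

/-- The vector `x ∈ T_ξ(T^*M)` satisfies `i_x ω_{V,ε} = -dθ_{V,ε}/dε` at `ξ`
(the derivative is one-sided at the end points of the parameter interval `[0, 1]`). -/
def SolvesMoser (φ : ℝ → Cotangent E M → Cotangent E M) (ε : ℝ) (ξ : Cotangent E M)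
    (x : TangentSpace (cotangentModel E) ξ) : Prop :=
  ∀ v : TangentSpace (cotangentModel E) ξ,
    HasDerivWithinAt (fun e ↦ thetaForm φ e ξ ![v]) (-(omegaForm φ ε ξ ![x, v])) (Icc 0 1) ε

end Cotangent

end

/-! Write `θ_ε`, `ω_ε` for the averaged forms and `w_s = Tφ_s w` for vectors carried along by the
flow of `V`. The proof combines Moser's method with a variational computation along the flow.

Moser's method. Differentiation under the integral gives `ω_ε = dθ_ε`, so `i_X ω_ε = -∂θ_ε/∂ε`
implies that the derivative of `Φ_ε^* ω_ε` in `ε` is `Φ_ε^* (d i_X ω_ε + d ∂θ_ε/∂ε) = 0`, and hence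
that `Φ_ε^* ω_ε = ω₀` where the flow exists (`hasDerivAt_spatialExtDeriv_flow`). Homogeneity makes
`V` vanish on the zero section, so `φ_s` fixes it. As `θ₀` vanishes there, so do `θ_ε` and `X_ε`:
the points of the zero section are rest points of `X`, and near them the flow of `X` exists on all
of `[0, 1]` (`IsSprayDomain.exists_isMoserFlow`). The local flows are glued by uniqueness of
integral curves, which also gives injectivity; the derivative of `Φ_ε` is bijective because it
carries `ω_ε` back to the non-degenerate `ω₀`.

Existence of `U`. The fibre component of `V` has degree two in the covector, so its linearisation
vanishes on the zero section. There `Tφ_s` preserves fibre components and fixes the tangent vectors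
of the zero section, which makes `ω_ε` non-degenerate (`IsPoissonSpray.nondegenerate_zero`). This is
an open condition, and `[0, 1]` is compact.

The Poisson property. Since `Φ_ε` carries `ω₀` to `ω_ε`, it suffices that `q : (U, ω_ε) → (M, -επ)`
is Poisson. If a covector `β_ε` satisfies `π^♯ β_ε = Tq w_ε`, it extends backwards to covectors
`β_s` along the base path, solving a linear differential equation, with `π^♯ β_s = Tq w_s` for all
`s` and `d/ds β_s(Tq v_s) = ω₀(w_s, v_s)` for every `v` (`IsPoissonSpray.exists_covector_chart`).
Jacobi's identity is what propagates the first relation; of the spray only `Tq(V) = π^♯` enters. For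
`w` in the kernel of `T(q ∘ φ_ε)` take `β_ε = 0`: then `Tq w = π^♯ β₀` and `ε ω_ε(w, ·) = -β₀ ∘ Tq`.
This kernel has at least the dimension of `M`, and for `ε > 0` a vector `w` is determined by `β₀`,
so every covector occurs as `β₀` (`fst_eq_of_ker`). Taking `β₀ = -εα` yields the Hamiltonian vector
of `α ∘ Tq` and its projection `-επ^♯ α`.

Analysis. Smooth dependence of flows and of parameter integrals comes from calculus in the Banach
space `C([0, 1], F)`. Averages are rewritten as integrals over `[0, 1]` of pullbacks under `φ_{εs}`,
and locally `φ` is extended to an open time interval; in charts the `θ_ε` then become a family `Θ`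
that is smooth beyond `ε = 0` and `ε = 1`. -/

noncomputable section

set_option synthInstance.maxHeartbeats 200000
set_option linter.unusedSectionVars false

/-! ### Smoothness of `γ ↦ f ∘ γ` on spaces of continuous maps. -/

section Superposition

universe u

variable {K : Type*} [TopologicalSpace K] [CompactSpace K]
  {E G : Type u} [NormedAddCommGroup E] [NormedSpace ℝ E] [NormedAddCommGroup G] [NormedSpace ℝ G]

open Classical in
/-- The superposition operator `γ ↦ f ∘ γ` on continuous maps (zero where this is not
continuous). -/
def superposition (K : Type*) [TopologicalSpace K] (f : E → G) (γ : C(K, E)) : C(K, G) :=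
  if h : Continuous (f ∘ γ) then ⟨f ∘ γ, h⟩ else 0

/-- Pointwise evaluation `A ↦ h ↦ (k ↦ A k (h k))` as a continuous bilinear map. -/
def pointwiseApply (K : Type*) [TopologicalSpace K] [CompactSpace K] (E G : Type*)
    [NormedAddCommGroup E] [NormedSpace ℝ E] [NormedAddCommGroup G] [NormedSpace ℝ G] :
    C(K, E →L[ℝ] G) →L[ℝ] C(K, E) →L[ℝ] C(K, G) :=
  LinearMap.mkContinuous₂
    (LinearMap.mk₂ ℝ (fun (A : C(K, E →L[ℝ] G)) (h : C(K, E)) ↦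
        (⟨fun k ↦ A k (h k), by fun_prop⟩ : C(K, G)))
      (fun _ _ _ ↦ by ext; simp) (fun _ _ _ ↦ by ext; simp)
      (fun _ _ _ ↦ by ext; simp) (fun _ _ _ ↦ by ext; simp)) 1 (by
    intro A h
    rw [one_mul]
    refine (ContinuousMap.norm_le _ (by positivity)).2 fun k ↦ ?_
    exact (A k).le_of_opNorm_le_of_le (A.norm_coe_le_norm k) (h.norm_coe_le_norm k))

@[simp]
lemma pointwiseApply_apply (A : C(K, E →L[ℝ] G)) (h : C(K, E)) (k : K) :
    pointwiseApply K E G A h k = A k (h k) := rfl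

lemma continuous_comp_of_continuousOn {f : E → G} {Ω : Set E} (hf : ContinuousOn f Ω)
    {γ : C(K, E)} (hγ : ∀ k, γ k ∈ Ω) : Continuous (f ∘ γ) :=
  hf.comp_continuous γ.continuous hγ

lemma superposition_apply {f : E → G} {Ω : Set E} (hf : ContinuousOn f Ω)
    {γ : C(K, E)} (hγ : ∀ k, γ k ∈ Ω) (k : K) : superposition K f γ k = f (γ k) := by
  simp [superposition, continuous_comp_of_continuousOn hf hγ]

lemma isOpen_range_subset {Ω : Set E} (hΩ : IsOpen Ω) : IsOpen {γ : C(K, E) | ∀ k, γ k ∈ Ω} := by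
  simpa [MapsTo] using ContinuousMap.isOpen_setOfPred_mapsTo (X := K) (Y := E) isCompact_univ hΩ

/-- The range of `γ` is compact, so a single radius works along the whole of `γ`; sup-norm estimates
need this uniformity. -/
lemma exists_uniform_of_continuousOn {f : E → G} {Ω : Set E} (hΩ : IsOpen Ω)
    (hf : ContinuousOn f Ω) {γ : C(K, E)} (hγ : ∀ k, γ k ∈ Ω) {ε : ℝ} (hε : 0 < ε) :
    ∃ δ > 0, ∀ k, ∀ y, dist y (γ k) < δ → y ∈ Ω ∧ dist (f y) (f (γ k)) < ε := by
  have hc : IsCompact (range γ) := isCompact_range γ.continuous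
  have h1 := hc.uniformContinuousAt_of_continuousAt f
    (fun x hx ↦ by
      obtain ⟨k, rfl⟩ := hx
      exact hf.continuousAt (hΩ.mem_nhds (hγ k))) (Metric.dist_mem_uniformity hε)
  obtain ⟨δ₁, hδ₁, h1⟩ := Metric.mem_uniformity_dist.1 h1
  obtain ⟨δ₂, hδ₂, h2⟩ := hc.exists_thickening_subset_open hΩ (by rintro _ ⟨k, rfl⟩; exact hγ k)
  refine ⟨min δ₁ δ₂, lt_min hδ₁ hδ₂, fun k y hy ↦ ⟨h2 ?_, ?_⟩⟩
  · exact Metric.mem_thickening_iff.2 ⟨γ k, mem_range_self k, hy.trans_le (min_le_right _ _)⟩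
  · rw [dist_comm]
    exact h1 (by rw [dist_comm]; exact hy.trans_le (min_le_left _ _)) (mem_range_self k)

lemma continuousOn_superposition {f : E → G} {Ω : Set E} (hΩ : IsOpen Ω)
    (hf : ContinuousOn f Ω) : ContinuousOn (superposition K f) {γ | ∀ k, γ k ∈ Ω} := by
  intro γ hγ
  refine ContinuousAt.continuousWithinAt (Metric.continuousAt_iff.2 fun ε hε ↦ ?_)
  obtain ⟨δ, hδ, h⟩ := exists_uniform_of_continuousOn hΩ hf hγ (half_pos hε)
  refine ⟨δ, hδ, fun {γ'} hγ' ↦ ?_⟩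
  have h' : ∀ k, γ' k ∈ Ω ∧ dist (f (γ' k)) (f (γ k)) < ε / 2 := fun k ↦
    h k _ ((ContinuousMap.dist_apply_le_dist k).trans_lt hγ')
  refine lt_of_le_of_lt ((ContinuousMap.dist_le (half_pos hε).le).2 fun k ↦ ?_) (half_lt_self hε)
  rw [superposition_apply hf (fun k ↦ (h' k).1), superposition_apply hf hγ]
  exact (h' k).2.le

/-- The mean value inequality on balls around the points `γ k`, of a radius independent of `k`,
bounds the first-order error by `c ‖η k‖` for all `k` at once. -/
lemma hasFDerivAt_superposition {f : E → G} {Ω : Set E} (hΩ : IsOpen Ω)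
    (hf : ContDiffOn ℝ 1 f Ω) {γ : C(K, E)} (hγ : ∀ k, γ k ∈ Ω) :
    HasFDerivAt (superposition K f) (pointwiseApply K E G (superposition K (fderiv ℝ f) γ)) γ := by
  have hf' : ContinuousOn (fderiv ℝ f) Ω := hf.continuousOn_fderiv_of_isOpen hΩ le_rfl
  have hd : ∀ x ∈ Ω, HasFDerivAt f (fderiv ℝ f x) x := fun x hx ↦
    ((hf.differentiableOn one_ne_zero).differentiableAt (hΩ.mem_nhds hx)).hasFDerivAt
  rw [hasFDerivAt_iff_isLittleO_nhds_zero, Asymptotics.isLittleO_iff]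
  intro c hc
  obtain ⟨δ, hδ, h⟩ := exists_uniform_of_continuousOn hΩ hf' hγ hc
  filter_upwards [Metric.ball_mem_nhds (0 : C(K, E)) hδ] with η hη
  rw [mem_ball_zero_iff] at hη
  refine (ContinuousMap.norm_le _ (by positivity)).2 fun k ↦ ?_
  have hηk : ∀ k, dist (γ k + η k) (γ k) < δ := fun k ↦ by
    simpa using (η.norm_coe_le_norm k).trans_lt hη
  have key : ‖f (γ k + η k) - f (γ k) - fderiv ℝ f (γ k) (γ k + η k - γ k)‖
      ≤ c * ‖γ k + η k - γ k‖ := by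
    refine (convex_ball (γ k) δ).norm_image_sub_le_of_norm_hasFDerivWithin_le'
      (f' := fderiv ℝ f) (fun x hx ↦ (hd x (h k x hx).1).hasFDerivWithinAt) (fun x hx ↦ ?_)
      (Metric.mem_ball_self hδ) (hηk k)
    rw [← dist_eq_norm]
    exact (h k x hx).2.le
  have e1 : superposition K f (γ + η) k = f (γ k + η k) :=
    superposition_apply hf.continuousOn (γ := γ + η) (fun k ↦ (h k _ (hηk k)).1) k
  simp only [ContinuousMap.sub_apply, e1, superposition_apply hf.continuousOn hγ,
    pointwiseApply_apply, superposition_apply hf' hγ]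
  simp only [add_sub_cancel_left] at key
  exact key.trans (by gcongr; exact η.norm_coe_le_norm k)

/-- Up to the continuous linear map `pointwiseApply`, the derivative of the superposition operator
of `f` is the superposition operator of `fderiv ℝ f`. The target `G` varies in the induction because
it becomes `E →L[ℝ] G`; hence the common universe of `E` and `G`. -/
lemma contDiffOn_superposition_nat {Ω : Set E} (hΩ : IsOpen Ω) (n : ℕ) :
    ∀ {G : Type u} [NormedAddCommGroup G] [NormedSpace ℝ G] {f : E → G}, ContDiffOn ℝ n f Ω →
      ContDiffOn ℝ n (superposition K f) {γ | ∀ k, γ k ∈ Ω} := by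
  induction n with
  | zero =>
    intro G _ _ f hf
    simp only [Nat.cast_zero, contDiffOn_zero] at hf ⊢
    exact continuousOn_superposition hΩ hf
  | succ n ih =>
    intro G _ _ f hf
    have h1 : ContDiffOn ℝ 1 f Ω := hf.of_le (by exact_mod_cast Nat.le_add_left 1 n)
    push_cast at hf ⊢
    rw [contDiffOn_succ_iff_fderiv_of_isOpen hΩ] at hf
    rw [contDiffOn_succ_iff_fderiv_of_isOpen (isOpen_range_subset hΩ)]
    refine ⟨fun γ hγ ↦ (hasFDerivAt_superposition hΩ h1 hγ).differentiableAt.differentiableWithinAt,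
      by simp, ?_⟩
    refine ((pointwiseApply K E G).contDiff.comp_contDiffOn (ih hf.2.2)).congr fun γ hγ ↦ ?_
    exact (hasFDerivAt_superposition hΩ h1 hγ).fderiv

lemma contDiffOn_superposition {Ω : Set E} (hΩ : IsOpen Ω) {f : E → G}
    (hf : ContDiffOn ℝ ∞ f Ω) : ContDiffOn ℝ ∞ (superposition K f) {γ | ∀ k, γ k ∈ Ω} :=
  contDiffOn_infty.2 fun n ↦ contDiffOn_superposition_nat hΩ n (contDiffOn_infty.1 hf n)

end Superposition

/-! ### Smooth local flows in Banach spaces. -/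

section LocalFlow

universe u

variable {F : Type u} [NormedAddCommGroup F] [NormedSpace ℝ F]

/-- Constant maps, as a continuous linear map into `C([0, 1], F)`. -/
def constPath (F : Type*) [NormedAddCommGroup F] [NormedSpace ℝ F] :
    F →L[ℝ] C(Icc (0 : ℝ) 1, F) :=
  LinearMap.mkContinuous
    { toFun := fun x ↦ ContinuousMap.const _ x
      map_add' := fun _ _ ↦ by ext; simp
      map_smul' := fun _ _ ↦ by ext; simp } 1 fun x ↦ by
    rw [one_mul]
    exact (ContinuousMap.norm_le _ (norm_nonneg x)).2 fun k ↦ le_rfl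

@[simp] lemma constPath_apply (x : F) (k : Icc (0 : ℝ) 1) : constPath F x k = x := rfl

lemma continuous_IccExtend_path (h : C(Icc (0 : ℝ) 1, F)) :
    Continuous (IccExtend zero_le_one h) := h.continuous.Icc_extend'

/-- The primitive `t ↦ ∫₀ᵗ h` of a path, as a continuous linear map. -/
def primitivePath (F : Type*) [NormedAddCommGroup F] [NormedSpace ℝ F] :
    C(Icc (0 : ℝ) 1, F) →L[ℝ] C(Icc (0 : ℝ) 1, F) :=
  LinearMap.mkContinuous
    { toFun := fun h ↦ ⟨fun t ↦ ∫ τ in (0 : ℝ)..t, IccExtend zero_le_one h τ,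
        (intervalIntegral.continuous_primitive
          (fun a b ↦ (continuous_IccExtend_path h).intervalIntegrable a b) 0).comp
            continuous_subtype_val⟩
      map_add' := fun h k ↦ by
        ext t
        exact intervalIntegral.integral_add
          ((continuous_IccExtend_path h).intervalIntegrable _ _)
          ((continuous_IccExtend_path k).intervalIntegrable _ _)
      map_smul' := fun c h ↦ by
        ext t
        exact intervalIntegral.integral_smul c _ } 1 fun h ↦ by
    rw [one_mul]
    refine (ContinuousMap.norm_le _ (norm_nonneg h)).2 fun t ↦ ?_
    refine (intervalIntegral.norm_integral_le_of_norm_le_const (C := ‖h‖)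
      (fun τ _ ↦ h.norm_coe_le_norm _)).trans ?_
    rw [sub_zero, abs_of_nonneg t.2.1]
    exact mul_le_of_le_one_right (norm_nonneg h) t.2.2

lemma primitivePath_apply (h : C(Icc (0 : ℝ) 1, F)) (t : Icc (0 : ℝ) 1) :
    primitivePath F h t = ∫ τ in (0 : ℝ)..t, IccExtend zero_le_one h τ := rfl

lemma norm_primitivePath_le : ‖primitivePath F‖ ≤ 1 :=
  LinearMap.mkContinuous_norm_le _ zero_le_one _

lemma norm_pointwiseApply_le {E G : Type*} [NormedAddCommGroup E] [NormedSpace ℝ E]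
    [NormedAddCommGroup G] [NormedSpace ℝ G] (A : C(Icc (0 : ℝ) 1, E →L[ℝ] G)) :
    ‖pointwiseApply (Icc (0 : ℝ) 1) E G A‖ ≤ ‖A‖ := by
  refine ContinuousLinearMap.opNorm_le_bound _ (norm_nonneg A) fun h ↦ ?_
  refine (ContinuousMap.norm_le _ (by positivity)).2 fun k ↦ ?_
  exact (A k).le_of_opNorm_le_of_le (A.norm_coe_le_norm k) (h.norm_coe_le_norm k)

/-- The equation `γ = x + l ∫ v ∘ γ` whose solutions are the integral curves of `l • v`. -/
def flowEquation (v : F → F) (w : (F × ℝ) × C(Icc (0 : ℝ) 1, F)) : C(Icc (0 : ℝ) 1, F) :=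
  w.2 - constPath F w.1.1 - w.1.2 • primitivePath F (superposition _ v w.2)

lemma contDiffAt_flowEquation {v : F → F} {Ω : Set F} (hΩ : IsOpen Ω) (hv : ContDiffOn ℝ ∞ v Ω)
    {w : (F × ℝ) × C(Icc (0 : ℝ) 1, F)} (hw : ∀ k, w.2 k ∈ Ω) :
    ContDiffAt ℝ ∞ (flowEquation v) w := by
  have h1 : ContDiffAt ℝ ∞ (superposition (Icc (0 : ℝ) 1) v) w.2 :=
    (contDiffOn_superposition hΩ hv).contDiffAt ((isOpen_range_subset hΩ).mem_nhds hw)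
  have h2 : ContDiffAt ℝ ∞ (fun w : (F × ℝ) × C(Icc (0 : ℝ) 1, F) ↦
      superposition (Icc (0 : ℝ) 1) v w.2) w := h1.comp w contDiffAt_snd
  have h3 : ContDiffAt ℝ ∞ (fun w : (F × ℝ) × C(Icc (0 : ℝ) 1, F) ↦
      primitivePath F (superposition (Icc (0 : ℝ) 1) v w.2)) w :=
    (primitivePath F).contDiff.contDiffAt.comp w h2
  have h4 : ContDiffAt ℝ ∞ (fun w : (F × ℝ) × C(Icc (0 : ℝ) 1, F) ↦ constPath F w.1.1) w :=
    (constPath F).contDiff.contDiffAt.comp w (contDiffAt_fst.comp w contDiffAt_fst)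
  exact (contDiffAt_snd.sub h4).sub ((contDiffAt_snd.comp w contDiffAt_fst).smul h3)

/-- The partial derivative in the path is `id - l ∫ A` with `‖∫‖ ≤ 1` and `‖A‖ ≤ C`, hence
invertible by the Neumann series when `|l| C < 1`. -/
lemma fderiv_flowEquation_inr [CompleteSpace F] {v : F → F} {Ω : Set F} (hΩ : IsOpen Ω)
    (hv : ContDiffOn ℝ ∞ v Ω)
    {w : (F × ℝ) × C(Icc (0 : ℝ) 1, F)} (hw : ∀ k, w.2 k ∈ Ω) {C : ℝ} (hC0 : 0 ≤ C)
    (hC : ∀ k, ‖fderiv ℝ v (w.2 k)‖ ≤ C) (hlC : |w.1.2| * C < 1) :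
    (fderiv ℝ (flowEquation v) w ∘L .inr ℝ (F × ℝ) C(Icc (0 : ℝ) 1, F)).IsInvertible := by
  have hv1 : ContDiffOn ℝ 1 v Ω := hv.of_le (by exact_mod_cast le_top)
  set A : C(Icc (0 : ℝ) 1, F) →L[ℝ] C(Icc (0 : ℝ) 1, F) :=
    pointwiseApply (Icc (0 : ℝ) 1) F F (superposition _ (fderiv ℝ v) w.2) with hA
  have h1 : HasFDerivAt (fun γ ↦ flowEquation v (w.1, γ))
      (ContinuousLinearMap.id ℝ _ - w.1.2 • (primitivePath F ∘L A)) w.2 := by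
    have := (primitivePath F).hasFDerivAt.comp w.2 (hasFDerivAt_superposition hΩ hv1 hw)
    exact ((hasFDerivAt_id w.2).sub_const (constPath F w.1.1)).sub (this.const_smul w.1.2)
  have h2 : HasFDerivAt (fun γ ↦ flowEquation v (w.1, γ))
      (fderiv ℝ (flowEquation v) w ∘L .inr ℝ (F × ℝ) C(Icc (0 : ℝ) 1, F)) w.2 := by
    have h3 : HasFDerivAt (flowEquation v) (fderiv ℝ (flowEquation v) w) (w.1, w.2) :=
      ((contDiffAt_flowEquation hΩ hv hw).differentiableAt (by simp)).hasFDerivAt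
    exact h3.comp w.2 (hasFDerivAt_prodMk_right w.1 w.2)
  rw [h2.unique h1]
  have hnorm : ‖w.1.2 • (primitivePath F ∘L A)‖ < 1 := by
    refine lt_of_le_of_lt (ContinuousLinearMap.opNorm_smul_le _ _ |>.trans ?_) hlC
    rw [Real.norm_eq_abs]
    gcongr
    refine (ContinuousLinearMap.opNorm_comp_le _ _).trans ?_
    have h5 : ‖A‖ ≤ C := (norm_pointwiseApply_le _).trans
      ((ContinuousMap.norm_le _ hC0).2 fun k ↦ by
        rw [superposition_apply (hv1.continuousOn_fderiv_of_isOpen hΩ le_rfl) hw]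
        exact hC k)
    calc ‖primitivePath F‖ * ‖A‖ ≤ 1 * C := by gcongr; exact norm_primitivePath_le
      _ = C := one_mul C
  obtain ⟨e, he⟩ := isUnit_one_sub_of_norm_lt_one
    (R := C(Icc (0 : ℝ) 1, F) →L[ℝ] C(Icc (0 : ℝ) 1, F)) hnorm
  exact ⟨ContinuousLinearEquiv.ofUnit e, he⟩

/-- Picard–Lindelöf gives a flow `α` that is jointly continuous. The rescaled curves `t ↦ α (x, l
t)` on `[0, 1]` are a continuous family of zeros of `flowEquation v`, so locally they are the
implicit function, which is smooth in `(x, l)`; evaluation at `t = 1` returns `α (x, l)`. -/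
theorem exists_contDiffOn_localFlow [CompleteSpace F] {v : F → F} {Ω : Set F} (hΩ : IsOpen Ω)
    (hv : ContDiffOn ℝ ∞ v Ω) {x₀ : F} (hx₀ : x₀ ∈ Ω) :
    ∃ δ > 0, ∃ r > 0, ∃ ψ : ℝ × F → F,
      ContDiffOn ℝ ∞ ψ (Ioo (-δ) δ ×ˢ Metric.ball x₀ r) ∧
      ∀ x ∈ Metric.ball x₀ r, ψ (0, x) = x ∧
        ∀ t ∈ Ioo (-δ) δ, ψ (t, x) ∈ Ω ∧ HasDerivAt (fun t ↦ ψ (t, x)) (v (ψ (t, x))) t := by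
  have hv1 : ContDiffOn ℝ 1 v Ω := hv.of_le (by exact_mod_cast le_top)
  obtain ⟨ε, hε, a, r, L, K, hr, hPL⟩ :=
    IsPicardLindelof.of_contDiffAt_one (hv1.contDiffAt (hΩ.mem_nhds hx₀))
  obtain ⟨α, hα, hαc⟩ :=
    (hPL 0).exists_forall_mem_closedBall_eq_hasDerivWithinAt_continuousOn
  simp only [zero_sub, zero_add] at hα hαc
  set C := ‖fderiv ℝ v x₀‖ + 1 with hC
  obtain ⟨ρ, hρ, hρΩ⟩ : ∃ ρ > 0, ∀ x ∈ Metric.ball x₀ ρ, x ∈ Ω ∧ ‖fderiv ℝ v x‖ ≤ C := by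
    have h1 : ContinuousAt (fderiv ℝ v) x₀ :=
      (hv1.continuousOn_fderiv_of_isOpen hΩ le_rfl).continuousAt (hΩ.mem_nhds hx₀)
    have h2 : ∀ᶠ x in 𝓝 x₀, ‖fderiv ℝ v x‖ < C :=
      h1.norm.eventually_lt continuousAt_const (by simp [hC])
    obtain ⟨ρ, hρ, h⟩ := Metric.eventually_nhds_iff_ball.1 ((hΩ.eventually_mem hx₀).and h2)
    exact ⟨ρ, hρ, fun x hx ↦ ⟨(h x hx).1, (h x hx).2.le⟩⟩
  have hrr : (0 : ℝ) < r := hr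
  have hnb : Metric.closedBall x₀ r ×ˢ Icc (-ε) ε ∈ 𝓝 (x₀, (0 : ℝ)) :=
    prod_mem_nhds (Metric.closedBall_mem_nhds _ hrr) (Icc_mem_nhds (by linarith) hε)
  have hα0 : α (x₀, 0) = x₀ := (hα x₀ (Metric.mem_closedBall_self hrr.le)).1
  have hev : ∀ᶠ p in 𝓝 (x₀, (0 : ℝ)), α p ∈ Metric.ball x₀ ρ := by
    have := hαc.continuousAt hnb
    rw [ContinuousAt, hα0] at this
    exact this (Metric.ball_mem_nhds _ hρ)
  obtain ⟨P, hP, Q, hQ, hPQ⟩ := Filter.eventually_prod_iff.1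
    (by rwa [nhds_prod_eq] at hev :
      ∀ᶠ p in 𝓝 x₀ ×ˢ 𝓝 (0 : ℝ), α p ∈ Metric.ball x₀ ρ)
  obtain ⟨r₁, hr₁, h₁⟩ := Metric.eventually_nhds_iff_ball.1 hP
  obtain ⟨ε₁, hε₁, h₂⟩ := Metric.eventually_nhds_iff_ball.1 hQ
  have hCpos : 0 < C := by positivity
  set r' := min (r : ℝ) r₁ with hr'
  -- The bound `1 / C` ensures `|l| * C < 1`, as needed to invert the linearised flow equation.
  set δ := min (min ε ε₁) (1 / C) with hδ
  have hr'0 : 0 < r' := lt_min hrr hr₁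
  have hδ0 : 0 < δ := lt_min (lt_min hε hε₁) (by positivity)
  have hδε : δ ≤ ε := (min_le_left _ _).trans (min_le_left _ _)
  have hδε₁ : δ ≤ ε₁ := (min_le_left _ _).trans (min_le_right _ _)
  have hδC : δ ≤ 1 / C := min_le_right _ _
  have hball : ∀ x ∈ Metric.ball x₀ r', x ∈ Metric.closedBall x₀ r := fun x hx ↦
    Metric.ball_subset_closedBall (Metric.ball_subset_ball (min_le_left _ _) hx)
  have hαmem : ∀ x ∈ Metric.ball x₀ r', ∀ t ∈ Ioo (-δ) δ, α (x, t) ∈ Metric.ball x₀ ρ := by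
    intro x hx t ht
    refine hPQ (h₁ x (Metric.ball_subset_ball (min_le_right _ _) hx)) (h₂ t ?_)
    rw [Real.ball_eq_Ioo]
    exact ⟨by linarith [ht.1], by linarith [ht.2]⟩
  have hder : ∀ x ∈ Metric.ball x₀ r', ∀ t ∈ Ioo (-δ) δ,
      HasDerivAt (fun t ↦ α (x, t)) (v (α (x, t))) t := by
    intro x hx t ht
    exact ((hα x (hball x hx)).2 t ⟨by linarith [ht.1], by linarith [ht.2]⟩).hasDerivAt
      (Icc_mem_nhds (by linarith [ht.1]) (by linarith [ht.2]))
  refine ⟨δ, hδ0, r', hr'0, fun p ↦ α (p.2, p.1), ?_, fun x hx ↦ ⟨(hα x (hball x hx)).1,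
    fun t ht ↦ ⟨(hρΩ _ (hαmem x hx t ht)).1, hder x hx t ht⟩⟩⟩
  -- the paths `t ↦ α (x, l t)` solve the flow equation and depend continuously on `(x, l)`
  set B : Set (F × ℝ) := Metric.ball x₀ r' ×ˢ Ioo (-δ) δ with hB
  have hBo : IsOpen B := Metric.isOpen_ball.prod isOpen_Ioo
  have hmul : ∀ l ∈ Ioo (-δ) δ, ∀ t ∈ Icc (0 : ℝ) 1, l * t ∈ Ioo (-δ) δ := by
    intro l hl t ht
    rw [mem_Ioo, ← abs_lt] at hl ⊢
    rw [abs_mul, abs_of_nonneg ht.1]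
    exact (mul_le_of_le_one_right (abs_nonneg l) ht.2).trans_lt hl
  let Γ' : C(B × Icc (0 : ℝ) 1, F) := ⟨fun q ↦ α (q.1.1.1, q.1.1.2 * q.2), by
    refine hαc.comp_continuous (by fun_prop) fun q ↦ ⟨hball _ q.1.2.1, ?_⟩
    have := hmul _ q.1.2.2 _ q.2.2
    exact ⟨by linarith [this.1], by linarith [this.2]⟩⟩
  let Γ : C(B, C(Icc (0 : ℝ) 1, F)) := Γ'.curry
  have hΓ : ∀ (p : B) (t : Icc (0 : ℝ) 1), Γ p t = α (p.1.1, p.1.2 * t) := fun p t ↦ rfl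
  have hΓρ : ∀ (p : B) (t : Icc (0 : ℝ) 1), Γ p t ∈ Metric.ball x₀ ρ := fun p t ↦
    hαmem _ p.2.1 _ (hmul _ p.2.2 _ t.2)
  have hΓΩ : ∀ (p : B) (t : Icc (0 : ℝ) 1), Γ p t ∈ Ω := fun p t ↦ (hρΩ _ (hΓρ p t)).1
  have hsol : ∀ p : B, flowEquation v (p.1, Γ p) = 0 := by
    intro p
    ext t
    have h1 : ∀ τ ∈ uIcc (0 : ℝ) t, HasDerivAt (fun τ ↦ α (p.1.1, p.1.2 * τ))
        (p.1.2 • IccExtend zero_le_one (superposition _ v (Γ p)) τ) τ := by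
      intro τ hτ
      rw [uIcc_of_le t.2.1] at hτ
      have hτ' : τ ∈ Icc (0 : ℝ) 1 := ⟨hτ.1, hτ.2.trans t.2.2⟩
      rw [IccExtend_of_mem _ _ hτ', superposition_apply hv.continuousOn (hΓΩ p), hΓ]
      have h2 := (hder _ p.2.1 _ (hmul _ p.2.2 _ hτ')).scomp τ
        ((hasDerivAt_id τ).const_mul p.1.2)
      simpa [Function.comp_def] using h2
    have h3 := intervalIntegral.integral_eq_sub_of_hasDerivAt h1
      (((continuous_IccExtend_path _).const_smul p.1.2).intervalIntegrable _ _)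
    rw [intervalIntegral.integral_smul] at h3
    have h4 : α (p.1.1, 0) = p.1.1 := (hα _ (hball _ p.2.1)).1
    simp only [flowEquation, ContinuousMap.sub_apply, ContinuousMap.smul_apply, constPath_apply,
      primitivePath_apply, h3, mul_zero, h4, hΓ, ContinuousMap.zero_apply]
    abel
  have hmain : ∀ p ∈ B, ContDiffAt ℝ ∞ α p := by
    intro p hp
    set w : (F × ℝ) × C(Icc (0 : ℝ) 1, F) := (p, Γ ⟨p, hp⟩) with hw
    have cdf : ContDiffAt ℝ ∞ (flowEquation v) w := contDiffAt_flowEquation hΩ hv (hΓΩ ⟨p, hp⟩)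
    have if₂ : (fderiv ℝ (flowEquation v) w ∘L
        .inr ℝ (F × ℝ) C(Icc (0 : ℝ) 1, F)).IsInvertible := by
      refine fderiv_flowEquation_inr hΩ hv (hΓΩ ⟨p, hp⟩) hCpos.le
        (fun k ↦ (hρΩ _ (hΓρ ⟨p, hp⟩ k)).2) ?_
      have h1 : |p.2| < 1 / C := (abs_lt.2 hp.2).trans_le hδC
      calc |p.2| * C < 1 / C * C := by gcongr
        _ = 1 := by field_simp
    have hne : (∞ : WithTop ℕ∞) ≠ 0 := by simp
    have hev := cdf.eventually_apply_eq_iff_implicitFunction hne if₂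
    have hcont : Filter.Tendsto (fun q : B ↦ ((q : F × ℝ), Γ q)) (𝓝 ⟨p, hp⟩) (𝓝 w) :=
      (continuous_subtype_val.prodMk Γ.continuous).continuousAt
    -- Continuity of `Γ` keeps the solutions in the neighbourhood of `w` where the zero set is a
    -- graph.
    have h5 : ∀ᶠ q : B in 𝓝 ⟨p, hp⟩, cdf.implicitFunction hne if₂ q = Γ q := by
      filter_upwards [hcont.eventually hev] with q hq
      exact hq.1 (by rw [hsol q, hw, hsol ⟨p, hp⟩])
    have h6 : ∀ᶠ q in 𝓝 p, α q = cdf.implicitFunction hne if₂ q ⟨1, by simp⟩ := by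
      have h7 := (hBo.isOpenEmbedding_subtypeVal.map_nhds_eq ⟨p, hp⟩)
      simp only at h7
      rw [← h7, Filter.eventually_map]
      filter_upwards [h5] with q hq
      rw [hq, hΓ]
      simp
    refine ContDiffAt.congr_of_eventuallyEq ?_ h6
    exact (ContinuousMap.evalCLM ℝ (⟨1, by simp⟩ : Icc (0 : ℝ) 1)).contDiff.contDiffAt.comp p
      (cdf.contDiffAt_implicitFunction hne if₂)
  intro p hp
  exact ((hmain (p.2, p.1) ⟨hp.2, hp.1⟩).comp p
    (contDiffAt_snd.prodMk contDiffAt_fst)).contDiffWithinAt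

end LocalFlow

/-! ### Smooth dependence of integrals on parameters. -/

section ParametricIntegral

universe u

variable {P G : Type u} [NormedAddCommGroup P] [NormedSpace ℝ P]
  [NormedAddCommGroup G] [NormedSpace ℝ G]

/-- The path `s ↦ (s, p)`. -/
def slicePath (p : P) : C(Icc (0 : ℝ) 1, ℝ × P) := ⟨fun s ↦ (s, p), by fun_prop⟩

@[simp] lemma slicePath_apply (p : P) (s : Icc (0 : ℝ) 1) : slicePath p s = ((s : ℝ), p) := rfl

lemma hasFDerivAt_slicePath (p : P) : HasFDerivAt (slicePath (P := P))
    (((ContinuousLinearMap.inr ℝ ℝ P).compLeftContinuous ℝ (Icc (0 : ℝ) 1)) ∘L constPath P) p := by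
  have h : slicePath (P := P) = fun p ↦ slicePath 0 +
      (((ContinuousLinearMap.inr ℝ ℝ P).compLeftContinuous ℝ (Icc (0 : ℝ) 1)) ∘L constPath P) p := by
    ext p s <;> simp [slicePath]
  rw [h]
  exact (ContinuousLinearMap.hasFDerivAt _).const_add _

lemma contDiff_slicePath : ContDiff ℝ ∞ (slicePath (P := P)) := by
  have h : slicePath (P := P) = fun p ↦ slicePath 0 +
      (((ContinuousLinearMap.inr ℝ ℝ P).compLeftContinuous ℝ (Icc (0 : ℝ) 1)) ∘L constPath P) p := by
    ext p s <;> simp [slicePath]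
  rw [h]
  exact contDiff_const.add (ContinuousLinearMap.contDiff _)

lemma integral_eq_primitivePath {g : ℝ × P → G} {Ω : Set (ℝ × P)} (hg : ContinuousOn g Ω) {p : P}
    (hp : ∀ s ∈ Icc (0 : ℝ) 1, (s, p) ∈ Ω) : ∫ s in (0 : ℝ)..1, g (s, p) =
      primitivePath G (superposition _ g (slicePath p)) ⟨1, by simp⟩ := by
  rw [primitivePath_apply]
  refine intervalIntegral.integral_congr fun s hs ↦ ?_
  rw [uIcc_of_le zero_le_one] at hs
  simp only [IccExtend_of_mem _ _ hs]
  rw [superposition_apply hg (fun k ↦ by simpa using hp k k.2)]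
  rfl

lemma isOpen_slice_subset {Ω : Set (ℝ × P)} (hΩ : IsOpen Ω) :
    IsOpen {p : P | ∀ s ∈ Icc (0 : ℝ) 1, (s, p) ∈ Ω} := by
  have := (isOpen_range_subset (K := Icc (0 : ℝ) 1) hΩ).preimage (contDiff_slicePath (P := P)).continuous
  convert this using 1
  ext p
  simp

/-- The integral factors as the affine map `slicePath`, the superposition operator of `g`, and the
continuous linear functional `∫₀¹`. -/
theorem contDiffOn_integral_Icc {g : ℝ × P → G} {Ω : Set (ℝ × P)} (hΩ : IsOpen Ω)
    (hg : ContDiffOn ℝ ∞ g Ω) :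
    ContDiffOn ℝ ∞ (fun p ↦ ∫ s in (0 : ℝ)..1, g (s, p))
      {p : P | ∀ s ∈ Icc (0 : ℝ) 1, (s, p) ∈ Ω} := by
  have h1 : ContDiffOn ℝ ∞ (fun p ↦ superposition (Icc (0 : ℝ) 1) g (slicePath p))
      {p : P | ∀ s ∈ Icc (0 : ℝ) 1, (s, p) ∈ Ω} :=
    (contDiffOn_superposition hΩ hg).comp contDiff_slicePath.contDiffOn
      (fun p hp k ↦ by simpa using hp k k.2)
  refine (((ContinuousMap.evalCLM ℝ (⟨1, by simp⟩ : Icc (0 : ℝ) 1)) ∘L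
    primitivePath G).contDiff.comp_contDiffOn h1).congr fun p hp ↦ ?_
  exact integral_eq_primitivePath hg.continuousOn hp

theorem fderiv_integral_Icc_apply {g : ℝ × P → G} {Ω : Set (ℝ × P)} (hΩ : IsOpen Ω)
    (hg : ContDiffOn ℝ ∞ g Ω) {p : P} (hp : ∀ s ∈ Icc (0 : ℝ) 1, (s, p) ∈ Ω) (u : P) :
    fderiv ℝ (fun p ↦ ∫ s in (0 : ℝ)..1, g (s, p)) p u =
      ∫ s in (0 : ℝ)..1, fderiv ℝ g (s, p) (0, u) := by
  have hg1 : ContDiffOn ℝ 1 g Ω := hg.of_le (by exact_mod_cast le_top)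
  have hp' : ∀ k : Icc (0 : ℝ) 1, slicePath p k ∈ Ω := fun k ↦ by simpa using hp k k.2
  have h1 := ((ContinuousMap.evalCLM ℝ (⟨1, by simp⟩ : Icc (0 : ℝ) 1)) ∘L
    primitivePath G).hasFDerivAt.comp p
    ((hasFDerivAt_superposition hΩ hg1 hp').comp p (hasFDerivAt_slicePath p))
  have h2 : (fun p ↦ ∫ s in (0 : ℝ)..1, g (s, p)) =ᶠ[𝓝 p]
      (((ContinuousMap.evalCLM ℝ (⟨1, by simp⟩ : Icc (0 : ℝ) 1)) ∘L primitivePath G) ∘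
        superposition (Icc (0 : ℝ) 1) g ∘ slicePath) := by
    filter_upwards [(isOpen_slice_subset hΩ).mem_nhds hp] with q hq
    exact integral_eq_primitivePath hg.continuousOn hq
  rw [h2.fderiv_eq, h1.fderiv]
  simp only [ContinuousLinearMap.comp_apply, ContinuousMap.evalCLM_apply, primitivePath_apply]
  refine intervalIntegral.integral_congr fun s hs ↦ ?_
  rw [uIcc_of_le zero_le_one] at hs
  simp only [IccExtend_of_mem _ _ hs, pointwiseApply_apply]
  rw [superposition_apply (hg1.continuousOn_fderiv_of_isOpen hΩ le_rfl) hp']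
  rfl

end ParametricIntegral

/-! ### From local to global along an interval. -/

section IntervalChain

/-- A reflexive and transitive relation that holds locally on an interval holds on all of it. -/
theorem Icc_chain {a b : ℝ} {R : ℝ → ℝ → Prop} (hrefl : ∀ x ∈ Icc a b, R x x)
    (htrans : ∀ x ∈ Icc a b, ∀ y ∈ Icc a b, ∀ z ∈ Icc a b, x ≤ y → y ≤ z → R x y → R y z → R x z)
    (hloc : ∀ s ∈ Icc a b, ∃ δ > 0, ∀ x ∈ Icc a b, ∀ y ∈ Icc a b, |x - s| < δ → |y - s| < δ →
      x ≤ y → R x y) :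
    ∀ x ∈ Icc a b, ∀ y ∈ Icc a b, x ≤ y → R x y := by
  intro x hx y hy hxy
  have hsub : ∀ t ∈ Icc x y, t ∈ Icc a b := fun t ht ↦ ⟨hx.1.trans ht.1, ht.2.trans hy.2⟩
  choose! δ hδ hR using hloc
  -- A subdivision of `[x, y]` subordinate to the cover by intervals on which `R` holds; it equals
  -- `y` from index `m` on.
  obtain ⟨t, ht0, htm, ⟨m, htm'⟩, hcov⟩ := exists_monotone_Icc_subset_open_cover_Icc hxy
    (c := fun s : Icc x y ↦ Subtype.val ⁻¹' Metric.ball (s : ℝ) (δ s))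
    (fun s ↦ Metric.isOpen_ball.preimage continuous_subtype_val)
    (fun s _ ↦ mem_iUnion.2 ⟨s, Metric.mem_ball_self (hδ _ (hsub _ s.2))⟩)
  have key : ∀ n, R x (t n) := by
    intro n
    induction n with
    | zero => rw [ht0]; exact hrefl x hx
    | succ n ih =>
      obtain ⟨s, hs⟩ := hcov n
      have hle : t n ≤ t (n + 1) := htm (Nat.le_succ n)
      have h1 := hs ⟨le_rfl, hle⟩
      have h2 := hs ⟨hle, le_rfl⟩
      simp only [mem_preimage, Metric.mem_ball, Real.dist_eq] at h1 h2
      exact htrans x hx _ (hsub _ (t n).2) _ (hsub _ (t (n + 1)).2) (t n).2.1 hle ih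
        (hR s (hsub _ s.2) _ (hsub _ (t n).2) _ (hsub _ (t (n + 1)).2) h1 h2 hle)
  have := key m
  rwa [htm' m le_rfl] at this

end IntervalChain

/-! ### Derivatives of charts and of maps read in charts. -/

section ChartDeriv

variable {F : Type*} [NormedAddCommGroup F] [NormedSpace ℝ F]
  {H : Type*} [TopologicalSpace H] (I : ModelWithCorners ℝ F H)
  {N : Type*} [TopologicalSpace N] [ChartedSpace H N]
  {F' : Type*} [NormedAddCommGroup F'] [NormedSpace ℝ F']
  {H' : Type*} [TopologicalSpace H'] (I' : ModelWithCorners ℝ F' H')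
  {N' : Type*} [TopologicalSpace N'] [ChartedSpace H' N']

/-- The derivative at `ξ` of the preferred chart at `c`, with values in the model space. -/
abbrev chartDeriv (c ξ : N) : TangentSpace I ξ →L[ℝ] F := mvfderiv I (extChartAt I c) ξ

/-- The derivative at `z` of the inverse of the preferred chart at `c`. -/
def chartSymmDeriv (c : N) (z : F) : F →L[ℝ] TangentSpace I ((extChartAt I c).symm z) :=
  (mfderivWithin 𝓘(ℝ, F) I (extChartAt I c).symm (range I) z).comp
      ((NormedSpace.fromTangentSpace (𝕜 := ℝ) z).symm : F →L[ℝ] TangentSpace 𝓘(ℝ, F) z)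

variable {I I'}

lemma formInChart_eq {k : ℕ} (c : N) (β : DiffForm I N k) (z : F) :
    formInChart I c β z = (β ((extChartAt I c).symm z)).compContinuousLinearMap
      (chartSymmDeriv I c z) := rfl

variable [IsManifold I 1 N] [IsManifold I' 1 N']

lemma chartDeriv_chartSymmDeriv {c : N} {z : F} (hz : z ∈ (extChartAt I c).target) (u : F) :
    chartDeriv I c ((extChartAt I c).symm z) (chartSymmDeriv I c z u) = u :=
  congr($(mfderiv_extChartAt_comp_mfderivWithin_extChartAt_symm hz) u)

lemma chartSymmDeriv_chartDeriv {c : N} {z : F} (hz : z ∈ (extChartAt I c).target)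
    (v : TangentSpace I ((extChartAt I c).symm z)) :
    chartSymmDeriv I c z (chartDeriv I c ((extChartAt I c).symm z) v) = v :=
  congr($(mfderivWithin_extChartAt_symm_comp_mfderiv_extChartAt hz) v)

lemma chartDeriv_bijective {c ξ : N} (h : ξ ∈ (chartAt H c).source) :
    Function.Bijective (chartDeriv I c ξ) :=
  (isInvertible_mfderiv_extChartAt (I := I) (by rwa [extChartAt_source])).bijective

lemma hasMFDerivAt_chartDeriv {c ξ : N} (h : ξ ∈ (chartAt H c).source) :
    HasMFDerivAt I 𝓘(ℝ, F) (extChartAt I c) ξ (mfderiv I 𝓘(ℝ, F) (extChartAt I c) ξ) :=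
  (mdifferentiableAt_extChartAt h).hasMFDerivAt

lemma HasMFDerivWithinAt.hasDerivWithinAt_chart {γ : ℝ → N} {s : Set ℝ} {t : ℝ} {c : N}
    {X : TangentSpace I (γ t)}
    (h : HasMFDerivWithinAt 𝓘(ℝ, ℝ) I γ s t ((1 : ℝ →L[ℝ] ℝ).smulRight X))
    (hc : γ t ∈ (chartAt H c).source) :
    HasDerivWithinAt (fun s ↦ extChartAt I c (γ s)) (chartDeriv I c (γ t) X) s t := by
  have h1 := ((hasMFDerivAt_chartDeriv (I := I) hc).comp_hasMFDerivWithinAt t h).hasFDerivWithinAt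
  have h2 : (mfderiv I 𝓘(ℝ, F) (extChartAt I c) (γ t)).comp ((1 : ℝ →L[ℝ] ℝ).smulRight X) =
      ((1 : ℝ →L[ℝ] ℝ).smulRight (chartDeriv I c (γ t) X) : ℝ →L[ℝ] F) := by
    ext
    exact congr(chartDeriv I c (γ t) $(one_smul ℝ X)).trans (one_smul ℝ _).symm
  exact hasDerivWithinAt_iff_hasFDerivWithinAt.2 (h1.congr_fderiv h2)

lemma fderiv_chart_apply [I.Boundaryless] {f : N → N'} {ξ c : N} {c' : N'}
    (hf : MDifferentiableAt I I' f ξ)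
    (hξ : ξ ∈ (chartAt H c).source) (hf' : f ξ ∈ (chartAt H' c').source) (v : TangentSpace I ξ) :
    chartDeriv I' c' (f ξ) (mfderiv I I' f ξ v) =
      fderiv ℝ (fun z ↦ extChartAt I' c' (f ((extChartAt I c).symm z))) (extChartAt I c ξ)
        (chartDeriv I c ξ v) := by
  have hξ' : ξ ∈ (extChartAt I c).source := by rwa [extChartAt_source]
  have hz := (extChartAt I c).map_source hξ'
  have hsymm : MDifferentiableAt 𝓘(ℝ, F) I (extChartAt I c).symm (extChartAt I c ξ) := by
    have := mdifferentiableWithinAt_extChartAt_symm hz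
    rwa [I.range_eq_univ, mdifferentiableWithinAt_univ] at this
  have hleft := (extChartAt I c).left_inv hξ'
  have hg : MDifferentiableAt 𝓘(ℝ, F) 𝓘(ℝ, F')
      (fun z ↦ extChartAt I' c' (f ((extChartAt I c).symm z))) (extChartAt I c ξ) := by
    refine MDifferentiableAt.comp (I' := I') (extChartAt I c ξ)
      (g := extChartAt I' c') (f := fun z ↦ f ((extChartAt I c).symm z)) ?_ ?_
    · exact mdifferentiableAt_extChartAt (by rwa [hleft])
    · refine MDifferentiableAt.comp (I' := I) (extChartAt I c ξ) (g := f) ?_ hsymm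
      rwa [hleft]
  have h1 := hg.hasMFDerivAt.comp ξ (hasMFDerivAt_chartDeriv (I := I) hξ)
  have h2 := (hasMFDerivAt_chartDeriv (I := I') hf').comp ξ hf.hasMFDerivAt
  have heq : (fun z ↦ extChartAt I' c' (f ((extChartAt I c).symm z))) ∘ (extChartAt I c)
      =ᶠ[𝓝 ξ] extChartAt I' c' ∘ f := by
    filter_upwards [(isOpen_extChartAt_source (I := I) c).mem_nhds hξ'] with y hy
    exact congr(extChartAt I' c' (f $((extChartAt I c).left_inv hy)))
  have h3 := hasMFDerivAt_unique (h1.congr_of_eventuallyEq heq.symm) h2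
  rw [mfderiv_eq_fderiv] at h3
  exact congr($h3 v).symm

/-- Smoothness of vector fields is defined through the trivialisations of the tangent bundle; this
translates it into chart derivatives. -/
lemma trivializationAt_snd_eq_chartDeriv {c ξ : N} (h : ξ ∈ (chartAt H c).source)
    (v : TangentSpace I ξ) :
    (trivializationAt F (TangentSpace I) c (⟨ξ, v⟩ : TangentBundle I N)).2 =
      chartDeriv I c ξ v := by
  have := TangentBundle.continuousLinearMapAt_trivializationAt (I := I) h
  have h2 : (trivializationAt F (TangentSpace I) c).continuousLinearMapAt ℝ ξ v =
      chartDeriv I c ξ v := congr($this v)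
  rw [← h2, Trivialization.continuousLinearMapAt_apply,
    Trivialization.linearMapAt_apply, if_pos (by simpa using h)]

end ChartDeriv

/-! ### Smooth vector fields in charts. -/

section SmoothFields

variable {F : Type*} [NormedAddCommGroup F] [NormedSpace ℝ F]
  {H : Type*} [TopologicalSpace H] {I : ModelWithCorners ℝ F H}
  {N : Type*} [TopologicalSpace N] [ChartedSpace H N] [IsManifold I ∞ N]
  {F₁ : Type*} [NormedAddCommGroup F₁] [NormedSpace ℝ F₁]
  {H₁ : Type*} [TopologicalSpace H₁] {I₁ : ModelWithCorners ℝ F₁ H₁}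
  {N₁ : Type*} [TopologicalSpace N₁] [ChartedSpace H₁ N₁]

/-- Smoothness of a vector field along a map, read in a chart. -/
lemma contMDiffWithinAt_field_iff [IsManifold I 1 N] {f : N₁ → N} {X : Π p : N₁, TangentSpace I (f p)}
    {s : Set N₁} {p : N₁} {c : N} (hc : f p ∈ (chartAt H c).source) :
    ContMDiffWithinAt I₁ I.tangent ∞ (fun q ↦ (⟨f q, X q⟩ : TangentBundle I N)) s p ↔
      ContMDiffWithinAt I₁ I ∞ f s p ∧
        ContMDiffWithinAt I₁ 𝓘(ℝ, F) ∞ (fun q ↦ chartDeriv I c (f q) (X q)) s p := by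
  rw [ModelWithCorners.tangent, Trivialization.contMDiffWithinAt_iff
    (e := trivializationAt F (TangentSpace I) c)
    (by simpa [TangentBundle.trivializationAt_source] using hc)]
  refine and_congr_right fun hf ↦ ?_
  refine Filter.EventuallyEq.contMDiffWithinAt_iff ?_ (trivializationAt_snd_eq_chartDeriv hc _)
  filter_upwards [hf.continuousWithinAt.preimage_mem_nhdsWithin
    ((chartAt H c).open_source.mem_nhds hc)] with q hq
  exact trivializationAt_snd_eq_chartDeriv hq _

/-- The expression of a smooth vector field in a chart is smooth. -/
lemma contDiffOn_field_chart [IsManifold I 1 N] [I.Boundaryless] {V : Π ξ : N, TangentSpace I ξ} {Ω : Set N}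
    (hV : ContMDiffOn I I.tangent ∞ (fun ξ ↦ (⟨ξ, V ξ⟩ : TangentBundle I N)) Ω) (c : N) :
    ContDiffOn ℝ ∞ (fun z ↦ chartDeriv I c ((extChartAt I c).symm z) (V ((extChartAt I c).symm z)))
      ((extChartAt I c).target ∩ (extChartAt I c).symm ⁻¹' Ω) := by
  rw [← contMDiffOn_iff_contDiffOn]
  intro z hz
  have hs : (extChartAt I c).symm z ∈ (chartAt H c).source := by
    rw [← extChartAt_source I]; exact (extChartAt I c).map_target hz.1
  have h1 := ((contMDiffWithinAt_field_iff (X := V) (f := id) hs).1 (hV _ hz.2)).2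
  exact ContMDiffWithinAt.comp (I' := I) z h1
    ((contMDiffOn_extChartAt_symm c z hz.1).mono inter_subset_left) (fun y hy ↦ hy.2)

/-- The time-dependent version of `contDiffOn_field_chart`. -/
lemma contDiffWithinAt_timeField_chart [IsManifold I 1 N] [I.Boundaryless] {X : ℝ → Π ξ : N, TangentSpace I ξ}
    {J : Set ℝ} {D : Set N}
    (hX : ContMDiffOn (𝓘(ℝ, ℝ).prod I) I.tangent ∞
      (fun p : ℝ × N ↦ (⟨p.2, X p.1 p.2⟩ : TangentBundle I N)) (J ×ˢ D)) (c : N) :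
    ContDiffOn ℝ ∞ (fun p : ℝ × F ↦
        chartDeriv I c ((extChartAt I c).symm p.2) (X p.1 ((extChartAt I c).symm p.2)))
      (J ×ˢ ((extChartAt I c).target ∩ (extChartAt I c).symm ⁻¹' D)) := by
  rw [← contMDiffOn_iff_contDiffOn]
  intro p hp
  have hs : (extChartAt I c).symm p.2 ∈ (chartAt H c).source := by
    rw [← extChartAt_source I]; exact (extChartAt I c).map_target hp.2.1
  have h1 := ((contMDiffWithinAt_field_iff (X := fun p : ℝ × N ↦ X p.1 p.2)
    (f := fun p : ℝ × N ↦ p.2) (p := (p.1, (extChartAt I c).symm p.2)) hs).1 (hX (p.1, (extChartAt I c).symm p.2) ⟨hp.1, hp.2.2⟩)).2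
  have h2 : ContMDiffWithinAt 𝓘(ℝ, ℝ × F) (𝓘(ℝ, ℝ).prod I) ∞
      (fun p : ℝ × F ↦ (p.1, (extChartAt I c).symm p.2))
      (J ×ˢ ((extChartAt I c).target ∩ (extChartAt I c).symm ⁻¹' D)) p := by
    refine ContMDiffWithinAt.prodMk ?_ ?_
    · exact contMDiffWithinAt_iff_contDiffWithinAt.2 contDiff_fst.contDiffAt.contDiffWithinAt
    · exact ContMDiffWithinAt.comp (I' := 𝓘(ℝ, F)) p (contMDiffOn_extChartAt_symm c p.2 hp.2.1)
        (contMDiffWithinAt_iff_contDiffWithinAt.2 contDiff_snd.contDiffAt.contDiffWithinAt)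
        (fun q hq ↦ hq.2.1)
  exact ContMDiffWithinAt.comp (I' := 𝓘(ℝ, ℝ).prod I) (t := J ×ˢ D) p h1 h2
    (fun q hq ↦ ⟨hq.1, hq.2.2⟩)

end SmoothFields

/-! ### Uniqueness of integral curves of time-dependent vector fields. -/

section Uniqueness

variable {F : Type*} [NormedAddCommGroup F] [NormedSpace ℝ F]
  {H : Type*} [TopologicalSpace H] {I : ModelWithCorners ℝ F H} [I.Boundaryless]
  {N : Type*} [TopologicalSpace N] [ChartedSpace H N] [IsManifold I ∞ N]

/-- Local form of the uniqueness of integral curves of time-dependent vector fields. -/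
lemma eqOn_integralCurves_local [IsManifold I 1 N] {X : ℝ → Π ξ : N, TangentSpace I ξ} {a b : ℝ} {D : Set N}
    (hD : IsOpen D)
    (hX : ContMDiffOn (𝓘(ℝ, ℝ).prod I) I.tangent ∞
      (fun p : ℝ × N ↦ (⟨p.2, X p.1 p.2⟩ : TangentBundle I N)) (Icc a b ×ˢ D))
    {γ₁ γ₂ : ℝ → N}
    (h₁ : ∀ t ∈ Icc a b, γ₁ t ∈ D ∧ HasMFDerivWithinAt 𝓘(ℝ, ℝ) I γ₁ (Icc a b) t
      ((1 : ℝ →L[ℝ] ℝ).smulRight (X t (γ₁ t))))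
    (h₂ : ∀ t ∈ Icc a b, γ₂ t ∈ D ∧ HasMFDerivWithinAt 𝓘(ℝ, ℝ) I γ₂ (Icc a b) t
      ((1 : ℝ →L[ℝ] ℝ).smulRight (X t (γ₂ t))))
    {s : ℝ} (hs : s ∈ Icc a b) (heq : γ₁ s = γ₂ s) :
    ∃ δ > 0, ∀ x ∈ Icc a b, ∀ y ∈ Icc a b, |x - s| < δ → |y - s| < δ →
      x ≤ y → (γ₁ x = γ₂ x ↔ γ₁ y = γ₂ y) := by
  set c := γ₁ s with hc
  set κ := extChartAt I c with hκ
  set O : Set F := κ.target ∩ κ.symm ⁻¹' D with hO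
  have hOo : IsOpen O :=
    (continuousOn_extChartAt_symm c).isOpen_inter_preimage (isOpen_extChartAt_target c) hD
  have hcs : c ∈ κ.source := mem_extChartAt_source c
  have hzO : κ c ∈ O := ⟨κ.map_source hcs, by
    change κ.symm (κ c) ∈ D
    rw [κ.left_inv hcs]; exact (h₁ s hs).1⟩
  obtain ⟨r, hr, hrO⟩ := Metric.isOpen_iff.1 hOo _ hzO
  set Y : ℝ × F → F := fun p ↦ chartDeriv I c (κ.symm p.2) (X p.1 (κ.symm p.2)) with hY
  have hYs : ContDiffOn ℝ ∞ Y (Icc a b ×ˢ O) := contDiffWithinAt_timeField_chart hX c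
  -- At the end times smoothness is only one-sided; since the product of the interval with a ball is
  -- convex, a Lipschitz constant is still available.
  have hYw : ContDiffWithinAt ℝ 1 Y (Icc a b ×ˢ Metric.ball (κ c) r) (s, κ c) :=
    ((hYs (s, κ c) ⟨hs, hzO⟩).mono (prod_mono_right hrO)).of_le (by exact_mod_cast le_top)
  obtain ⟨K, T, hT, hlip⟩ :=
    hYw.exists_lipschitzOnWith ((convex_Icc a b).prod (convex_ball _ _))
  rw [nhdsWithin_prod_eq] at hT
  obtain ⟨T₁, hT₁, T₂, hT₂, hTT⟩ := Filter.mem_prod_iff.1 hT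
  have hT₂' : T₂ ∈ 𝓝 (κ c) := by
    rwa [nhdsWithin_eq_nhds.2 (Metric.ball_mem_nhds _ hr)] at hT₂
  -- both curves stay close to `c` for times close to `s`
  have hnear : ∀ γ : ℝ → N, (∀ t ∈ Icc a b, γ t ∈ D ∧ HasMFDerivWithinAt 𝓘(ℝ, ℝ) I γ (Icc a b) t
      ((1 : ℝ →L[ℝ] ℝ).smulRight (X t (γ t)))) → γ s = c →
      ∀ᶠ t in 𝓝[Icc a b] s, γ t ∈ κ.source ∧ κ (γ t) ∈ T₂ := by
    intro γ hγ hγs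
    have hcont : Filter.Tendsto γ (𝓝[Icc a b] s) (𝓝 c) := by
      rw [← hγs]; exact (hγ s hs).2.continuousWithinAt
    have h1 : ∀ᶠ x in 𝓝 c, x ∈ κ.source ∧ κ x ∈ T₂ :=
      ((isOpen_extChartAt_source c).eventually_mem hcs).and
        ((continuousAt_extChartAt c).preimage_mem_nhds hT₂')
    exact hcont.eventually h1
  have hev := ((hnear γ₁ h₁ rfl).and (hnear γ₂ h₂ heq.symm)).and hT₁
  rw [eventually_nhdsWithin_iff, Metric.eventually_nhds_iff] at hev
  obtain ⟨δ, hδ, hev⟩ := hev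
  refine ⟨δ, hδ, fun x hx y hy hxs hys hxy ↦ ?_⟩
  have hsub : ∀ t ∈ Icc x y, t ∈ Icc a b ∧ |t - s| < δ := fun t ht ↦
    ⟨⟨hx.1.trans ht.1, ht.2.trans hy.2⟩, by
      rw [abs_lt] at hxs hys ⊢; constructor <;> linarith [ht.1, ht.2]⟩
  have hgood : ∀ t ∈ Icc x y, ((γ₁ t ∈ κ.source ∧ κ (γ₁ t) ∈ T₂) ∧
      (γ₂ t ∈ κ.source ∧ κ (γ₂ t) ∈ T₂)) ∧ t ∈ T₁ := fun t ht ↦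
    hev (by rw [Real.dist_eq]; exact (hsub t ht).2) (hsub t ht).1
  have hder : ∀ γ : ℝ → N, (∀ t ∈ Icc a b, γ t ∈ D ∧
      HasMFDerivWithinAt 𝓘(ℝ, ℝ) I γ (Icc a b) t
        ((1 : ℝ →L[ℝ] ℝ).smulRight (X t (γ t)))) → (∀ t ∈ Icc x y, γ t ∈ κ.source) →
      ∀ t ∈ Icc x y, HasDerivWithinAt (fun t ↦ κ (γ t)) (Y (t, κ (γ t))) (Icc x y) t := by
    intro γ hγ hγs t ht
    have h := ((hγ t (hsub t ht).1).2.mono (fun u hu ↦ (hsub u hu).1 : Icc x y ⊆ Icc a b)).hasDerivWithinAt_chart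
      (c := c) (by simpa [hκ] using hγs t ht)
    have e : κ.symm (κ (γ t)) = γ t := κ.left_inv (hγs t ht)
    convert h using 1
    simp only [hY]
    rw [e]
  have hd1 := hder γ₁ h₁ fun t ht ↦ (hgood t ht).1.1.1
  have hd2 := hder γ₂ h₂ fun t ht ↦ (hgood t ht).1.2.1
  have hlip' : ∀ t ∈ Icc x y, LipschitzOnWith K (fun z ↦ Y (t, z)) T₂ := by
    intro t ht z hz w hw
    simpa [Prod.edist_eq] using
      hlip (hTT ⟨(hgood t ht).2, hz⟩ : (t, z) ∈ T) (hTT ⟨(hgood t ht).2, hw⟩ : (t, w) ∈ T)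
  have hinj : ∀ t ∈ Icc x y, κ (γ₁ t) = κ (γ₂ t) → γ₁ t = γ₂ t := fun t ht h ↦
    κ.injOn (hgood t ht).1.1.1 (hgood t ht).1.2.1 h
  have hc1 : ContinuousOn (fun t ↦ κ (γ₁ t)) (Icc x y) := fun t ht ↦ (hd1 t ht).continuousWithinAt
  have hc2 : ContinuousOn (fun t ↦ κ (γ₂ t)) (Icc x y) := fun t ht ↦ (hd2 t ht).continuousWithinAt
  constructor
  · intro hxe
    refine hinj y ⟨hxy, le_rfl⟩ (ODE_solution_unique_of_mem_Icc_right
      (v := fun t z ↦ Y (t, z)) (s := fun _ ↦ T₂)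
      (fun t ht ↦ hlip' t (Ico_subset_Icc_self ht)) hc1 (fun t ht ↦ ?_)
      (fun t ht ↦ (hgood t (Ico_subset_Icc_self ht)).1.1.2) hc2 (fun t ht ↦ ?_)
      (fun t ht ↦ (hgood t (Ico_subset_Icc_self ht)).1.2.2) (by rw [hxe]) ⟨hxy, le_rfl⟩)
    · exact (hd1 t (Ico_subset_Icc_self ht)).mono_of_mem_nhdsWithin (Icc_mem_nhdsGE_of_mem ht)
    · exact (hd2 t (Ico_subset_Icc_self ht)).mono_of_mem_nhdsWithin (Icc_mem_nhdsGE_of_mem ht)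
  · intro hye
    refine hinj x ⟨le_rfl, hxy⟩ (ODE_solution_unique_of_mem_Icc_left
      (v := fun t z ↦ Y (t, z)) (s := fun _ ↦ T₂)
      (fun t ht ↦ hlip' t (Ioc_subset_Icc_self ht)) hc1 (fun t ht ↦ ?_)
      (fun t ht ↦ (hgood t (Ioc_subset_Icc_self ht)).1.1.2) hc2 (fun t ht ↦ ?_)
      (fun t ht ↦ (hgood t (Ioc_subset_Icc_self ht)).1.2.2) (by rw [hye]) ⟨le_rfl, hxy⟩)
    · exact (hd1 t (Ioc_subset_Icc_self ht)).mono_of_mem_nhdsWithin (Icc_mem_nhdsLE_of_mem ht)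
    · exact (hd2 t (Ioc_subset_Icc_self ht)).mono_of_mem_nhdsWithin (Icc_mem_nhdsLE_of_mem ht)

/-- Two integral curves of a smooth time-dependent vector field that meet are equal. -/
theorem eqOn_integralCurves [T2Space N] [IsManifold I 1 N] {X : ℝ → Π ξ : N, TangentSpace I ξ} {a b : ℝ}
    {D : Set N} (hD : IsOpen D)
    (hX : ContMDiffOn (𝓘(ℝ, ℝ).prod I) I.tangent ∞
      (fun p : ℝ × N ↦ (⟨p.2, X p.1 p.2⟩ : TangentBundle I N)) (Icc a b ×ˢ D))
    {γ₁ γ₂ : ℝ → N}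
    (h₁ : ∀ t ∈ Icc a b, γ₁ t ∈ D ∧ HasMFDerivWithinAt 𝓘(ℝ, ℝ) I γ₁ (Icc a b) t
      ((1 : ℝ →L[ℝ] ℝ).smulRight (X t (γ₁ t))))
    (h₂ : ∀ t ∈ Icc a b, γ₂ t ∈ D ∧ HasMFDerivWithinAt 𝓘(ℝ, ℝ) I γ₂ (Icc a b) t
      ((1 : ℝ →L[ℝ] ℝ).smulRight (X t (γ₂ t))))
    {s : ℝ} (hs : s ∈ Icc a b) (heq : γ₁ s = γ₂ s) {t : ℝ} (ht : t ∈ Icc a b) :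
    γ₁ t = γ₂ t := by
  -- Agreement at one time being equivalent to agreement at another is a transitive relation. Near a
  -- time of agreement it follows from local uniqueness, near any other time from the Hausdorff
  -- property.
  have key : ∀ x ∈ Icc a b, ∀ y ∈ Icc a b, x ≤ y → (γ₁ x = γ₂ x ↔ γ₁ y = γ₂ y) := by
    refine Icc_chain (fun _ _ ↦ Iff.rfl) (fun _ _ _ _ _ _ _ _ h h' ↦ h.trans h') fun s hs ↦ ?_
    by_cases hse : γ₁ s = γ₂ s
    · exact eqOn_integralCurves_local hD hX h₁ h₂ hs hse
    · have h := ((h₁ s hs).2.continuousWithinAt.prodMk (h₂ s hs).2.continuousWithinAt).eventually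
        ((isClosed_diagonal (X := N)).isOpen_compl.mem_nhds hse)
      rw [eventually_nhdsWithin_iff, Metric.eventually_nhds_iff] at h
      obtain ⟨δ, hδ, h⟩ := h
      refine ⟨δ, hδ, fun x hx y hy hxs hys _ ↦ ?_⟩
      exact iff_of_false (h (by rwa [Real.dist_eq]) hx) (h (by rwa [Real.dist_eq]) hy)
  rcases le_total s t with hst | hst
  · exact (key s hs t ht hst).1 heq
  · exact (key t ht s hs hst).2 heq

end Uniqueness

/-! ### Smooth flows on manifolds, near a compact integral curve. -/

section ManifoldFlow

variable {F : Type*} [NormedAddCommGroup F] [NormedSpace ℝ F]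
  {H : Type*} [TopologicalSpace H] {I : ModelWithCorners ℝ F H}
  {N : Type*} [TopologicalSpace N] [ChartedSpace H N]

/-- `ψ` is a smooth flow of the field `V`, remaining in `Ω`, for the times in the open interval
`J ∋ 0` and the initial points in the open set `O`. -/
structure IsSmoothFlow (I : ModelWithCorners ℝ F H) (V : Π ξ : N, TangentSpace I ξ) (Ω : Set N)
    (J : Set ℝ) (O : Set N) (ψ : ℝ → N → N) : Prop where
  isOpen : IsOpen O
  smooth : ContMDiffOn (𝓘(ℝ, ℝ).prod I) I ∞ (fun p : ℝ × N ↦ ψ p.1 p.2) (J ×ˢ O)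
  initial : ∀ x ∈ O, ψ 0 x = x
  mem : ∀ x ∈ O, ∀ t ∈ J, ψ t x ∈ Ω
  deriv : ∀ x ∈ O, ∀ t ∈ J,
    HasMFDerivAt 𝓘(ℝ, ℝ) I (fun s ↦ ψ s x) t ((1 : ℝ →L[ℝ] ℝ).smulRight (V (ψ t x)))

variable [I.Boundaryless] [IsManifold I ∞ N] {V : Π ξ : N, TangentSpace I ξ} {Ω : Set N}

lemma hasMFDerivWithinAt_chart_symm [IsManifold I 1 N] {c : N} {γ : ℝ → F} {t : ℝ} {u : F}
    (hz : γ t ∈ (extChartAt I c).target) (h : HasDerivAt γ u t) :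
    HasMFDerivAt 𝓘(ℝ, ℝ) I (fun s ↦ (extChartAt I c).symm (γ s)) t
      ((1 : ℝ →L[ℝ] ℝ).smulRight (chartSymmDeriv I c (γ t) u)) := by
  have h1 : HasMFDerivAt 𝓘(ℝ, F) I (extChartAt I c).symm (γ t)
      (mfderivWithin 𝓘(ℝ, F) I (extChartAt I c).symm (range I) (γ t)) := by
    have := (mdifferentiableWithinAt_extChartAt_symm hz).hasMFDerivWithinAt
    have hr : range I ∈ 𝓝 (γ t) := by rw [I.range_eq_univ]; exact Filter.univ_mem
    exact this.hasMFDerivAt hr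
  have h2 := h1.comp t (hasMFDerivAt_iff_hasFDerivAt.2 h.hasFDerivAt)
  refine h2.congr_mfderiv ?_
  ext
  exact congr(chartSymmDeriv I c (γ t) $(one_smul ℝ u)).trans (one_smul ℝ _).symm

theorem exists_isSmoothFlow_local [IsManifold I 1 N] [CompleteSpace F] (hΩ : IsOpen Ω)
    (hV : ContMDiffOn I I.tangent ∞ (fun ξ ↦ (⟨ξ, V ξ⟩ : TangentBundle I N)) Ω) {c : N}
    (hc : c ∈ Ω) :
    ∃ δ > 0, ∃ O : Set N, c ∈ O ∧ ∃ ψ, IsSmoothFlow I V Ω (Ioo (-δ) δ) O ψ := by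
  set κ := extChartAt I c with hκ
  have hcs : c ∈ κ.source := mem_extChartAt_source c
  set Ω' : Set F := κ.target ∩ κ.symm ⁻¹' Ω with hΩ'
  have hΩo : IsOpen Ω' :=
    (continuousOn_extChartAt_symm c).isOpen_inter_preimage (isOpen_extChartAt_target c) hΩ
  have hzΩ : κ c ∈ Ω' := ⟨κ.map_source hcs, by
    change κ.symm (κ c) ∈ Ω
    rw [κ.left_inv hcs]; exact hc⟩
  obtain ⟨δ, hδ, r, hr, ψ, hψ, hψ'⟩ := exists_contDiffOn_localFlow hΩo (contDiffOn_field_chart hV c) hzΩ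
  refine ⟨δ, hδ, κ.source ∩ κ ⁻¹' Metric.ball (κ c) r, ⟨hcs, Metric.mem_ball_self hr⟩,
    fun t x ↦ κ.symm (ψ (t, κ x)), ?_, ?_, ?_, ?_, ?_⟩
  · exact (continuousOn_extChartAt c).isOpen_inter_preimage (isOpen_extChartAt_source c)
      Metric.isOpen_ball
  · have h1 : ContMDiffOn (𝓘(ℝ, ℝ).prod I) 𝓘(ℝ, ℝ × F) ∞ (fun p : ℝ × N ↦ (p.1, κ p.2))
        (Ioo (-δ) δ ×ˢ (κ.source ∩ κ ⁻¹' Metric.ball (κ c) r)) := by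
      have : ContMDiffOn (𝓘(ℝ, ℝ).prod I) 𝓘(ℝ, F) ∞ (fun p : ℝ × N ↦ κ p.2)
          (Ioo (-δ) δ ×ˢ (κ.source ∩ κ ⁻¹' Metric.ball (κ c) r)) := by
        have h2 : ContMDiffOn I 𝓘(ℝ, F) ∞ κ κ.source := by
          rw [hκ, extChartAt_source]; exact contMDiffOn_extChartAt
        exact h2.comp contMDiff_snd.contMDiffOn (fun p hp ↦ hp.2.1)
      exact contMDiffOn_fst.prodMk_space this
    have h3 := (contMDiffOn_iff_contDiffOn.2 hψ).comp h1 (fun p hp ↦ ⟨hp.1, hp.2.2⟩)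
    exact (contMDiffOn_extChartAt_symm c).comp h3
      (fun p hp ↦ ((hψ' _ hp.2.2).2 _ hp.1).1.1)
  · intro x hx
    rw [(hψ' _ hx.2).1, κ.left_inv hx.1]
  · intro x hx t ht
    exact ((hψ' _ hx.2).2 t ht).1.2
  · intro x hx t ht
    have h1 := ((hψ' _ hx.2).2 t ht)
    have h2 := hasMFDerivWithinAt_chart_symm (I := I) (c := c) h1.1.1 h1.2
    rwa [chartSymmDeriv_chartDeriv h1.1.1] at h2

lemma contMDiffOn_timeField {J : Set ℝ}
    (hV : ContMDiffOn I I.tangent ∞ (fun ξ ↦ (⟨ξ, V ξ⟩ : TangentBundle I N)) Ω) :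
    ContMDiffOn (𝓘(ℝ, ℝ).prod I) I.tangent ∞
      (fun p : ℝ × N ↦ (⟨p.2, V p.2⟩ : TangentBundle I N)) (J ×ˢ Ω) :=
  hV.comp contMDiff_snd.contMDiffOn (fun _ hp ↦ hp.2)

/-- Composition of two flows defined for times up to `a` and on `(-δ', δ')`. -/
lemma IsSmoothFlow.extend [IsManifold I 1 N] [T2Space N] (hΩ : IsOpen Ω)
    (hV : ContMDiffOn I I.tangent ∞ (fun ξ ↦ (⟨ξ, V ξ⟩ : TangentBundle I N)) Ω)
    {a δ δ' : ℝ} (ha : 0 ≤ a) (hδ : 0 < δ) (hδ' : 0 < δ') {O O' : Set N} {ψ ψ' : ℝ → N → N}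
    (h : IsSmoothFlow I V Ω (Ioo (-δ) (a + δ)) O ψ)
    (h' : IsSmoothFlow I V Ω (Ioo (-δ') δ') O' ψ') :
    ∃ ψ'', IsSmoothFlow I V Ω (Ioo (-δ) (a + δ')) (O ∩ ψ a ⁻¹' O') ψ'' := by
  have haJ : a ∈ Ioo (-δ) (a + δ) := ⟨by linarith, by linarith⟩
  have hψa : ContMDiffOn I I ∞ (ψ a) O :=
    h.smooth.comp (contMDiffOn_const.prodMk contMDiffOn_id) (fun x hx ↦ ⟨haJ, hx⟩)
  set O₂ := O ∩ ψ a ⁻¹' O' with hO₂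
  have hO₂o : IsOpen O₂ := hψa.continuousOn.isOpen_inter_preimage h.isOpen h'.isOpen
  set η := min δ δ' with hη
  have hη0 : 0 < η := lt_min hδ hδ'
  have hηδ : η ≤ δ := min_le_left _ _
  have hηδ' : η ≤ δ' := min_le_right _ _
  -- derivative of the shifted flow
  have hder' : ∀ x ∈ O₂, ∀ t ∈ Ioo (a - δ') (a + δ'),
      HasMFDerivAt 𝓘(ℝ, ℝ) I (fun s ↦ ψ' (s - a) (ψ a x)) t
        ((1 : ℝ →L[ℝ] ℝ).smulRight (V (ψ' (t - a) (ψ a x)))) := by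
    intro x hx t ht
    have h1 := h'.deriv (ψ a x) hx.2 (t - a) ⟨by linarith [ht.1], by linarith [ht.2]⟩
    have h2 : HasMFDerivAt 𝓘(ℝ, ℝ) 𝓘(ℝ, ℝ) (fun s ↦ s - a) t (ContinuousLinearMap.id ℝ ℝ) :=
      hasMFDerivAt_iff_hasFDerivAt.2 ((hasFDerivAt_id t).sub_const a)
    have h3 := HasMFDerivAt.comp t h1 h2
    exact h3
  have hagree : ∀ x ∈ O₂, ∀ t ∈ Ioo (a - η) (a + η), ψ t x = ψ' (t - a) (ψ a x) := by
    intro x hx t ht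
    have hsub : ∀ u ∈ Icc (a - |t - a|) (a + |t - a|), u ∈ Ioo (a - η) (a + η) := by
      intro u hu
      have : |t - a| < η := abs_lt.2 ⟨by linarith [ht.1], by linarith [ht.2]⟩
      exact ⟨by linarith [hu.1], by linarith [hu.2]⟩
    refine eqOn_integralCurves (X := fun _ ↦ V) (a := a - |t - a|) (b := a + |t - a|) (s := a)
      (γ₁ := fun t ↦ ψ t x) (γ₂ := fun t ↦ ψ' (t - a) (ψ a x)) hΩ
      (contMDiffOn_timeField hV) (fun u hu ↦ ?_) (fun u hu ↦ ?_)
      ⟨by linarith [abs_nonneg (t - a)], by linarith [abs_nonneg (t - a)]⟩ ?_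
      ⟨by linarith [neg_abs_le (t - a)], by linarith [le_abs_self (t - a)]⟩
    · have hu' := hsub u hu
      have hu'' : u ∈ Ioo (-δ) (a + δ) := ⟨by linarith [hu'.1], by linarith [hu'.2]⟩
      exact ⟨h.mem x hx.1 u hu'', (h.deriv x hx.1 u hu'').hasMFDerivWithinAt⟩
    · have hu' := hsub u hu
      exact ⟨h'.mem _ hx.2 _ ⟨by linarith [hu'.1], by linarith [hu'.2]⟩,
        (hder' x hx u ⟨by linarith [hu'.1], by linarith [hu'.2]⟩).hasMFDerivWithinAt⟩
    · simp only [sub_self]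
      exact (h'.initial _ hx.2).symm
  -- The two flows are switched at `a + η`, strictly inside the overlap, so that near every time
  -- `ψ''` agrees with a single one of them.
  set ψ'' : ℝ → N → N := fun t x ↦ if t < a + η then ψ t x else ψ' (t - a) (ψ a x) with hψ''
  have e1 : ∀ x, ∀ t < a + η, ψ'' t x = ψ t x := fun x t ht ↦ if_pos ht
  have e2 : ∀ x ∈ O₂, ∀ t > a - η, ψ'' t x = ψ' (t - a) (ψ a x) := by
    intro x hx t ht
    by_cases hlt : t < a + η
    · rw [e1 x t hlt]; exact hagree x hx t ⟨ht, hlt⟩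
    · exact if_neg hlt
  refine ⟨ψ'', hO₂o, ?_, ?_, ?_, ?_⟩
  · intro p hp
    by_cases hlt : p.1 < a + η
    · have h1 : ContMDiffWithinAt (𝓘(ℝ, ℝ).prod I) I ∞ (fun p : ℝ × N ↦ ψ p.1 p.2)
          (Ioo (-δ) (a + δ') ×ˢ O₂) p := by
        refine (h.smooth.contMDiffAt ?_).contMDiffWithinAt
        exact prod_mem_nhds (Ioo_mem_nhds hp.1.1 (by linarith)) (h.isOpen.mem_nhds hp.2.1)
      refine h1.congr_of_eventuallyEq ?_ (e1 _ _ hlt)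
      filter_upwards [mem_nhdsWithin_of_mem_nhds
        ((isOpen_Iio.preimage continuous_fst).mem_nhds (hlt : p.1 ∈ Iio (a + η)))] with q hq
      exact e1 _ _ hq
    · have hgt : a - η < p.1 := by linarith
      have h1 : ContMDiffWithinAt (𝓘(ℝ, ℝ).prod I) I ∞ (fun p : ℝ × N ↦ ψ' (p.1 - a) (ψ a p.2))
          (Ioo (-δ) (a + δ') ×ˢ O₂) p := by
        have h2 : ContMDiffAt (𝓘(ℝ, ℝ).prod I) I ∞ (fun p : ℝ × N ↦ ψ' p.1 p.2)
            (p.1 - a, ψ a p.2) := h'.smooth.contMDiffAt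
          (prod_mem_nhds (Ioo_mem_nhds (by linarith) (by linarith [hp.1.2]))
            (h'.isOpen.mem_nhds hp.2.2))
        have h3 : ContMDiffAt (𝓘(ℝ, ℝ).prod I) I ∞ (fun p : ℝ × N ↦ ψ a p.2) p :=
          ContMDiffAt.comp p (hψa.contMDiffAt (h.isOpen.mem_nhds hp.2.1)) contMDiffAt_snd
        have h4 : ContMDiffAt (𝓘(ℝ, ℝ).prod I) 𝓘(ℝ, ℝ) ∞ (fun p : ℝ × N ↦ p.1 - a) p :=
          contMDiffAt_fst.sub contMDiffAt_const
        exact (ContMDiffAt.comp p h2 (h4.prodMk h3)).contMDiffWithinAt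
      refine h1.congr_of_eventuallyEq ?_ (e2 _ hp.2 _ hgt)
      filter_upwards [self_mem_nhdsWithin, mem_nhdsWithin_of_mem_nhds
        ((isOpen_Ioi.preimage continuous_fst).mem_nhds (hgt : p.1 ∈ Ioi (a - η)))] with q hq hq'
      exact e2 _ hq.2 _ hq'
  · intro x hx
    rw [e1 x 0 (by linarith), h.initial x hx.1]
  · intro x hx t ht
    by_cases hlt : t < a + η
    · rw [e1 x t hlt]; exact h.mem x hx.1 t ⟨ht.1, by linarith⟩
    · rw [e2 x hx t (by linarith)]
      exact h'.mem _ hx.2 _ ⟨by linarith, by linarith [ht.2]⟩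
  · intro x hx t ht
    by_cases hlt : t < a + η
    · have h1 := h.deriv x hx.1 t ⟨ht.1, by linarith⟩
      rw [← e1 x t hlt] at h1
      refine h1.congr_of_eventuallyEq ?_
      filter_upwards [isOpen_Iio.mem_nhds (hlt : t ∈ Iio (a + η))] with q hq
      exact e1 _ _ hq
    · have hgt : a - η < t := by linarith
      have h1 := hder' x hx t ⟨by linarith, ht.2⟩
      rw [← e2 x hx t hgt] at h1
      refine h1.congr_of_eventuallyEq ?_
      filter_upwards [isOpen_Ioi.mem_nhds (hgt : t ∈ Ioi (a - η))] with q hq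
      exact e2 _ hx _ hq

/-- The flow of a smooth vector field is defined and smooth near a compact integral curve. -/
theorem exists_isSmoothFlow [IsManifold I 1 N] [CompleteSpace F] [T2Space N] (hΩ : IsOpen Ω)
    (hV : ContMDiffOn I I.tangent ∞ (fun ξ ↦ (⟨ξ, V ξ⟩ : TangentBundle I N)) Ω) {γ : ℝ → N}
    (hγ : ∀ t ∈ Icc (0 : ℝ) 1, γ t ∈ Ω ∧ HasMFDerivWithinAt 𝓘(ℝ, ℝ) I γ (Icc 0 1) t
      ((1 : ℝ →L[ℝ] ℝ).smulRight (V (γ t)))) :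
    ∃ δ > 0, ∃ O : Set N, γ 0 ∈ O ∧ ∃ ψ, IsSmoothFlow I V Ω (Ioo (-δ) (1 + δ)) O ψ := by
  -- The relation chained along `[0, 1]` is an implication: a flow near `γ 0` up to time `x` yields
  -- one up to time `y`. Locally it follows by composing with the flow near `γ s`.
  have key : ∀ x ∈ Icc (0 : ℝ) 1, ∀ y ∈ Icc (0 : ℝ) 1, x ≤ y →
      (∃ δ > 0, ∃ O : Set N, γ 0 ∈ O ∧ ∃ ψ, IsSmoothFlow I V Ω (Ioo (-δ) (x + δ)) O ψ) →
      (∃ δ > 0, ∃ O : Set N, γ 0 ∈ O ∧ ∃ ψ, IsSmoothFlow I V Ω (Ioo (-δ) (y + δ)) O ψ) := by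
    refine Icc_chain (fun _ _ ↦ id) (fun _ _ _ _ _ _ _ _ h h' ↦ h' ∘ h) fun s hs ↦ ?_
    obtain ⟨δ', hδ', O', hcO', ψ', h'⟩ := exists_isSmoothFlow_local hΩ hV (hγ s hs).1
    have hev := (hγ s hs).2.continuousWithinAt.eventually (h'.isOpen.mem_nhds hcO')
    rw [eventually_nhdsWithin_iff, Metric.eventually_nhds_iff] at hev
    obtain ⟨ρ, hρ, hev⟩ := hev
    -- Times within `δ' / 4` of `s` satisfy `y - x ≤ δ' / 2`, so a flow extended to `x + δ'` passes
    -- `y` by at least `δ' / 2`.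
    refine ⟨min ρ (δ' / 4), by positivity, fun x hx y hy hxs hys hxy ⟨δ, hδ, O, hO, ψ, h⟩ ↦ ?_⟩
    have hxs' := lt_min_iff.1 hxs
    have hys' := lt_min_iff.1 hys
    obtain ⟨ψ'', h''⟩ := h.extend hΩ hV hx.1 hδ hδ' h'
    have hxJ : x ∈ Ioo (-δ) (x + δ) := ⟨by linarith [hx.1], by linarith⟩
    have hψx : ψ x (γ 0) = γ x := by
      refine eqOn_integralCurves (X := fun _ ↦ V) (a := 0) (b := x) (s := 0)
        (γ₁ := fun t ↦ ψ t (γ 0)) (γ₂ := γ) hΩ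
        (contMDiffOn_timeField hV) (fun u hu ↦ ?_) (fun u hu ↦ ?_) ⟨le_rfl, hx.1⟩
        (h.initial _ hO) ⟨hx.1, le_rfl⟩
      · have hu' : u ∈ Ioo (-δ) (x + δ) := ⟨by linarith [hu.1], by linarith [hu.2]⟩
        exact ⟨h.mem _ hO _ hu', (h.deriv _ hO _ hu').hasMFDerivWithinAt⟩
      · have hu' : u ∈ Icc (0 : ℝ) 1 := ⟨hu.1, hu.2.trans hx.2⟩
        exact ⟨(hγ u hu').1, (hγ u hu').2.mono (Icc_subset_Icc_right hx.2)⟩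
    have hd : y - x ≤ δ' / 2 := by
      have h1 := abs_lt.1 hxs'.2
      have h2 := abs_lt.1 hys'.2
      linarith
    refine ⟨min δ (δ' / 2), by positivity, O ∩ ψ x ⁻¹' O', ⟨hO, ?_⟩, ψ'', ?_⟩
    · change ψ x (γ 0) ∈ O'
      rw [hψx]
      exact hev (by rw [Real.dist_eq]; exact hxs'.1) hx
    · have hsub : Ioo (-min δ (δ' / 2)) (y + min δ (δ' / 2)) ⊆ Ioo (-δ) (x + δ') := by
        intro t ht
        have h1 := min_le_left δ (δ' / 2)
        have h2 := min_le_right δ (δ' / 2)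
        exact ⟨by linarith [ht.1], by linarith [ht.2]⟩
      exact ⟨h''.isOpen, h''.smooth.mono (prod_mono_left hsub), h''.initial,
        fun x hx t ht ↦ h''.mem x hx t (hsub ht), fun x hx t ht ↦ h''.deriv x hx t (hsub ht)⟩
  refine key 0 (by simp) 1 (by simp) zero_le_one ?_
  obtain ⟨δ, hδ, O, hO, ψ, h⟩ := exists_isSmoothFlow_local hΩ hV (hγ 0 (by simp)).1
  exact ⟨δ, hδ, O, hO, ψ, by simpa using h⟩

end ManifoldFlow

set_option maxSynthPendingDepth 3

/-! ### Charts of the cotangent bundle and the Liouville form. -/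

section CotangentCharts

variable {E : Type*} [NormedAddCommGroup E] [NormedSpace ℝ E]
    {M : Type*} [TopologicalSpace M] [ChartedSpace E M] [IsManifold 𝓘(ℝ, E) ∞ M]

lemma cotangent_mem_chartSource {c ξ : Cotangent E M} :
    ξ ∈ (chartAt (ModelProd E (E →L[ℝ] ℝ)) c).source ↔ ξ.proj ∈ (chartAt E c.proj).source := by
  rw [← extChartAt_source (cotangentModel E), FiberBundle.extChartAt]
  simp only [PartialEquiv.trans_source, mem_inter_iff, mem_preimage]
  have hb : ∀ x : Cotangent E M,
      x ∈ (trivializationAt (E →L[ℝ] ℝ) (fun x ↦ TangentSpace 𝓘(ℝ, E) x →L[ℝ] ℝ) c.proj).source ↔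
      x.proj ∈ (chartAt E c.proj).source := by
    intro x
    simp
  refine ⟨fun h ↦ (hb ξ).1 h.1, fun h ↦ ⟨(hb ξ).2 h, ?_⟩⟩
  simp [h]

lemma cotangent_extChartAt_target (c : Cotangent E M) :
    (extChartAt (cotangentModel E) c).target = (extChartAt 𝓘(ℝ, E) c.proj).target ×ˢ univ := by
  rw [FiberBundle.extChartAt_target]
  congr 1
  refine inter_eq_left.2 fun x hx ↦ ?_
  have h := (extChartAt 𝓘(ℝ, E) c.proj).map_target hx
  rw [extChartAt_source] at h
  simpa using h

lemma cotangent_extChartAt_fst (c ξ : Cotangent E M) :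
    (extChartAt (cotangentModel E) c ξ).1 = extChartAt 𝓘(ℝ, E) c.proj ξ.proj := by
  rw [FiberBundle.extChartAt]
  simp only [PartialEquiv.trans_apply]
  simp
  rw [hom_trivializationAt_apply]

/-- The bundle charts of `T^*M` are dual to those of `TM`, so they preserve the pairing of covectors
with vectors. The Liouville form therefore is `p dx` in every chart. -/
lemma cotangent_extChartAt_snd {c ξ : Cotangent E M} (h : ξ.proj ∈ (chartAt E c.proj).source)
    (u : TangentSpace 𝓘(ℝ, E) ξ.proj) :
    (extChartAt (cotangentModel E) c ξ).2 (chartDeriv 𝓘(ℝ, E) c.proj ξ.proj u) = ξ.2 u := by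
  have h1 : (extChartAt (cotangentModel E) c ξ).2 =
      ξ.snd ∘SL Trivialization.symmL ℝ (trivializationAt E (TangentSpace 𝓘(ℝ, E)) c.proj) ξ.proj := by
    rw [FiberBundle.extChartAt]
    simp only [PartialEquiv.trans_apply]
    simp
    rw [hom_trivializationAt_apply]
    simp [ContinuousLinearMap.inCoordinates]
  have h2 : (trivializationAt E (TangentSpace 𝓘(ℝ, E)) c.proj).continuousLinearMapAt ℝ ξ.proj u =
      chartDeriv 𝓘(ℝ, E) c.proj ξ.proj u :=
    congr($(TangentBundle.continuousLinearMapAt_trivializationAt (I := 𝓘(ℝ, E)) h) u)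
  rw [h1, ← h2, ContinuousLinearMap.comp_apply, Trivialization.symmL_continuousLinearMapAt]
  simpa using h

/-- Points of one fibre lie in a common chart, and points of different fibres are separated by open
sets of `M`. Uniqueness of integral curves on `T^*M` rests on this. -/
instance [T2Space M] : T2Space (Cotangent E M) := by
  refine ⟨fun ξ η hne ↦ ?_⟩
  have hq : Continuous (cotangentProj E M) :=
    FiberBundle.continuous_proj (E →L[ℝ] ℝ) (fun x : M ↦ TangentSpace 𝓘(ℝ, E) x →L[ℝ] ℝ)
  by_cases h : ξ.proj = η.proj
  · set e := chartAt (ModelProd E (E →L[ℝ] ℝ)) ξ with he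
    have h1 : ξ ∈ e.source := mem_chart_source _ ξ
    have h2 : η ∈ e.source := by
      rw [he, cotangent_mem_chartSource, ← h]; exact mem_chart_source _ _
    have hne' : e ξ ≠ e η := fun h' ↦ hne (e.injOn h1 h2 h')
    have : T2Space (ModelProd E (E →L[ℝ] ℝ)) := inferInstanceAs (T2Space (E × (E →L[ℝ] ℝ)))
    obtain ⟨u, v, hu, hv, hxu, hyv, huv⟩ := t2_separation hne'
    refine ⟨_, _, e.isOpen_inter_preimage hu, e.isOpen_inter_preimage hv, ⟨h1, hxu⟩, ⟨h2, hyv⟩, ?_⟩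
    exact (huv.preimage e).mono inter_subset_right inter_subset_right
  · obtain ⟨u, v, hu, hv, hxu, hyv, huv⟩ := t2_separation h
    exact ⟨_, _, hu.preimage hq, hv.preimage hq, hxu, hyv, huv.preimage _⟩

lemma mdifferentiable_cotangentProj (ξ : Cotangent E M) :
    MDifferentiableAt (cotangentModel E) 𝓘(ℝ, E) (cotangentProj E M) ξ :=
  (contMDiff_proj (n := ∞) (IB := 𝓘(ℝ, E))
    (fun x : M ↦ TangentSpace 𝓘(ℝ, E) x →L[ℝ] ℝ) ξ).mdifferentiableAt (by simp)

variable [IsManifold 𝓘(ℝ, E) 1 M]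

lemma cotangent_chartDeriv_fst {c ξ : Cotangent E M} (h : ξ.proj ∈ (chartAt E c.proj).source)
    (v : TangentSpace (cotangentModel E) ξ) :
    (chartDeriv (cotangentModel E) c ξ v).1 =
      chartDeriv 𝓘(ℝ, E) c.proj ξ.proj
        (mfderiv (cotangentModel E) 𝓘(ℝ, E) (cotangentProj E M) ξ v) := by
  have h1 := (hasMFDerivAt_chartDeriv (I := 𝓘(ℝ, E)) h).comp ξ
    (mdifferentiable_cotangentProj ξ).hasMFDerivAt
  have h2 := ((hasMFDerivAt_iff_hasFDerivAt.2 hasFDerivAt_fst).comp ξ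
    (hasMFDerivAt_chartDeriv (I := cotangentModel E) (cotangent_mem_chartSource.2 h)) :
      HasMFDerivAt (cotangentModel E) 𝓘(ℝ, E) (Prod.fst ∘ extChartAt (cotangentModel E) c) ξ _)
  have h3 : Prod.fst ∘ extChartAt (cotangentModel E) c =
      extChartAt 𝓘(ℝ, E) c.proj ∘ cotangentProj E M :=
    funext fun η ↦ cotangent_extChartAt_fst c η
  rw [h3] at h2
  exact congr($(hasMFDerivAt_unique h2 h1) v)

/-- In every chart the Liouville form is `p dx`. -/
lemma liouville_apply_chart {c ξ : Cotangent E M} (h : ξ.proj ∈ (chartAt E c.proj).source)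
    (v : Fin 1 → TangentSpace (cotangentModel E) ξ) :
    liouville E M ξ v = (extChartAt (cotangentModel E) c ξ).2
      (chartDeriv (cotangentModel E) c ξ (v 0)).1 := by
  rw [cotangent_chartDeriv_fst h, cotangent_extChartAt_snd h]
  rfl

/-- The form `p dx` on the model space `E × E^*`. -/
def modelLiouville (E : Type*) [NormedAddCommGroup E] [NormedSpace ℝ E] :
    E × (E →L[ℝ] ℝ) →L[ℝ] (E × (E →L[ℝ] ℝ)) →L[ℝ] ℝ :=
  ((ContinuousLinearMap.compL ℝ (E × (E →L[ℝ] ℝ)) E ℝ).flip (.fst ℝ E (E →L[ℝ] ℝ))) ∘L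
    (.snd ℝ E (E →L[ℝ] ℝ))

@[simp] lemma modelLiouville_apply (z u : E × (E →L[ℝ] ℝ)) : modelLiouville E z u = z.2 u.1 := rfl

/-- The form `dp ∧ dx` on the model space `E × E^*`. -/
def modelSymplectic (E : Type*) [NormedAddCommGroup E] [NormedSpace ℝ E] :
    E × (E →L[ℝ] ℝ) →L[ℝ] (E × (E →L[ℝ] ℝ)) →L[ℝ] ℝ :=
  modelLiouville E - (modelLiouville E).flip

@[simp] lemma modelSymplectic_apply (u v : E × (E →L[ℝ] ℝ)) :
    modelSymplectic E u v = u.2 v.1 - v.2 u.1 := rfl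

/-- The form `p dx` as a differential form on the model space. -/
def modelLiouvilleForm (E : Type*) [NormedAddCommGroup E] [NormedSpace ℝ E] :
    E × (E →L[ℝ] ℝ) → (E × (E →L[ℝ] ℝ)) [⋀^Fin 1]→L[ℝ] ℝ :=
  fun z ↦ ContinuousAlternatingMap.ofSubsingleton ℝ _ ℝ (0 : Fin 1) (modelLiouville E z)

lemma contDiff_modelLiouvilleForm : ContDiff ℝ ∞ (modelLiouvilleForm E) :=
  (ContinuousAlternatingMap.ofSubsingletonLIE (𝕜 := ℝ) (E := E × (E →L[ℝ] ℝ)) (F := ℝ)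
    (0 : Fin 1)).toContinuousLinearEquiv.contDiff.comp (modelLiouville E).contDiff

lemma extDeriv_modelLiouvilleForm (z : E × (E →L[ℝ] ℝ)) (v : Fin 2 → E × (E →L[ℝ] ℝ)) :
    extDeriv (modelLiouvilleForm E) z v = modelSymplectic E (v 0) (v 1) := by
  rw [extDeriv_apply (contDiff_modelLiouvilleForm.differentiable (by simp) z)]
  have h : ∀ u : Fin 1 → E × (E →L[ℝ] ℝ), (fun z ↦ modelLiouvilleForm E z u) =
      (modelLiouville E).flip (u 0) := fun u ↦ rfl
  simp only [h, ContinuousLinearMap.fderiv]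
  simp [Fin.removeNth, modelSymplectic_apply]
  ring

lemma formInChart_liouville {c : Cotangent E M} {z : E × (E →L[ℝ] ℝ)}
    (hz : z ∈ (extChartAt (cotangentModel E) c).target) :
    formInChart (cotangentModel E) c (liouville E M) z = modelLiouvilleForm E z := by
  ext v
  have h := (extChartAt (cotangentModel E) c).map_target hz
  rw [extChartAt_source, cotangent_mem_chartSource] at h
  rw [formInChart_eq, ContinuousAlternatingMap.compContinuousLinearMap_apply,
    liouville_apply_chart h, (extChartAt (cotangentModel E) c).right_inv hz]
  simp only [Function.comp_apply]
  rw [chartDeriv_chartSymmDeriv hz]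
  rfl

end CotangentCharts

/-! ### The canonical symplectic form in charts. -/

section CanonicalForm

variable {E : Type*} [NormedAddCommGroup E] [NormedSpace ℝ E]
    {M : Type*} [TopologicalSpace M] [ChartedSpace E M] [IsManifold 𝓘(ℝ, E) ∞ M]
    [IsManifold 𝓘(ℝ, E) 1 M]

lemma contDiffAt_chart_transition {c c' ξ : Cotangent E M}
    (h : ξ.proj ∈ (chartAt E c.proj).source) (h' : ξ.proj ∈ (chartAt E c'.proj).source) :
    ContDiffAt ℝ ∞ (fun z ↦ extChartAt (cotangentModel E) c'
      ((extChartAt (cotangentModel E) c).symm z)) (extChartAt (cotangentModel E) c ξ) := by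
  have hξ : ξ ∈ (extChartAt (cotangentModel E) c).source := by
    rwa [extChartAt_source, cotangent_mem_chartSource]
  have hz := (extChartAt (cotangentModel E) c).map_source hξ
  rw [← contMDiffAt_iff_contDiffAt]
  refine ContMDiffAt.comp (I' := cotangentModel E) _ (g := extChartAt (cotangentModel E) c')
    (f := (extChartAt (cotangentModel E) c).symm) ?_ ?_
  · refine contMDiffAt_extChartAt' ?_
    rwa [(extChartAt (cotangentModel E) c).left_inv hξ, cotangent_mem_chartSource]
  · exact (contMDiffOn_extChartAt_symm c).contMDiffAt ((isOpen_extChartAt_target c).mem_nhds hz)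

lemma fderiv_chart_transition {c c' ξ : Cotangent E M}
    (h : ξ.proj ∈ (chartAt E c.proj).source) (h' : ξ.proj ∈ (chartAt E c'.proj).source)
    (v : TangentSpace (cotangentModel E) ξ) :
    fderiv ℝ (fun z ↦ extChartAt (cotangentModel E) c'
      ((extChartAt (cotangentModel E) c).symm z)) (extChartAt (cotangentModel E) c ξ)
        (chartDeriv (cotangentModel E) c ξ v) = chartDeriv (cotangentModel E) c' ξ v := by
  have := fderiv_chart_apply (I := cotangentModel E) (I' := cotangentModel E) (f := id)
    mdifferentiableAt_id (cotangent_mem_chartSource.2 h) (c' := c')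
    (cotangent_mem_chartSource.2 h') v
  rw [mfderiv_id] at this
  exact this.symm

/-- In every chart the canonical symplectic form is `dp ∧ dx`. -/
lemma canonicalForm_apply_chart {c ξ : Cotangent E M} (h : ξ.proj ∈ (chartAt E c.proj).source)
    (v : Fin 2 → TangentSpace (cotangentModel E) ξ) :
    canonicalForm E M ξ v = modelSymplectic E (chartDeriv (cotangentModel E) c ξ (v 0))
      (chartDeriv (cotangentModel E) c ξ (v 1)) := by
  set κ := extChartAt (cotangentModel E) ξ with hκ
  set τ : E × (E →L[ℝ] ℝ) → E × (E →L[ℝ] ℝ) :=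
    fun z ↦ extChartAt (cotangentModel E) c (κ.symm z) with hτ
  have hself : ξ.proj ∈ (chartAt E ξ.proj).source := mem_chart_source _ _
  have hξ : ξ ∈ κ.source := mem_extChartAt_source ξ
  have hz : κ ξ ∈ κ.target := κ.map_source hξ
  have htarget : κ.target ∈ 𝓝 (κ ξ) := (isOpen_extChartAt_target ξ).mem_nhds hz
  have h1 : formInChart (cotangentModel E) ξ (liouville E M) =ᶠ[𝓝 (κ ξ)] modelLiouvilleForm E := by
    filter_upwards [htarget] with z hz
    exact formInChart_liouville hz
  have hnear : ∀ᶠ z in 𝓝 (κ ξ), z ∈ κ.target ∧ (κ.symm z).proj ∈ (chartAt E c.proj).source := by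
    refine (Filter.eventually_of_mem htarget fun _ ↦ id).and ?_
    have hcont : ContinuousAt κ.symm (κ ξ) := continuousAt_extChartAt_symm ξ
    refine hcont.preimage_mem_nhds (((chartAt E c.proj).open_source.preimage
      (FiberBundle.continuous_proj (E →L[ℝ] ℝ)
        (fun x : M ↦ TangentSpace 𝓘(ℝ, E) x →L[ℝ] ℝ))).mem_nhds ?_)
    change (κ.symm (κ ξ)).proj ∈ (chartAt E c.proj).source
    rwa [κ.left_inv hξ]
  -- Since `mextDeriv` uses the preferred chart at `ξ`, the change to the chart at `c` has to be
  -- made explicit: `p dx` is invariant under the transition `τ`, and `d` commutes with pullback.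
  have h2 : modelLiouvilleForm E =ᶠ[𝓝 (κ ξ)]
      fun z ↦ (modelLiouvilleForm E (τ z)).compContinuousLinearMap (fderiv ℝ τ z) := by
    filter_upwards [hnear] with z hz
    rw [← formInChart_liouville hz.1]
    ext u
    rw [formInChart_eq, ContinuousAlternatingMap.compContinuousLinearMap_apply,
      ContinuousAlternatingMap.compContinuousLinearMap_apply, liouville_apply_chart hz.2]
    have hs := κ.map_target hz.1
    rw [hκ, extChartAt_source, cotangent_mem_chartSource] at hs
    have e := fderiv_chart_transition hs hz.2 (chartSymmDeriv (cotangentModel E) ξ z (u 0))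
    rw [chartDeriv_chartSymmDeriv hz.1, κ.right_inv hz.1] at e
    simp only [Function.comp_apply]
    rw [← e]
    rfl
  have h3 : canonicalForm E M ξ v = extDeriv (modelLiouvilleForm E) (κ ξ)
      (fun i ↦ chartDeriv (cotangentModel E) ξ ξ (v i)) := by
    rw [canonicalForm, mextDeriv, ContinuousAlternatingMap.compContinuousLinearMap_apply,
      (cotangentModel E).range_eq_univ, extDerivWithin_univ, h1.extDeriv_eq]
    rfl
  have h4 := h2.extDeriv_eq
  rw [extDeriv_pullback (contDiff_modelLiouvilleForm.differentiable (by simp) _)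
    (contDiffAt_chart_transition hself h)
    (by simp only [minSmoothness_of_isRCLikeNormedField]; exact WithTop.coe_le_coe.2 le_top)] at h4
  rw [h3, h4, ContinuousAlternatingMap.compContinuousLinearMap_apply, extDeriv_modelLiouvilleForm]
  simp only [Function.comp_apply]
  rw [← fderiv_chart_transition hself h, ← fderiv_chart_transition hself h]

lemma modelSymplectic_nondegenerate {u : E × (E →L[ℝ] ℝ)}
    (h : ∀ w, modelSymplectic E u w = 0) : u = 0 := by
  have h2 : u.2 = 0 := by
    ext x
    simpa using h (x, 0)
  have h1 : u.1 = 0 := by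
    by_contra hne
    obtain ⟨f, -, hf⟩ := exists_dual_vector ℝ u.1 (by simpa using hne)
    have := h (0, f)
    simp [hf] at this
    exact hne this
  exact Prod.ext h1 h2

/-- The form `dp ∧ dx` as a constant alternating map. -/
def modelSymplecticForm (E : Type*) [NormedAddCommGroup E] [NormedSpace ℝ E] :
    (E × (E →L[ℝ] ℝ)) [⋀^Fin 2]→L[ℝ] ℝ := extDeriv (modelLiouvilleForm E) 0

lemma formInChart_canonicalForm {c : Cotangent E M} {z : E × (E →L[ℝ] ℝ)}
    (hz : z ∈ (extChartAt (cotangentModel E) c).target) :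
    formInChart (cotangentModel E) c (canonicalForm E M) z = modelSymplecticForm E := by
  ext v
  have h := (extChartAt (cotangentModel E) c).map_target hz
  rw [extChartAt_source, cotangent_mem_chartSource] at h
  rw [formInChart_eq, ContinuousAlternatingMap.compContinuousLinearMap_apply,
    canonicalForm_apply_chart h, modelSymplecticForm, extDeriv_modelLiouvilleForm]
  simp only [Function.comp_apply]
  rw [chartDeriv_chartSymmDeriv hz, chartDeriv_chartSymmDeriv hz]

lemma formInChart_canonicalForm_eventuallyEq (c : Cotangent E M) :
    formInChart (cotangentModel E) c (canonicalForm E M) =ᶠ[𝓝 (extChartAt (cotangentModel E) c c)]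
      fun _ ↦ modelSymplecticForm E := by
  filter_upwards [(isOpen_extChartAt_target (I := cotangentModel E) c).mem_nhds
    (mem_extChartAt_target c)] with z hz
  exact formInChart_canonicalForm hz

/-- In charts the form has constant coefficients, which gives smoothness and closedness. -/
lemma canonicalForm_isSymplecticOn (W : Set (Cotangent E M)) :
    IsSymplecticOn (cotangentModel E) (canonicalForm E M) W where
  smooth x _ := by
    rw [SmoothFormAt, (cotangentModel E).range_eq_univ, contDiffWithinAt_univ]
    exact contDiffAt_const.congr_of_eventuallyEq (formInChart_canonicalForm_eventuallyEq x)
  closed x _ := by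
    rw [mextDeriv, (cotangentModel E).range_eq_univ, extDerivWithin_univ,
      (formInChart_canonicalForm_eventuallyEq x).extDeriv_eq]
    ext v
    rw [ContinuousAlternatingMap.compContinuousLinearMap_apply,
      extDeriv_apply (differentiableAt_const _)]
    simp
  nondegenerate x _ v hv := by
    have hx : x.proj ∈ (chartAt E x.proj).source := mem_chart_source _ _
    have hbij := chartDeriv_bijective (I := cotangentModel E) (cotangent_mem_chartSource.2 hx)
    apply hbij.1
    rw [map_zero]
    refine modelSymplectic_nondegenerate fun w ↦ ?_
    obtain ⟨w', rfl⟩ := hbij.2 w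
    have := hv w'
    rwa [canonicalForm_apply_chart hx] at this

end CanonicalForm

/-! ### Flows in charts and the variational equation. -/

section FlowInCharts

variable {F : Type*} [NormedAddCommGroup F] [NormedSpace ℝ F]
  {H : Type*} [TopologicalSpace H] {I : ModelWithCorners ℝ F H} [I.Boundaryless]
  {N : Type*} [TopologicalSpace N] [ChartedSpace H N] [IsManifold I ∞ N] [IsManifold I 1 N]
  {V : Π ξ : N, TangentSpace I ξ} {Ω : Set N} {J : Set ℝ} {O : Set N} {ψ : ℝ → N → N}

lemma IsSmoothFlow.mono (h : IsSmoothFlow I V Ω J O ψ) {J' : Set ℝ} {O' : Set N}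
    (hJ : J' ⊆ J) (hO' : IsOpen O') (hO : O' ⊆ O) : IsSmoothFlow I V Ω J' O' ψ :=
  ⟨hO', h.smooth.mono (prod_mono hJ hO), fun x hx ↦ h.initial x (hO hx),
    fun x hx t ht ↦ h.mem x (hO hx) t (hJ ht), fun x hx t ht ↦ h.deriv x (hO hx) t (hJ ht)⟩

/-- The expression of a time-dependent map in the charts at `c` and `c'`. -/
def flowInChart (I : ModelWithCorners ℝ F H) (ψ : ℝ → N → N) (c c' : N) (p : ℝ × F) : F :=
  extChartAt I c' (ψ p.1 ((extChartAt I c).symm p.2))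

lemma IsSmoothFlow.contMDiffAt (h : IsSmoothFlow I V Ω J O ψ) (hJ : IsOpen J) {s : ℝ} (hs : s ∈ J)
    {ξ : N} (hξ : ξ ∈ O) : ContMDiffAt (𝓘(ℝ, ℝ).prod I) I ∞ (fun p : ℝ × N ↦ ψ p.1 p.2) (s, ξ) :=
  h.smooth.contMDiffAt (prod_mem_nhds (hJ.mem_nhds hs) (h.isOpen.mem_nhds hξ))

lemma IsSmoothFlow.contMDiffAt_slice (h : IsSmoothFlow I V Ω J O ψ) (hJ : IsOpen J) {s : ℝ}
    (hs : s ∈ J) {ξ : N} (hξ : ξ ∈ O) : ContMDiffAt I I ∞ (ψ s) ξ :=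
  ContMDiffAt.comp (I' := 𝓘(ℝ, ℝ).prod I) ξ (h.contMDiffAt hJ hs hξ)
    (f := fun x ↦ (s, x)) (contMDiffAt_const.prodMk contMDiffAt_id)

lemma IsSmoothFlow.contDiffAt_flowInChart (h : IsSmoothFlow I V Ω J O ψ) (hJ : IsOpen J)
    {c c' : N} {s : ℝ} (hs : s ∈ J) {z : F} (hz : z ∈ (extChartAt I c).target)
    (hzO : (extChartAt I c).symm z ∈ O)
    (hc' : ψ s ((extChartAt I c).symm z) ∈ (chartAt H c').source) :
    ContDiffAt ℝ ∞ (flowInChart I ψ c c') (s, z) := by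
  rw [← contMDiffAt_iff_contDiffAt]
  have h1 : ContMDiffAt 𝓘(ℝ, ℝ × F) I ∞ (fun p : ℝ × F ↦ (extChartAt I c).symm p.2) (s, z) :=
    ContMDiffAt.comp (I' := 𝓘(ℝ, F)) (s, z)
      ((contMDiffOn_extChartAt_symm c).contMDiffAt ((isOpen_extChartAt_target c).mem_nhds hz))
      (contMDiffAt_iff_contDiffAt.2 contDiffAt_snd)
  have h2 : ContMDiffAt 𝓘(ℝ, ℝ × F) (𝓘(ℝ, ℝ).prod I) ∞
      (fun p : ℝ × F ↦ (p.1, (extChartAt I c).symm p.2)) (s, z) :=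
    ContMDiffAt.prodMk (contMDiffAt_iff_contDiffAt.2 contDiffAt_fst) h1
  have h3 := ContMDiffAt.comp (I' := 𝓘(ℝ, ℝ).prod I) (s, z) (h.contMDiffAt hJ hs hzO) h2
  exact ContMDiffAt.comp (I' := I) (s, z)
    (contMDiffAt_extChartAt' (x := c') (x' := ψ s ((extChartAt I c).symm z)) hc') h3

lemma IsSmoothFlow.chartDeriv_mfderiv (h : IsSmoothFlow I V Ω J O ψ) (hJ : IsOpen J)
    {c c' : N} {s : ℝ} (hs : s ∈ J) {ξ : N} (hξ : ξ ∈ (chartAt H c).source)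
    (hξO : ξ ∈ O) (hc' : ψ s ξ ∈ (chartAt H c').source) (v : TangentSpace I ξ) :
    chartDeriv I c' (ψ s ξ) (mfderiv I I (ψ s) ξ v) =
      fderiv ℝ (flowInChart I ψ c c') (s, extChartAt I c ξ) (0, chartDeriv I c ξ v) := by
  have hξ' : ξ ∈ (extChartAt I c).source := by rwa [extChartAt_source]
  have hz := (extChartAt I c).map_source hξ'
  have hl := (extChartAt I c).left_inv hξ'
  rw [fderiv_chart_apply ((h.contMDiffAt_slice hJ hs hξO).mdifferentiableAt (by simp)) hξ hc']
  have h1 : HasFDerivAt (flowInChart I ψ c c')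
      (fderiv ℝ (flowInChart I ψ c c') (s, extChartAt I c ξ)) (s, extChartAt I c ξ) :=
    ((h.contDiffAt_flowInChart hJ hs hz (by rwa [hl]) (by rwa [hl])).differentiableAt
      (by simp)).hasFDerivAt
  have h2 := h1.comp (extChartAt I c ξ) (hasFDerivAt_prodMk_right s (extChartAt I c ξ))
  exact congr($(h2.fderiv) (chartDeriv I c ξ v))

/-- The set of `(s, z)` such that the flow is defined at `(s, z)` in the chart at `c`, with values
in the domain of the chart at `c'`. -/
lemma IsSmoothFlow.eventually_flowInChart (h : IsSmoothFlow I V Ω J O ψ) (hJ : IsOpen J)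
    {c c' : N} {s : ℝ} (hs : s ∈ J) {z : F} (hz : z ∈ (extChartAt I c).target)
    (hzO : (extChartAt I c).symm z ∈ O)
    (hc' : ψ s ((extChartAt I c).symm z) ∈ (chartAt H c').source) :
    ∀ᶠ p : ℝ × F in 𝓝 (s, z), p.1 ∈ J ∧ p.2 ∈ (extChartAt I c).target ∧
      (extChartAt I c).symm p.2 ∈ O ∧
      ψ p.1 ((extChartAt I c).symm p.2) ∈ (chartAt H c').source := by
  have hsymm : ContinuousAt (fun p : ℝ × F ↦ (extChartAt I c).symm p.2) (s, z) :=
    ContinuousAt.comp (g := (extChartAt I c).symm)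
      ((continuousOn_extChartAt_symm c).continuousAt ((isOpen_extChartAt_target c).mem_nhds hz))
      continuousAt_snd
  have h1 : ContinuousAt (fun p : ℝ × F ↦ ψ p.1 ((extChartAt I c).symm p.2)) (s, z) :=
    ContinuousAt.comp (g := fun p : ℝ × N ↦ ψ p.1 p.2)
      (f := fun p : ℝ × F ↦ (p.1, (extChartAt I c).symm p.2))
      (h.contMDiffAt hJ hs hzO).continuousAt (continuousAt_fst.prodMk hsymm)
  have e1 : ∀ᶠ p : ℝ × F in 𝓝 (s, z), p.1 ∈ J := continuousAt_fst (hJ.mem_nhds hs)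
  have e2 : ∀ᶠ p : ℝ × F in 𝓝 (s, z), p.2 ∈ (extChartAt I c).target :=
    continuousAt_snd ((isOpen_extChartAt_target c).mem_nhds hz)
  have e3 : ∀ᶠ p : ℝ × F in 𝓝 (s, z), (extChartAt I c).symm p.2 ∈ O :=
    hsymm (h.isOpen.mem_nhds hzO)
  have e4 : ∀ᶠ p : ℝ × F in 𝓝 (s, z),
      ψ p.1 ((extChartAt I c).symm p.2) ∈ (chartAt H c').source :=
    h1 ((chartAt H c').open_source.mem_nhds hc')
  exact e1.and (e2.and (e3.and e4))

/-- The vector field `V` in the chart at `c`. -/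
def fieldInChart (I : ModelWithCorners ℝ F H) (V : Π ξ : N, TangentSpace I ξ) (c : N) (z : F) : F :=
  chartDeriv I c ((extChartAt I c).symm z) (V ((extChartAt I c).symm z))

lemma IsSmoothFlow.fderiv_flowInChart_time (h : IsSmoothFlow I V Ω J O ψ) (hJ : IsOpen J)
    {c c' : N} {s : ℝ} (hs : s ∈ J) {z : F} (hz : z ∈ (extChartAt I c).target)
    (hzO : (extChartAt I c).symm z ∈ O)
    (hc' : ψ s ((extChartAt I c).symm z) ∈ (chartAt H c').source) :
    fderiv ℝ (flowInChart I ψ c c') (s, z) (1, 0) =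
      fieldInChart I V c' (flowInChart I ψ c c' (s, z)) := by
  have h1 : HasFDerivAt (flowInChart I ψ c c') (fderiv ℝ (flowInChart I ψ c c') (s, z)) (s, z) :=
    ((h.contDiffAt_flowInChart hJ hs hz hzO hc').differentiableAt (by simp)).hasFDerivAt
  have h2 := (h1.comp s (hasFDerivAt_prodMk_left s z)).hasDerivAt
  have h3 := ((h.deriv _ hzO s hs).hasMFDerivWithinAt (s := univ)).hasDerivWithinAt_chart
    (c := c') hc'
  rw [hasDerivWithinAt_univ] at h3
  have h4 := h2.unique h3
  refine Eq.trans (by simp) (h4.trans ?_)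
  simp only [fieldInChart, flowInChart]
  rw [(extChartAt I c').left_inv (by rwa [extChartAt_source])]
  rfl

/-- The variational equation. -/
lemma IsSmoothFlow.hasDerivAt_fderiv_flowInChart (h : IsSmoothFlow I V Ω J O ψ) (hJ : IsOpen J)
    (hΩ : IsOpen Ω)
    (hV : ContMDiffOn I I.tangent ∞ (fun ξ ↦ (⟨ξ, V ξ⟩ : TangentBundle I N)) Ω)
    {c c' : N} {s : ℝ} (hs : s ∈ J) {z : F} (hz : z ∈ (extChartAt I c).target)
    (hzO : (extChartAt I c).symm z ∈ O)
    (hc' : ψ s ((extChartAt I c).symm z) ∈ (chartAt H c').source) (u : F) :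
    HasDerivAt (fun t ↦ fderiv ℝ (flowInChart I ψ c c') (t, z) (0, u))
      (fderiv ℝ (fieldInChart I V c') (flowInChart I ψ c c' (s, z))
        (fderiv ℝ (flowInChart I ψ c c') (s, z) (0, u))) s := by
  set f := flowInChart I ψ c c' with hf
  have hcd : ContDiffAt ℝ ∞ f (s, z) := h.contDiffAt_flowInChart hJ hs hz hzO hc'
  have hd : HasFDerivAt (fderiv ℝ f) (fderiv ℝ (fderiv ℝ f) (s, z)) (s, z) :=
    ((hcd.fderiv_right (m := ∞) le_rfl).differentiableAt (by simp)).hasFDerivAt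
  have hsymm : IsSymmSndFDerivAt ℝ f (s, z) := hcd.isSymmSndFDerivAt (by
    simp only [minSmoothness_of_isRCLikeNormedField]; exact WithTop.coe_le_coe.2 le_top)
  have h1 : HasDerivAt (fun t ↦ fderiv ℝ f (t, z) (0, u))
      (fderiv ℝ (fderiv ℝ f) (s, z) (1, 0) (0, u)) s := by
    have h2 := (hd.comp s (hasFDerivAt_prodMk_left s z)).hasDerivAt
    have h3 := h2.clm_apply (hasDerivAt_const s ((0, u) : ℝ × F))
    simpa using h3
  -- The flow equation `∂ₜf = V ∘ f` holds on a neighbourhood of `(s, z)`, so it may be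
  -- differentiated in `z`; symmetry of the second derivative then exchanges `∂ₜ` and `∂_z`.
  have hev : (fun p ↦ fderiv ℝ f p (1, 0)) =ᶠ[𝓝 (s, z)] fun p ↦ fieldInChart I V c' (f p) := by
    filter_upwards [h.eventually_flowInChart hJ hs hz hzO hc'] with p hp
    exact h.fderiv_flowInChart_time hJ hp.1 hp.2.1 hp.2.2.1 hp.2.2.2
  have hs' : ψ s ((extChartAt I c).symm z) ∈ (extChartAt I c').source := by
    rwa [extChartAt_source]
  have hVd : HasFDerivAt (fieldInChart I V c') (fderiv ℝ (fieldInChart I V c') (f (s, z)))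
      (f (s, z)) := by
    have h2 := (contDiffOn_field_chart hV c').contDiffAt (x := f (s, z))
      (((continuousOn_extChartAt_symm c').isOpen_inter_preimage
        (isOpen_extChartAt_target c') hΩ).mem_nhds ⟨(extChartAt I c').map_source hs', ?_⟩)
    · exact (h2.differentiableAt (by simp)).hasFDerivAt
    · change (extChartAt I c').symm (extChartAt I c' (ψ s ((extChartAt I c).symm z))) ∈ Ω
      rw [(extChartAt I c').left_inv hs']
      exact h.mem _ hzO s hs
  have h4 : HasFDerivAt (fun p ↦ fderiv ℝ f p (1, 0))
      (fderiv ℝ (fieldInChart I V c') (f (s, z)) ∘L fderiv ℝ f (s, z)) (s, z) :=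
    (hVd.comp (s, z) (hcd.differentiableAt (by simp)).hasFDerivAt).congr_of_eventuallyEq hev
  have h5 : HasFDerivAt (fun p ↦ fderiv ℝ f p (1, 0))
      ((fderiv ℝ (fderiv ℝ f) (s, z)).flip (1, 0)) (s, z) := by
    have := hd.clm_apply (hasFDerivAt_const ((1, 0) : ℝ × F) (s, z))
    simpa using this
  have h6 := congr($(h4.unique h5) (0, u))
  rw [hsymm] at h1
  convert h1 using 1
  exact h6

/-- A given flow on `[0, 1]` extends locally to a smooth flow on an open interval. -/
theorem IsFlowOn.exists_isSmoothFlow [CompleteSpace F] [T2Space N] (hΩ : IsOpen Ω)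
    (hV : ContMDiffOn I I.tangent ∞ (fun ξ ↦ (⟨ξ, V ξ⟩ : TangentBundle I N)) Ω)
    {φ : ℝ → N → N} {U : Set N} (hU : IsOpen U) (hφ : IsFlowOn I (fun _ ↦ V) Ω φ U) {c : N}
    (hc : c ∈ U) :
    ∃ δ > 0, ∃ O ⊆ U, c ∈ O ∧ ∃ ψ, IsSmoothFlow I V Ω (Ioo (-δ) (1 + δ)) O ψ ∧
      ∀ x ∈ O, ∀ s ∈ Icc (0 : ℝ) 1, ψ s x = φ s x := by
  obtain ⟨δ, hδ, O, hO, ψ, h⟩ := _root_.exists_isSmoothFlow (γ := fun s ↦ φ s c) hΩ hV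
    fun t ht ↦ ⟨hφ.mem c hc t ht, hφ.deriv c hc t ht⟩
  rw [hφ.initial c hc] at hO
  refine ⟨δ, hδ, O ∩ U, inter_subset_right, ⟨hO, hc⟩, ψ,
    h.mono Subset.rfl (h.isOpen.inter hU) inter_subset_left, fun x hx s hs ↦ ?_⟩
  -- No regularity of `φ` in the point is assumed; it is inherited from `ψ` by uniqueness.
  refine eqOn_integralCurves (X := fun _ ↦ V) (a := 0) (b := 1) (s := 0)
    (γ₁ := fun t ↦ ψ t x) (γ₂ := fun t ↦ φ t x) hΩ (contMDiffOn_timeField hV)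
    (fun u hu ↦ ?_) (fun u hu ↦ ⟨hφ.mem x hx.2 u hu, hφ.deriv x hx.2 u hu⟩)
    (by simp) ?_ hs
  · have hu' : u ∈ Ioo (-δ) (1 + δ) := ⟨by linarith [hu.1], by linarith [hu.2]⟩
    exact ⟨h.mem x hx.1 u hu', (h.deriv x hx.1 u hu').hasMFDerivWithinAt⟩
  · simp only [h.initial x hx.1, hφ.initial x hx.2]

end FlowInCharts

/-! ### Exterior derivative of a pullback of `p dx`. -/

section PullbackLiouville

variable {E : Type*} [NormedAddCommGroup E] [NormedSpace ℝ E]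
  {F : Type*} [NormedAddCommGroup F] [NormedSpace ℝ F]
  {P : Type*} [NormedAddCommGroup P] [NormedSpace ℝ P]

/-- The pullback of `p dx` under `f`, along the inclusion `ι`. -/
def pullbackLiouville (ι : F →L[ℝ] P) (f : P → E × (E →L[ℝ] ℝ)) (p : P) : F →L[ℝ] ℝ :=
  modelLiouville E (f p) ∘L (fderiv ℝ f p ∘L ι)

lemma ContDiffAt.pullbackLiouville {ι : F →L[ℝ] P} {f : P → E × (E →L[ℝ] ℝ)} {p : P}
    (hf : ContDiffAt ℝ ∞ f p) : ContDiffAt ℝ ∞ (pullbackLiouville ι f) p :=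
  ((modelLiouville E).contDiff.contDiffAt.comp p hf).clm_comp
    ((hf.fderiv_right (m := ∞) le_rfl).clm_comp contDiffAt_const)

/-- The exterior derivative of the pullback of `p dx` is the pullback of `dp ∧ dx`. -/
lemma fderiv_pullbackLiouville_alternate {ι : F →L[ℝ] P} {f : P → E × (E →L[ℝ] ℝ)} {p : P}
    (hf : ContDiffAt ℝ ∞ f p) (u v : F) :
    fderiv ℝ (pullbackLiouville ι f) p (ι u) v - fderiv ℝ (pullbackLiouville ι f) p (ι v) u =
      modelSymplectic E (fderiv ℝ f p (ι u)) (fderiv ℝ f p (ι v)) := by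
  have hd : HasFDerivAt (fderiv ℝ f) (fderiv ℝ (fderiv ℝ f) p) p :=
    ((hf.fderiv_right (m := ∞) le_rfl).differentiableAt (by simp)).hasFDerivAt
  have hsymm : IsSymmSndFDerivAt ℝ f p := hf.isSymmSndFDerivAt (by
    simp only [minSmoothness_of_isRCLikeNormedField]; exact WithTop.coe_le_coe.2 le_top)
  -- The term containing the second derivative of `f` is symmetric in `u` and `v`, and cancels in
  -- the alternation.
  have key : ∀ u v, fderiv ℝ (pullbackLiouville ι f) p (ι u) v =
      modelLiouville E (fderiv ℝ f p (ι u)) (fderiv ℝ f p (ι v)) +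
        modelLiouville E (f p) (fderiv ℝ (fderiv ℝ f) p (ι u) (ι v)) := by
    intro u v
    have h1 : HasFDerivAt (fun p ↦ modelLiouville E (f p) (fderiv ℝ f p (ι v))) _ p :=
      ((modelLiouville E).hasFDerivAt.comp p (hf.differentiableAt (by simp)).hasFDerivAt).clm_apply
        (hd.clm_apply (hasFDerivAt_const (ι v) p))
    have h2 : HasFDerivAt (fun p ↦ modelLiouville E (f p) (fderiv ℝ f p (ι v)))
        ((fderiv ℝ (pullbackLiouville ι f) p).flip v) p := by
      have := ((hf.pullbackLiouville (ι := ι)).differentiableAt (by simp)).hasFDerivAt.clm_apply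
        (hasFDerivAt_const v p)
      simpa [pullbackLiouville] using this
    have h3 := congr($(h2.unique h1) (ι u))
    simp only [ContinuousLinearMap.flip_apply] at h3
    rw [h3]
    simp
    ring
  rw [key, key, hsymm]
  simp only [modelLiouville_apply, modelSymplectic_apply]
  ring

end PullbackLiouville

/-! ### Averages of forms along a flow. -/

section FlowAverage

variable {F : Type*} [NormedAddCommGroup F] [NormedSpace ℝ F]
  {H : Type*} [TopologicalSpace H] {I : ModelWithCorners ℝ F H} [I.Boundaryless]
  {N : Type*} [TopologicalSpace N] [ChartedSpace H N] {k : ℕ}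

lemma formPullback_congr {f g : N → N} {x : N} (h : f =ᶠ[𝓝 x] g) (β : DiffForm I N k) :
    formPullback I I f β x = formPullback I I g β x := by
  ext v
  -- The points `f x` and `g x` are only propositionally equal, so the two forms are compared on
  -- vectors of the model space.
  have h1 : ∀ y y' : N, y = y' → ∀ w : Fin k → F, β y w = β y' w := by rintro _ _ rfl w; rfl
  have h2 : ∀ v : TangentSpace I x, mfderiv I I f x v = mfderiv I I g x v :=
    fun v ↦ congr($h.mfderiv_eq v)
  refine (h1 _ _ h.self_of_nhds _).trans ?_
  refine congrArg (β (g x)) (funext fun i ↦ ?_)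
  exact h2 (v i)

variable [IsManifold I ∞ N] [IsManifold I 1 N]
  {V : Π ξ : N, TangentSpace I ξ} {Ω : Set N} {J : Set ℝ} {O : Set N} {ψ φ : ℝ → N → N}

lemma formInChart_apply_chartDeriv {c η : N} (h : η ∈ (chartAt H c).source) (β : DiffForm I N k)
    (v : Fin k → TangentSpace I η) :
    formInChart I c β (extChartAt I c η) (fun i ↦ chartDeriv I c η (v i)) = β η v := by
  have key : ∀ z ∈ (extChartAt I c).target,
      ∀ v : Fin k → TangentSpace I ((extChartAt I c).symm z),
      formInChart I c β z (fun i ↦ chartDeriv I c ((extChartAt I c).symm z) (v i)) =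
        β ((extChartAt I c).symm z) v := by
    intro z hz v
    rw [formInChart_eq, ContinuousAlternatingMap.compContinuousLinearMap_apply]
    exact congrArg _ (funext fun i ↦ chartSymmDeriv_chartDeriv hz (v i))
  have hη : η ∈ (extChartAt I c).source := by rwa [extChartAt_source]
  have h1 := key _ ((extChartAt I c).map_source hη)
  rw [(extChartAt I c).left_inv hη] at h1
  exact h1 v

/-- In charts the pullback is built from the flow, its derivative and the form, all differentiable
along the flow. The resulting integrability lets evaluation on vectors pass through the averaging
integral. -/
lemma IsSmoothFlow.continuousOn_formPullback (h : IsSmoothFlow I V Ω J O ψ) (hJ : IsOpen J)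
    {β : DiffForm I N k}
    (hβ : ∀ c, DifferentiableOn ℝ (formInChart I c β) (extChartAt I c).target)
    {ξ : N} (hξ : ξ ∈ O) :
    ContinuousOn (fun s ↦ (formPullback I I (ψ s) β ξ).compContinuousLinearMap
      (tangentIdent I ξ : F →L[ℝ] TangentSpace I ξ)) J := by
  intro s hs
  set c' := ψ s ξ with hc'
  have hl : (extChartAt I ξ).symm (extChartAt I ξ ξ) = ξ :=
    (extChartAt I ξ).left_inv (mem_extChartAt_source ξ)
  have hev := h.eventually_flowInChart hJ hs (mem_extChartAt_target ξ) (c' := c') (by rwa [hl])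
    (by rw [hl]; exact mem_chart_source H c')
  have hcont : ContinuousAt (fun t : ℝ ↦ (t, extChartAt I ξ ξ)) s := by fun_prop
  have hev' := hcont.eventually hev
  have hf : ContDiffAt ℝ ∞ (flowInChart I ψ ξ c') (s, extChartAt I ξ ξ) :=
    h.contDiffAt_flowInChart hJ hs (mem_extChartAt_target ξ) (by rwa [hl])
      (by rw [hl]; exact mem_chart_source H c')
  have hfs : DifferentiableAt ℝ (fun t : ℝ ↦ flowInChart I ψ ξ c' (t, extChartAt I ξ ξ)) s :=
    DifferentiableAt.comp s (g := flowInChart I ψ ξ c') (hf.differentiableAt (by simp))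
      (differentiableAt_id.prodMk (differentiableAt_const _))
  have hfd : DifferentiableAt ℝ
      (fun t : ℝ ↦ fderiv ℝ (flowInChart I ψ ξ c') (t, extChartAt I ξ ξ)) s :=
    DifferentiableAt.comp s ((hf.fderiv_right (m := ∞) le_rfl).differentiableAt (by simp))
      (differentiableAt_id.prodMk (differentiableAt_const _))
  have h1 : DifferentiableAt ℝ (fun t : ℝ ↦
      (formInChart I c' β (flowInChart I ψ ξ c' (t, extChartAt I ξ ξ))).compContinuousLinearMap
        (fderiv ℝ (flowInChart I ψ ξ c') (t, extChartAt I ξ ξ) ∘L ((ContinuousLinearMap.inr ℝ ℝ F) ∘L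
          (chartDeriv I ξ ξ ∘L (tangentIdent I ξ : F →L[ℝ] TangentSpace I ξ))))) s := by
    refine DifferentiableAt.continuousAlternatingMapCompContinuousLinearMap ?_
      (hfd.clm_comp (differentiableAt_const _))
    refine DifferentiableAt.comp s (g := formInChart I c' β)
      (f := fun t : ℝ ↦ flowInChart I ψ ξ c' (t, extChartAt I ξ ξ)) ?_ hfs
    refine (hβ c').differentiableAt ((isOpen_extChartAt_target c').mem_nhds ?_)
    simp only [flowInChart, hl]
    exact mem_extChartAt_target c'
  refine (h1.continuousAt.congr ?_).continuousWithinAt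
  filter_upwards [hev'] with t ht
  rw [hl] at ht
  ext u
  rw [ContinuousAlternatingMap.compContinuousLinearMap_apply,
    ContinuousAlternatingMap.compContinuousLinearMap_apply, formPullback,
    ContinuousAlternatingMap.compContinuousLinearMap_apply,
    ← formInChart_apply_chartDeriv ht.2.2.2]
  simp only [flowInChart, hl]
  refine congrArg _ (funext fun i ↦ ?_)
  exact (h.chartDeriv_mfderiv hJ ht.1 (mem_chart_source H ξ) hξ ht.2.2.2 _).symm

/-- The averaged forms in terms of a smooth flow. -/
theorem IsSmoothFlow.flowAverage_apply (h : IsSmoothFlow I V Ω J O ψ) (hJ : IsOpen J)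
    (hJ' : Icc 0 1 ⊆ J) {β : DiffForm I N k}
    (hβ : ∀ c, DifferentiableOn ℝ (formInChart I c β) (extChartAt I c).target)
    (hφ : ∀ x ∈ O, ∀ s ∈ Icc (0 : ℝ) 1, ψ s x = φ s x) {ξ : N} (hξ : ξ ∈ O)
    {ε : ℝ} (hε : ε ∈ Icc (0 : ℝ) 1) (v : Fin k → TangentSpace I ξ) :
    flowAverage I φ β ε ξ v =
      ∫ s in (0 : ℝ)..1, formPullback I I (ψ (ε * s)) β ξ v := by
  rw [flowAverage]
  split_ifs with h0
  · subst h0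
    have : ∀ s : ℝ, formPullback I I (ψ (0 * s)) β ξ v = β ξ v := by
      intro s
      have h1 : ψ (0 * s) =ᶠ[𝓝 ξ] id := by
        filter_upwards [h.isOpen.mem_nhds hξ] with x hx
        rw [zero_mul]; exact h.initial x hx
      rw [formPullback_congr h1, formPullback, mfderiv_id]
      rfl
    simp only [this]
    simp
  · have hε0 : 0 < ε := lt_of_le_of_ne hε.1 (Ne.symm h0)
    have hcongr : ∫ s in (0 : ℝ)..ε, (formPullback I I (φ s) β ξ).compContinuousLinearMap
        (tangentIdent I ξ : F →L[ℝ] TangentSpace I ξ) =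
        ∫ s in (0 : ℝ)..ε, (formPullback I I (ψ s) β ξ).compContinuousLinearMap
        (tangentIdent I ξ : F →L[ℝ] TangentSpace I ξ) := by
      refine intervalIntegral.integral_congr fun s hs ↦ ?_
      rw [uIcc_of_le hε0.le] at hs
      have h1 : φ s =ᶠ[𝓝 ξ] ψ s := by
        filter_upwards [h.isOpen.mem_nhds hξ] with x hx
        exact (hφ x hx s ⟨hs.1, hs.2.trans hε.2⟩).symm
      simp only [formPullback_congr h1]
    have hint : IntervalIntegrable (fun s ↦ (formPullback I I (ψ s) β ξ).compContinuousLinearMap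
        (tangentIdent I ξ : F →L[ℝ] TangentSpace I ξ)) MeasureTheory.volume 0 ε := by
      refine ContinuousOn.intervalIntegrable ?_
      rw [uIcc_of_le hε0.le]
      exact (h.continuousOn_formPullback hJ hβ hξ).mono ((Icc_subset_Icc_right hε.2).trans hJ')
    rw [hcongr]
    have h2 := (ContinuousAlternatingMap.apply ℝ F ℝ
      (fun i ↦ (tangentIdent I ξ).symm (v i))).intervalIntegral_comp_comm hint
    -- The substitution `s ↦ ε s` absorbs the factor `1/ε`; the formula over `[0, 1]` has no
    -- singularity at `ε = 0`.
    have h3 := intervalIntegral.smul_integral_comp_mul_left (a := 0) (b := 1)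
      (fun s ↦ formPullback I I (ψ s) β ξ v) ε
    rw [mul_zero, mul_one] at h3
    have h4 : ∫ s in (0 : ℝ)..1, formPullback I I (ψ (ε * s)) β ξ v =
        ε⁻¹ • ∫ s in (0 : ℝ)..ε, formPullback I I (ψ s) β ξ v := by
      rw [← h3, smul_smul, inv_mul_cancel₀ h0, one_smul]
    rw [h4]
    exact congr(ε⁻¹ • $h2.symm)

end FlowAverage

/-! ### The forms `θ_{V,ε}` and `ω_{V,ε}` in charts. -/

section Potential

variable {E : Type*} [NormedAddCommGroup E] [NormedSpace ℝ E]
    {M : Type*} [TopologicalSpace M] [ChartedSpace E M] [IsManifold 𝓘(ℝ, E) ∞ M]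
    [IsManifold 𝓘(ℝ, E) 1 M]

lemma differentiableOn_formInChart_liouville (c : Cotangent E M) :
    DifferentiableOn ℝ (formInChart (cotangentModel E) c (liouville E M))
      (extChartAt (cotangentModel E) c).target :=
  (contDiff_modelLiouvilleForm.differentiable (by simp)).differentiableOn.congr
    fun _ hz ↦ formInChart_liouville hz

lemma differentiableOn_formInChart_canonicalForm (c : Cotangent E M) :
    DifferentiableOn ℝ (formInChart (cotangentModel E) c (canonicalForm E M))
      (extChartAt (cotangentModel E) c).target :=
  (differentiableOn_const (modelSymplecticForm E)).congr fun _ hz ↦ formInChart_canonicalForm hz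

/-- The pullback of the Liouville form under `ψ s`, in the chart at `c`. -/
def liouvilleDensity (ψ : ℝ → Cotangent E M → Cotangent E M) (c : Cotangent E M)
    (p : ℝ × (E × (E →L[ℝ] ℝ))) : (E × (E →L[ℝ] ℝ)) →L[ℝ] ℝ :=
  (ψ p.1 ((extChartAt (cotangentModel E) c).symm p.2)).2 ∘L
    (mfderiv (cotangentModel E) 𝓘(ℝ, E) (cotangentProj E M)
      (ψ p.1 ((extChartAt (cotangentModel E) c).symm p.2)) ∘L
    (mfderiv (cotangentModel E) (cotangentModel E) (ψ p.1)
      ((extChartAt (cotangentModel E) c).symm p.2) ∘L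
    chartSymmDeriv (cotangentModel E) c p.2))

variable {V : Π ξ : Cotangent E M, TangentSpace (cotangentModel E) ξ} {Ω : Set (Cotangent E M)}
  {J : Set ℝ} {O : Set (Cotangent E M)} {ψ φ : ℝ → Cotangent E M → Cotangent E M}

lemma liouvilleDensity_apply (c : Cotangent E M) (p : ℝ × (E × (E →L[ℝ] ℝ)))
    (u : E × (E →L[ℝ] ℝ)) : liouvilleDensity ψ c p u =
      formPullback (cotangentModel E) (cotangentModel E) (ψ p.1) (liouville E M)
        ((extChartAt (cotangentModel E) c).symm p.2)
        ![chartSymmDeriv (cotangentModel E) c p.2 u] := rfl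

/-- The density is defined without a chart on the target. Near a given point any chart at `c'`
around the image turns it into a pullback of `p dx`, from which smoothness and the exterior
derivative are read off. -/
lemma IsSmoothFlow.liouvilleDensity_eventuallyEq
    (h : IsSmoothFlow (cotangentModel E) V Ω J O ψ) (hJ : IsOpen J)
    {c c' : Cotangent E M} {s : ℝ} (hs : s ∈ J) {z : E × (E →L[ℝ] ℝ)}
    (hz : z ∈ (extChartAt (cotangentModel E) c).target)
    (hzO : (extChartAt (cotangentModel E) c).symm z ∈ O)
    (hc' : ψ s ((extChartAt (cotangentModel E) c).symm z) ∈
      (chartAt (ModelProd E (E →L[ℝ] ℝ)) c').source) :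
    liouvilleDensity ψ c =ᶠ[𝓝 (s, z)] pullbackLiouville (ContinuousLinearMap.inr ℝ ℝ _)
      (flowInChart (cotangentModel E) ψ c c') := by
  filter_upwards [h.eventually_flowInChart hJ hs hz hzO hc'] with p hp
  refine ContinuousLinearMap.ext fun u ↦ ?_
  rw [liouvilleDensity_apply, formPullback, ContinuousAlternatingMap.compContinuousLinearMap_apply,
    liouville_apply_chart (cotangent_mem_chartSource.1 hp.2.2.2)]
  have h1 := (extChartAt (cotangentModel E) c).map_target hp.2.1
  rw [extChartAt_source] at h1
  have h2 := h.chartDeriv_mfderiv hJ (c := c) hp.1 h1 hp.2.2.1 hp.2.2.2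
    (chartSymmDeriv (cotangentModel E) c p.2 u)
  rw [chartDeriv_chartSymmDeriv hp.2.1, (extChartAt (cotangentModel E) c).right_inv hp.2.1] at h2
  simp only [Function.comp_apply, Matrix.cons_val_zero]
  rw [h2]
  rfl

lemma IsSmoothFlow.contDiffOn_liouvilleDensity
    (h : IsSmoothFlow (cotangentModel E) V Ω J O ψ) (hJ : IsOpen J) (c : Cotangent E M) :
    ContDiffOn ℝ ∞ (liouvilleDensity ψ c) (J ×ˢ ((extChartAt (cotangentModel E) c).target ∩
      (extChartAt (cotangentModel E) c).symm ⁻¹' O)) := by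
  rintro ⟨s, z⟩ ⟨hs, hz, hzO⟩
  have hc' := mem_chart_source (ModelProd E (E →L[ℝ] ℝ))
    (ψ s ((extChartAt (cotangentModel E) c).symm z))
  exact ((h.contDiffAt_flowInChart hJ hs hz hzO hc').pullbackLiouville.congr_of_eventuallyEq
    (h.liouvilleDensity_eventuallyEq hJ hs hz hzO hc')).contDiffWithinAt

lemma IsSmoothFlow.fderiv_liouvilleDensity_alternate
    (h : IsSmoothFlow (cotangentModel E) V Ω J O ψ) (hJ : IsOpen J) {c : Cotangent E M}
    {s : ℝ} (hs : s ∈ J) {ξ : Cotangent E M}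
    (hξ : ξ ∈ (chartAt (ModelProd E (E →L[ℝ] ℝ)) c).source) (hξO : ξ ∈ O)
    (v : Fin 2 → TangentSpace (cotangentModel E) ξ) :
    fderiv ℝ (liouvilleDensity ψ c) (s, extChartAt (cotangentModel E) c ξ)
        (0, chartDeriv (cotangentModel E) c ξ (v 0)) (chartDeriv (cotangentModel E) c ξ (v 1)) -
      fderiv ℝ (liouvilleDensity ψ c) (s, extChartAt (cotangentModel E) c ξ)
        (0, chartDeriv (cotangentModel E) c ξ (v 1)) (chartDeriv (cotangentModel E) c ξ (v 0)) =
      formPullback (cotangentModel E) (cotangentModel E) (ψ s) (canonicalForm E M) ξ v := by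
  have hξ' : ξ ∈ (extChartAt (cotangentModel E) c).source := by rwa [extChartAt_source]
  have hl := (extChartAt (cotangentModel E) c).left_inv hξ'
  have hz := (extChartAt (cotangentModel E) c).map_source hξ'
  have hc' := mem_chart_source (ModelProd E (E →L[ℝ] ℝ)) (ψ s ξ)
  have h1 := h.liouvilleDensity_eventuallyEq hJ (c := c) (c' := ψ s ξ) hs hz (by rwa [hl])
    (by rwa [hl])
  have h2 := fderiv_pullbackLiouville_alternate (ι := ContinuousLinearMap.inr ℝ ℝ _)
    (h.contDiffAt_flowInChart hJ (c := c) (c' := ψ s ξ) hs hz (by rwa [hl]) (by rwa [hl]))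
    (chartDeriv (cotangentModel E) c ξ (v 0)) (chartDeriv (cotangentModel E) c ξ (v 1))
  rw [h1.fderiv_eq]
  simp only [ContinuousLinearMap.inr_apply] at h2
  rw [h2, formPullback, ContinuousAlternatingMap.compContinuousLinearMap_apply,
    canonicalForm_apply_chart (cotangent_mem_chartSource.1 hc')]
  simp only [Function.comp_apply]
  rw [← h.chartDeriv_mfderiv hJ hs hξ hξO hc', ← h.chartDeriv_mfderiv hJ hs hξ hξO hc']

/-- `Θ` expresses the forms `θ_{V,ε}` in the chart at `c`, over the open set `O'` of the model
space. -/
structure IsPotential (φ : ℝ → Cotangent E M → Cotangent E M) (c : Cotangent E M) (δ : ℝ)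
    (O' : Set (E × (E →L[ℝ] ℝ)))
    (Θ : ℝ × (E × (E →L[ℝ] ℝ)) → (E × (E →L[ℝ] ℝ)) →L[ℝ] ℝ) : Prop where
  pos : 0 < δ
  isOpen : IsOpen O'
  subset_target : O' ⊆ (extChartAt (cotangentModel E) c).target
  smooth : ContDiffOn ℝ ∞ Θ (Ioo (-δ) (1 + δ) ×ˢ O')
  theta : ∀ ε ∈ Icc (0 : ℝ) 1, ∀ ξ ∈ (chartAt (ModelProd E (E →L[ℝ] ℝ)) c).source,
    extChartAt (cotangentModel E) c ξ ∈ O' → ∀ v : TangentSpace (cotangentModel E) ξ,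
      thetaForm φ ε ξ ![v] = Θ (ε, extChartAt (cotangentModel E) c ξ)
        (chartDeriv (cotangentModel E) c ξ v)
  omega : ∀ ε ∈ Icc (0 : ℝ) 1, ∀ ξ ∈ (chartAt (ModelProd E (E →L[ℝ] ℝ)) c).source,
    extChartAt (cotangentModel E) c ξ ∈ O' → ∀ u v : TangentSpace (cotangentModel E) ξ,
      omegaForm φ ε ξ ![u, v] =
        fderiv ℝ Θ (ε, extChartAt (cotangentModel E) c ξ)
          (0, chartDeriv (cotangentModel E) c ξ u) (chartDeriv (cotangentModel E) c ξ v) -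
        fderiv ℝ Θ (ε, extChartAt (cotangentModel E) c ξ)
          (0, chartDeriv (cotangentModel E) c ξ v) (chartDeriv (cotangentModel E) c ξ u)

/-- The averaged Liouville forms in the chart at `c`. -/
def averagedDensity (ψ : ℝ → Cotangent E M → Cotangent E M) (c : Cotangent E M)
    (p : ℝ × (E × (E →L[ℝ] ℝ))) : (E × (E →L[ℝ] ℝ)) →L[ℝ] ℝ :=
  ∫ s in (0 : ℝ)..1, liouvilleDensity ψ c (p.1 * s, p.2)

lemma mul_mem_Ioo {δ ε s : ℝ} (hδ : 0 < δ) (hε : ε ∈ Ioo (-δ) (1 + δ)) (hs : s ∈ Icc (0 : ℝ) 1) :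
    ε * s ∈ Ioo (-δ) (1 + δ) := by
  have h := convex_Ioo (-δ) (1 + δ) hε (y := 0) ⟨by linarith, by linarith⟩ hs.1
    (sub_nonneg.2 hs.2) (by ring)
  simpa [mul_comm] using h

/-- Differentiation under the integral sign shows that the exterior derivative of the averaged
densities is the average of the pullbacks of `ω₀`. The open time interval makes ordinary derivatives
in `ε` available at `0` and `1`. -/
theorem IsSmoothFlow.isPotential {δ : ℝ} (hδ : 0 < δ)
    (h : IsSmoothFlow (cotangentModel E) V Ω (Ioo (-δ) (1 + δ)) O ψ)
    (hφ : ∀ x ∈ O, ∀ s ∈ Icc (0 : ℝ) 1, ψ s x = φ s x) (c : Cotangent E M) :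
    IsPotential φ c δ ((extChartAt (cotangentModel E) c).target ∩
      (extChartAt (cotangentModel E) c).symm ⁻¹' O) (averagedDensity ψ c) := by
  set κ := extChartAt (cotangentModel E) c with hκ
  set O' : Set (E × (E →L[ℝ] ℝ)) := κ.target ∩ κ.symm ⁻¹' O with hO'
  have hJ' : Icc 0 1 ⊆ Ioo (-δ) (1 + δ) := fun x hx ↦ ⟨by linarith [hx.1], by linarith [hx.2]⟩
  have hO'o : IsOpen O' :=
    (continuousOn_extChartAt_symm c).isOpen_inter_preimage (isOpen_extChartAt_target c) h.isOpen
  have hd := h.contDiffOn_liouvilleDensity isOpen_Ioo c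
  set m : ℝ × (ℝ × (E × (E →L[ℝ] ℝ))) → ℝ × (E × (E →L[ℝ] ℝ)) := fun q ↦ (q.2.1 * q.1, q.2.2)
    with hm
  have hmc : ContDiff ℝ ∞ m := by fun_prop
  set S := m ⁻¹' (Ioo (-δ) (1 + δ) ×ˢ O') with hS
  have hSo : IsOpen S := (isOpen_Ioo.prod hO'o).preimage hmc.continuous
  have hg : ContDiffOn ℝ ∞ (liouvilleDensity ψ c ∘ m) S :=
    hd.comp hmc.contDiffOn (fun _ hq ↦ hq)
  have hmem : ∀ ε ∈ Ioo (-δ) (1 + δ), ∀ z ∈ O', ∀ s ∈ Icc (0 : ℝ) 1, (s, (ε, z)) ∈ S :=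
    fun ε hε z hz s hs ↦ ⟨mul_mem_Ioo hδ hε hs, hz⟩
  have hξO : ∀ ξ ∈ (chartAt (ModelProd E (E →L[ℝ] ℝ)) c).source, κ ξ ∈ O' → ξ ∈ O := by
    intro ξ hξ hz
    have := hz.2
    rwa [mem_preimage, κ.left_inv (by rwa [hκ, extChartAt_source])] at this
  refine ⟨hδ, hO'o, inter_subset_left, ?_, ?_, ?_⟩
  · exact (contDiffOn_integral_Icc hSo hg).mono fun p hp s hs ↦ hmem _ hp.1 _ hp.2 s hs
  · intro ε hε ξ hξ hz v
    have hc : ContinuousOn (fun s : ℝ ↦ liouvilleDensity ψ c (ε * s, κ ξ)) (Icc 0 1) :=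
      hd.continuousOn.comp (by fun_prop) fun s hs ↦ ⟨mul_mem_Ioo hδ (hJ' hε) hs, hz⟩
    rw [averagedDensity, ContinuousLinearMap.intervalIntegral_apply
      (hc.intervalIntegrable_of_Icc zero_le_one), thetaForm, h.flowAverage_apply isOpen_Ioo hJ'
        differentiableOn_formInChart_liouville hφ (hξO ξ hξ hz) hε]
    refine intervalIntegral.integral_congr fun s hs ↦ ?_
    simp only [liouvilleDensity_apply]
    -- Stated for arbitrary `η`, so that `κ.symm z` can be substituted for it in the dependent
    -- types.
    have key : ∀ η (v : TangentSpace (cotangentModel E) η), η ∈ κ.source →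
        formPullback (cotangentModel E) (cotangentModel E) (ψ (ε * s)) (liouville E M) η ![v] =
        formPullback (cotangentModel E) (cotangentModel E) (ψ (ε * s)) (liouville E M)
          (κ.symm (κ η)) ![chartSymmDeriv (cotangentModel E) c (κ η)
            (chartDeriv (cotangentModel E) c η v)] := by
      intro η v hη
      obtain ⟨z, hz, rfl⟩ : ∃ z ∈ κ.target, κ.symm z = η := ⟨κ η, κ.map_source hη, κ.left_inv hη⟩
      have h1 := chartSymmDeriv_chartDeriv hz v
      nth_rewrite 1 [← h1]
      rw [κ.right_inv hz]
    exact key ξ v (by rwa [hκ, extChartAt_source])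
  · intro ε hε ξ hξ hz u v
    have hcont : ∀ u : E × (E →L[ℝ] ℝ), ContinuousOn
        (fun s : ℝ ↦ fderiv ℝ (liouvilleDensity ψ c) (ε * s, κ ξ) (0, u)) (Icc 0 1) := by
      intro u
      refine ContinuousOn.clm_apply ?_ continuousOn_const
      exact (hd.continuousOn_fderiv_of_isOpen (isOpen_Ioo.prod hO'o) (by simp)).comp (by fun_prop)
        fun s hs ↦ ⟨mul_mem_Ioo hδ (hJ' hε) hs, hz⟩
    have hint : ∀ u v : E × (E →L[ℝ] ℝ), IntervalIntegrable
        (fun s : ℝ ↦ fderiv ℝ (liouvilleDensity ψ c) (ε * s, κ ξ) (0, u) v)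
        MeasureTheory.volume 0 1 := fun u v ↦
      ((hcont u).clm_apply continuousOn_const).intervalIntegrable_of_Icc zero_le_one
    have hfd : ∀ u v : E × (E →L[ℝ] ℝ),
        fderiv ℝ (averagedDensity ψ c) (ε, κ ξ) (0, u) v =
          ∫ s in (0 : ℝ)..1, fderiv ℝ (liouvilleDensity ψ c) (ε * s, κ ξ) (0, u) v := by
      intro u v
      have h1 := fderiv_integral_Icc_apply hSo hg (p := (ε, κ ξ))
        (hmem ε (hJ' hε) (κ ξ) hz) (0, u)
      have h2 : ∀ s ∈ Icc (0 : ℝ) 1, fderiv ℝ (liouvilleDensity ψ c ∘ m) (s, (ε, κ ξ)) (0, (0, u)) =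
          fderiv ℝ (liouvilleDensity ψ c) (ε * s, κ ξ) (0, u) := by
        intro s hs
        have hp : HasFDerivAt (fun q : ℝ × (ℝ × (E × (E →L[ℝ] ℝ))) ↦ q.2)
            (.snd ℝ ℝ (ℝ × (E × (E →L[ℝ] ℝ)))) (s, (ε, κ ξ)) := hasFDerivAt_snd
        have hm' : HasFDerivAt (𝕜 := ℝ) m _ (s, (ε, κ ξ)) :=
          ((hp.fst).mul hasFDerivAt_fst).prodMk hp.snd
        have h3 : HasFDerivAt (liouvilleDensity ψ c) (fderiv ℝ (liouvilleDensity ψ c) (ε * s, κ ξ))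
            (m (s, (ε, κ ξ))) :=
          ((hd.contDiffAt ((isOpen_Ioo.prod hO'o).mem_nhds
            ⟨mul_mem_Ioo hδ (hJ' hε) hs, hz⟩)).differentiableAt (by simp)).hasFDerivAt
        rw [(h3.comp _ hm').fderiv]
        simp
      have h4 : ∫ s in (0 : ℝ)..1, fderiv ℝ (liouvilleDensity ψ c ∘ m) (s, (ε, κ ξ)) (0, (0, u)) =
          ∫ s in (0 : ℝ)..1, fderiv ℝ (liouvilleDensity ψ c) (ε * s, κ ξ) (0, u) := by
        refine intervalIntegral.integral_congr fun s hs ↦ h2 s ?_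
        rwa [uIcc_of_le zero_le_one] at hs
      have h5 := congr($(h1.trans h4) v)
      rw [ContinuousLinearMap.intervalIntegral_apply
        ((hcont u).intervalIntegrable_of_Icc zero_le_one)] at h5
      exact h5
    rw [hfd, hfd, ← intervalIntegral.integral_sub, omegaForm, h.flowAverage_apply isOpen_Ioo hJ'
        differentiableOn_formInChart_canonicalForm hφ (hξO ξ hξ hz) hε]
    · refine intervalIntegral.integral_congr fun s hs ↦ ?_
      rw [uIcc_of_le zero_le_one] at hs
      exact (h.fderiv_liouvilleDensity_alternate isOpen_Ioo (mul_mem_Ioo hδ (hJ' hε) hs) hξ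
        (hξO ξ hξ hz) ![u, v]).symm
    · exact hint _ _
    · exact hint _ _

end Potential

/-! ### Poisson sprays in charts and the consequences of homogeneity. -/

section SprayInCharts

variable {E : Type*} [NormedAddCommGroup E] [NormedSpace ℝ E]
    {M : Type*} [TopologicalSpace M] [ChartedSpace E M] [IsManifold 𝓘(ℝ, E) ∞ M]
    [IsManifold 𝓘(ℝ, E) 1 M]

/-- The Poisson tensor in the chart at `b`. -/
def sharpInChart (P : SharpField E M) (b : M) (x : E) : (E →L[ℝ] ℝ) →L[ℝ] E :=
  chartDeriv 𝓘(ℝ, E) b ((extChartAt 𝓘(ℝ, E) b).symm x) ∘L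
    (P ((extChartAt 𝓘(ℝ, E) b).symm x) ∘L
      ContinuousLinearMap.precomp ℝ (chartDeriv 𝓘(ℝ, E) b ((extChartAt 𝓘(ℝ, E) b).symm x)))

lemma sharpInChart_apply {P : SharpField E M} {b y : M} (hy : y ∈ (chartAt E b).source)
    (α : E →L[ℝ] ℝ) : sharpInChart P b (extChartAt 𝓘(ℝ, E) b y) α =
      chartDeriv 𝓘(ℝ, E) b y (P y (α ∘L chartDeriv 𝓘(ℝ, E) b y)) := by
  have h : ∀ y' : M, y' = y →
      (chartDeriv 𝓘(ℝ, E) b y' ∘L (P y' ∘L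
        ContinuousLinearMap.precomp ℝ (chartDeriv 𝓘(ℝ, E) b y'))) α =
      chartDeriv 𝓘(ℝ, E) b y (P y (α ∘L chartDeriv 𝓘(ℝ, E) b y)) := by
    rintro _ rfl
    rfl
  exact h _ ((extChartAt 𝓘(ℝ, E) b).left_inv (by rwa [extChartAt_source]))

lemma cotangent_snd_comp_chartDeriv {c ξ : Cotangent E M} (h : ξ.proj ∈ (chartAt E c.proj).source) :
    (extChartAt (cotangentModel E) c ξ).2 ∘L chartDeriv 𝓘(ℝ, E) c.proj ξ.proj = ξ.2 :=
  ContinuousLinearMap.ext fun u ↦ cotangent_extChartAt_snd h u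

lemma cotangent_extChartAt_fiberMul {c ξ : Cotangent E M} (h : ξ.proj ∈ (chartAt E c.proj).source)
    (t : ℝ) : extChartAt (cotangentModel E) c (fiberMul E M t ξ) =
      ((extChartAt (cotangentModel E) c ξ).1, t • (extChartAt (cotangentModel E) c ξ).2) := by
  refine Prod.ext ?_ (ContinuousLinearMap.ext fun u ↦ ?_)
  · rw [cotangent_extChartAt_fst, cotangent_extChartAt_fst]
    rfl
  · obtain ⟨u, rfl⟩ := (chartDeriv_bijective (I := 𝓘(ℝ, E)) h).2 u
    have h1 := cotangent_extChartAt_snd (ξ := fiberMul E M t ξ) h u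
    refine h1.trans ?_
    exact congrArg (t • ·) (cotangent_extChartAt_snd h u).symm

/-- Fibrewise multiplication in charts. -/
def modelFiberMul (E : Type*) [NormedAddCommGroup E] [NormedSpace ℝ E] (t : ℝ) :
    E × (E →L[ℝ] ℝ) →L[ℝ] E × (E →L[ℝ] ℝ) :=
  (ContinuousLinearMap.id ℝ E).prodMap (t • ContinuousLinearMap.id ℝ (E →L[ℝ] ℝ))

lemma contMDiff_fiberMul (t : ℝ) :
    ContMDiff (cotangentModel E) (cotangentModel E) ∞ (fiberMul E M t) := by
  intro ξ
  set κ := extChartAt (cotangentModel E) ξ with hκ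
  have hξ : ξ ∈ κ.source := mem_extChartAt_source ξ
  have h1 : fiberMul E M t =ᶠ[𝓝 ξ] fun η ↦ κ.symm (modelFiberMul E t (κ η)) := by
    filter_upwards [(isOpen_extChartAt_source (I := cotangentModel E) ξ).mem_nhds hξ] with η hη
    have hη' : η.proj ∈ (chartAt E ξ.proj).source := by
      rwa [← cotangent_mem_chartSource, ← extChartAt_source (cotangentModel E)]
    have h2 := cotangent_extChartAt_fiberMul hη' t
    rw [← hκ] at h2
    have h3 : fiberMul E M t η ∈ κ.source := by
      rwa [hκ, extChartAt_source, cotangent_mem_chartSource]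
    exact (κ.left_inv h3).symm.trans (congrArg κ.symm h2)
  refine ContMDiffAt.congr_of_eventuallyEq ?_ h1
  refine ContMDiffAt.comp (I' := 𝓘(ℝ, E × (E →L[ℝ] ℝ))) ξ (g := κ.symm) ?_ ?_
  · refine (contMDiffOn_extChartAt_symm ξ).contMDiffAt ((isOpen_extChartAt_target ξ).mem_nhds ?_)
    have := κ.map_source hξ
    rw [hκ, cotangent_extChartAt_target] at this ⊢
    exact ⟨this.1, mem_univ _⟩
  · exact ContMDiffAt.comp (I' := 𝓘(ℝ, E × (E →L[ℝ] ℝ))) ξ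
      (contMDiffAt_iff_contDiffAt.2 (modelFiberMul E t).contDiff.contDiffAt)
      (contMDiffAt_extChartAt' (mem_chart_source _ ξ))

lemma isInvertible_mfderiv_fiberMul {t : ℝ} (ht : t ≠ 0) (ξ : Cotangent E M) :
    (mfderiv (cotangentModel E) (cotangentModel E) (fiberMul E M t) ξ).IsInvertible := by
  have hd : ∀ t η, MDifferentiableAt (cotangentModel E) (cotangentModel E) (fiberMul E M t) η :=
    fun t η ↦ (contMDiff_fiberMul t η).mdifferentiableAt (by simp)
  have hc : ∀ a b : ℝ, a * b = 1 → fiberMul E M a ∘ fiberMul E M b = id := by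
    intro a b hab
    funext η
    have h : a • b • η.2 = η.2 := by rw [smul_smul, hab, one_smul]
    exact congrArg (TotalSpace.mk η.proj) h
  have hl : fiberMul E M t⁻¹ (fiberMul E M t ξ) = ξ :=
    congrFun (hc t⁻¹ t (inv_mul_cancel₀ ht)) ξ
  have h1 := mfderiv_comp ξ (hd t⁻¹ (fiberMul E M t ξ)) (hd t ξ)
  have h2 := mfderiv_comp (fiberMul E M t ξ) (hd t (fiberMul E M t⁻¹ (fiberMul E M t ξ)))
    (hd t⁻¹ (fiberMul E M t ξ))
  rw [hc _ _ (inv_mul_cancel₀ ht), mfderiv_id] at h1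
  rw [hc _ _ (mul_inv_cancel₀ ht), mfderiv_id, hl] at h2
  exact ContinuousLinearMap.IsInvertible.of_inverse
    (g := mfderiv (cotangentModel E) (cotangentModel E) (fiberMul E M t⁻¹) (fiberMul E M t ξ))
    h2.symm h1.symm

variable {P : SharpField E M} {V : Π ξ : Cotangent E M, TangentSpace (cotangentModel E) ξ}

/-- Homogeneity says `V ∘ m_t = Tm_t (tV)`, and in a chart `m_t` is the linear map `modelFiberMul E
t`. -/
lemma IsPoissonSpray.chartDeriv_fiberMul (hV : IsPoissonSpray P V) {c ξ : Cotangent E M}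
    (h : ξ.proj ∈ (chartAt E c.proj).source) {t : ℝ} (ht : t ≠ 0) :
    chartDeriv (cotangentModel E) c (fiberMul E M t ξ) (V (fiberMul E M t ξ)) =
      modelFiberMul E t (t • chartDeriv (cotangentModel E) c ξ (V ξ)) := by
  have h1 := hV.homogeneous t ht ξ
  rw [VectorField.mpullback_apply, (isInvertible_mfderiv_fiberMul ht ξ).inverse_apply_eq] at h1
  rw [h1, fderiv_chart_apply ((contMDiff_fiberMul t ξ).mdifferentiableAt (by simp))
    (cotangent_mem_chartSource.2 h) (cotangent_mem_chartSource.2 h), map_smul]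
  have hξ : ξ ∈ (extChartAt (cotangentModel E) c).source := by
    rwa [extChartAt_source, cotangent_mem_chartSource]
  have h2 : (fun z ↦ extChartAt (cotangentModel E) c
      (fiberMul E M t ((extChartAt (cotangentModel E) c).symm z)))
      =ᶠ[𝓝 (extChartAt (cotangentModel E) c ξ)] modelFiberMul E t := by
    filter_upwards [(isOpen_extChartAt_target c).mem_nhds
      ((extChartAt (cotangentModel E) c).map_source hξ)] with z hz
    have h3 := (extChartAt (cotangentModel E) c).map_target hz
    rw [extChartAt_source, cotangent_mem_chartSource] at h3
    rw [cotangent_extChartAt_fiberMul h3, (extChartAt (cotangentModel E) c).right_inv hz]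
    rfl
  rw [h2.fderiv_eq, ContinuousLinearMap.fderiv]

lemma IsPoissonSpray.chartDeriv_fst (hV : IsPoissonSpray P V) {c ξ : Cotangent E M}
    (h : ξ.proj ∈ (chartAt E c.proj).source) :
    (chartDeriv (cotangentModel E) c ξ (V ξ)).1 =
      sharpInChart P c.proj (extChartAt (cotangentModel E) c ξ).1
        (extChartAt (cotangentModel E) c ξ).2 := by
  rw [cotangent_chartDeriv_fst h, hV.proj, cotangent_extChartAt_fst, sharpInChart_apply h,
    cotangent_snd_comp_chartDeriv h]

lemma IsPoissonSpray.fieldInChart_fst (hV : IsPoissonSpray P V) {c : Cotangent E M}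
    {z : E × (E →L[ℝ] ℝ)} (hz : z ∈ (extChartAt (cotangentModel E) c).target) :
    (fieldInChart (cotangentModel E) V c z).1 = sharpInChart P c.proj z.1 z.2 := by
  have h := (extChartAt (cotangentModel E) c).map_target hz
  rw [extChartAt_source, cotangent_mem_chartSource] at h
  rw [fieldInChart, hV.chartDeriv_fst h, (extChartAt (cotangentModel E) c).right_inv hz]

/-- One factor `t` comes from homogeneity and the other from the action of `m_t` on fibres. -/
lemma IsPoissonSpray.fieldInChart_snd (hV : IsPoissonSpray P V) {c : Cotangent E M}
    {z : E × (E →L[ℝ] ℝ)} (hz : z ∈ (extChartAt (cotangentModel E) c).target) {t : ℝ} (ht : t ≠ 0) :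
    (fieldInChart (cotangentModel E) V c (z.1, t • z.2)).2 =
      t • t • (fieldInChart (cotangentModel E) V c z).2 := by
  set κ := extChartAt (cotangentModel E) c with hκ
  have h := κ.map_target hz
  rw [hκ, extChartAt_source, cotangent_mem_chartSource] at h
  have h1 : κ.symm (z.1, t • z.2) = fiberMul E M t (κ.symm z) := by
    have h3 : fiberMul E M t (κ.symm z) ∈ κ.source := by
      rwa [hκ, extChartAt_source, cotangent_mem_chartSource]
    rw [← κ.left_inv h3, hκ, cotangent_extChartAt_fiberMul h, ← hκ, κ.right_inv hz]
  rw [fieldInChart, ← hκ, h1, hV.chartDeriv_fiberMul h ht]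
  rfl

lemma IsPoissonSpray.contDiffOn_fieldInChart (hV : IsPoissonSpray P V) (c : Cotangent E M) :
    ContDiffOn ℝ ∞ (fieldInChart (cotangentModel E) V c)
      (extChartAt (cotangentModel E) c).target := by
  have := contDiffOn_field_chart (contMDiffOn_univ.2 hV.smooth) c
  rwa [preimage_univ, inter_univ] at this

lemma IsPoissonSpray.contDiffAt_fieldInChart (hV : IsPoissonSpray P V) {c : Cotangent E M}
    {z : E × (E →L[ℝ] ℝ)} (hz : z ∈ (extChartAt (cotangentModel E) c).target) :
    ContDiffAt ℝ ∞ (fieldInChart (cotangentModel E) V c) z :=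
  (hV.contDiffOn_fieldInChart c).contDiffAt ((isOpen_extChartAt_target c).mem_nhds hz)

lemma cotangent_fst_zero_mem_target {c : Cotangent E M}
    {z : E × (E →L[ℝ] ℝ)} (hz : z ∈ (extChartAt (cotangentModel E) c).target) (p : E →L[ℝ] ℝ) :
    (z.1, p) ∈ (extChartAt (cotangentModel E) c).target := by
  rw [cotangent_extChartAt_target] at hz ⊢
  exact ⟨hz.1, mem_univ _⟩

/-- The base component is linear in the covector. The fibre component has degree two, so it equals
four times itself at covector zero (take `t = 2`). -/
lemma IsPoissonSpray.fieldInChart_zero (hV : IsPoissonSpray P V) {c : Cotangent E M}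
    {x : E} (hz : (x, 0) ∈ (extChartAt (cotangentModel E) c).target) :
    fieldInChart (cotangentModel E) V c (x, 0) = 0 := by
  have h1 := hV.fieldInChart_fst hz
  simp only [map_zero] at h1
  refine Prod.ext h1 ?_
  have h2 := hV.fieldInChart_snd hz (t := 2) (by norm_num)
  simp only [smul_zero, smul_smul] at h2
  have h3 : ((2 * 2 - 1 : ℝ)) • (fieldInChart (cotangentModel E) V c (x, 0)).2 = 0 := by
    rw [sub_smul, one_smul, ← h2, sub_self]
  exact (smul_eq_zero.1 h3).resolve_left (by norm_num)

lemma IsPoissonSpray.fderiv_fieldInChart_inl (hV : IsPoissonSpray P V) {c : Cotangent E M}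
    {x : E} (hz : (x, 0) ∈ (extChartAt (cotangentModel E) c).target) (u : E) :
    fderiv ℝ (fieldInChart (cotangentModel E) V c) (x, 0) (u, 0) = 0 := by
  have h1 : HasFDerivAt (fieldInChart (cotangentModel E) V c)
      (fderiv ℝ (fieldInChart (cotangentModel E) V c) (x, 0)) (x, 0) :=
    ((hV.contDiffAt_fieldInChart hz).differentiableAt (by simp)).hasFDerivAt
  have h2 := h1.comp x (hasFDerivAt_prodMk_left (𝕜 := ℝ) x (0 : E →L[ℝ] ℝ))
  have hev : ∀ᶠ y in 𝓝 x, (y, (0 : E →L[ℝ] ℝ)) ∈ (extChartAt (cotangentModel E) c).target :=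
    ContinuousAt.preimage_mem_nhds (f := fun y ↦ (y, (0 : E →L[ℝ] ℝ))) (by fun_prop)
      ((isOpen_extChartAt_target c).mem_nhds hz)
  have h3 : (fieldInChart (cotangentModel E) V c ∘ fun y ↦ (y, (0 : E →L[ℝ] ℝ))) =ᶠ[𝓝 x]
      fun _ ↦ 0 := by
    filter_upwards [hev] with y hy
    exact hV.fieldInChart_zero hy
  exact congr($(h2.unique ((hasFDerivAt_const 0 x).congr_of_eventuallyEq h3)) u)

/-- Along base directions `V` vanishes identically; along a fibre its fibre component is `t² V₂(x,
p)`, whose derivative at `t = 0` is zero. -/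
lemma IsPoissonSpray.fderiv_fieldInChart_snd (hV : IsPoissonSpray P V) {c : Cotangent E M}
    {x : E} (hz : (x, 0) ∈ (extChartAt (cotangentModel E) c).target) (u : E × (E →L[ℝ] ℝ)) :
    (fderiv ℝ (fieldInChart (cotangentModel E) V c) (x, 0) u).2 = 0 := by
  have hu : u = (u.1, 0) + (0, u.2) := by simp
  rw [hu, map_add, hV.fderiv_fieldInChart_inl hz, zero_add]
  have h1 : HasFDerivAt (fieldInChart (cotangentModel E) V c)
      (fderiv ℝ (fieldInChart (cotangentModel E) V c) (x, 0)) (x, (0 : ℝ) • u.2) := by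
    rw [zero_smul]
    exact ((hV.contDiffAt_fieldInChart hz).differentiableAt (by simp)).hasFDerivAt
  have h2 : HasDerivAt (fun t : ℝ ↦ (x, t • u.2)) (0, (1 : ℝ) • u.2) 0 :=
    (hasDerivAt_const 0 x).prodMk ((hasDerivAt_id (0 : ℝ)).smul_const u.2)
  have h3 := (hasFDerivAt_snd.comp _ h1).comp_hasDerivAt (0 : ℝ) h2
  have h4 : (Prod.snd ∘ fieldInChart (cotangentModel E) V c) ∘ (fun t : ℝ ↦ (x, t • u.2)) =
      fun t : ℝ ↦ (t ^ 2) • (fieldInChart (cotangentModel E) V c (x, u.2)).2 := by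
    funext t
    rcases eq_or_ne t 0 with rfl | ht
    · simp [hV.fieldInChart_zero hz]
    · have := hV.fieldInChart_snd (cotangent_fst_zero_mem_target hz u.2) ht
      rw [smul_smul, ← sq] at this
      exact this
  rw [h4] at h3
  have h5 := (((hasDerivAt_id (0 : ℝ)).pow 2).smul_const
    (fieldInChart (cotangentModel E) V c (x, u.2)).2)
  have h6 := h3.unique h5
  simpa using h6

end SprayInCharts

/-! ### Non-degeneracy of the averaged forms in charts. -/

section Nondegeneracy

variable {F : Type*} [NormedAddCommGroup F] [NormedSpace ℝ F]

lemma ContinuousLinearMap.isInvertible_of_injective_dual [FiniteDimensional ℝ F]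
    {B : F →L[ℝ] F →L[ℝ] ℝ} (hB : Function.Injective B) : B.IsInvertible := by
  have hfin : Module.finrank ℝ F = Module.finrank ℝ (F →L[ℝ] ℝ) := by
    rw [← (LinearMap.toContinuousLinearMap (𝕜 := ℝ) (E := F) (F' := ℝ)).finrank_eq]
    exact (Subspace.dual_finrank_eq (K := ℝ) (V := F)).symm
  exact ⟨(LinearEquiv.ofInjectiveOfFinrankEq (B : F →ₗ[ℝ] F →L[ℝ] ℝ) hB hfin).toContinuousLinearEquiv,
    by ext; rfl⟩

/-- The exterior derivative, in the space variable, of the family of 1-forms `Θ`. -/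
def spatialExtDeriv (Θ : ℝ × F → F →L[ℝ] ℝ) (p : ℝ × F) : F →L[ℝ] F →L[ℝ] ℝ :=
  fderiv ℝ Θ p ∘L ContinuousLinearMap.inr ℝ ℝ F -
    (fderiv ℝ Θ p ∘L ContinuousLinearMap.inr ℝ ℝ F).flip

lemma spatialExtDeriv_apply (Θ : ℝ × F → F →L[ℝ] ℝ) (p : ℝ × F) (u v : F) :
    spatialExtDeriv Θ p u v = fderiv ℝ Θ p (0, u) v - fderiv ℝ Θ p (0, v) u := rfl

lemma ContDiffOn.spatialExtDeriv {Θ : ℝ × F → F →L[ℝ] ℝ} {S : Set (ℝ × F)} (hS : IsOpen S)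
    (hΘ : ContDiffOn ℝ ∞ Θ S) : ContDiffOn ℝ ∞ (spatialExtDeriv Θ) S := by
  have h1 : ContDiffOn ℝ ∞ (fun p ↦ fderiv ℝ Θ p ∘L ContinuousLinearMap.inr ℝ ℝ F) S :=
    (hΘ.fderiv_of_isOpen hS (m := ∞) le_rfl).clm_comp contDiffOn_const
  exact h1.sub ((ContinuousLinearMap.flipₗᵢ ℝ F F ℝ).toContinuousLinearEquiv.contDiff.comp_contDiffOn h1)

variable {E : Type*} [NormedAddCommGroup E] [NormedSpace ℝ E]
    {M : Type*} [TopologicalSpace M] [ChartedSpace E M] [IsManifold 𝓘(ℝ, E) ∞ M]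
    [IsManifold 𝓘(ℝ, E) 1 M]
    {φ : ℝ → Cotangent E M → Cotangent E M} {c : Cotangent E M} {δ : ℝ}
    {O' : Set (E × (E →L[ℝ] ℝ))} {Θ : ℝ × (E × (E →L[ℝ] ℝ)) → (E × (E →L[ℝ] ℝ)) →L[ℝ] ℝ}

lemma IsPotential.omega_apply (h : IsPotential φ c δ O' Θ) {ε : ℝ} (hε : ε ∈ Icc (0 : ℝ) 1)
    {ξ : Cotangent E M} (hξ : ξ ∈ (chartAt (ModelProd E (E →L[ℝ] ℝ)) c).source)
    (hO : extChartAt (cotangentModel E) c ξ ∈ O') (u v : TangentSpace (cotangentModel E) ξ) :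
    omegaForm φ ε ξ ![u, v] = spatialExtDeriv Θ (ε, extChartAt (cotangentModel E) c ξ)
      (chartDeriv (cotangentModel E) c ξ u) (chartDeriv (cotangentModel E) c ξ v) :=
  h.omega ε hε ξ hξ hO u v

/-- In finite dimension the injectivity on the right amounts to invertibility, an open condition on
`(ε, z)`. -/
lemma IsPotential.nondegenerate_iff (h : IsPotential φ c δ O' Θ) {ε : ℝ}
    (hε : ε ∈ Icc (0 : ℝ) 1) {ξ : Cotangent E M}
    (hξ : ξ ∈ (chartAt (ModelProd E (E →L[ℝ] ℝ)) c).source)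
    (hO : extChartAt (cotangentModel E) c ξ ∈ O') :
    (∀ v : TangentSpace (cotangentModel E) ξ,
      (∀ w : TangentSpace (cotangentModel E) ξ, omegaForm φ ε ξ ![v, w] = 0) → v = 0) ↔
      Function.Injective (spatialExtDeriv Θ (ε, extChartAt (cotangentModel E) c ξ)) := by
  have hb := chartDeriv_bijective (I := cotangentModel E) hξ
  rw [injective_iff_map_eq_zero]
  constructor
  · intro H u hu
    obtain ⟨v, rfl⟩ := hb.2 u
    rw [H v fun w ↦ by rw [h.omega_apply hε hξ hO, hu]; rfl, map_zero]
  · intro H v hv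
    apply hb.1
    rw [map_zero]
    refine H _ (ContinuousLinearMap.ext fun w ↦ ?_)
    obtain ⟨w, rfl⟩ := hb.2 w
    rw [← h.omega_apply hε hξ hO, hv]
    rfl

end Nondegeneracy

/-! ### Non-degeneracy along the zero section. -/

section ZeroSection

lemma IsSmoothFlow.fderiv_flowInChart_zero {F : Type*} [NormedAddCommGroup F] [NormedSpace ℝ F]
    {H : Type*} [TopologicalSpace H] {I : ModelWithCorners ℝ F H} [I.Boundaryless]
    {N : Type*} [TopologicalSpace N] [ChartedSpace H N] [IsManifold I ∞ N] [IsManifold I 1 N]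
    {V : Π ξ : N, TangentSpace I ξ} {Ω : Set N} {J : Set ℝ} {O : Set N} {ψ : ℝ → N → N}
    (h : IsSmoothFlow I V Ω J O ψ) (hJ : IsOpen J) (h0 : 0 ∈ J) {c : N} {z : F}
    (hz : z ∈ (extChartAt I c).target) (hzO : (extChartAt I c).symm z ∈ O) (u : F) :
    fderiv ℝ (flowInChart I ψ c c) (0, z) (0, u) = u := by
  have hs := (extChartAt I c).map_target hz
  rw [extChartAt_source] at hs
  have hd := ((h.contDiffAt_flowInChart hJ (c := c) (c' := c) h0 hz hzO
    (by rwa [h.initial _ hzO])).differentiableAt (by simp)).hasFDerivAt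
  have h1 := hd.comp z (hasFDerivAt_prodMk_right (𝕜 := ℝ) (0 : ℝ) z)
  have h2 : (flowInChart I ψ c c ∘ fun z ↦ (0, z)) =ᶠ[𝓝 z] id := by
    filter_upwards [((continuousOn_extChartAt_symm c).isOpen_inter_preimage
      (isOpen_extChartAt_target c) h.isOpen).mem_nhds ⟨hz, hzO⟩] with y hy
    simp only [Function.comp_apply, flowInChart]
    rw [h.initial _ hy.2, (extChartAt I c).right_inv hy.1]
    rfl
  exact congr($(h1.unique ((hasFDerivAt_id z).congr_of_eventuallyEq h2)) u)

variable {E : Type*} [NormedAddCommGroup E] [NormedSpace ℝ E]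
    {M : Type*} [TopologicalSpace M] [ChartedSpace E M] [IsManifold 𝓘(ℝ, E) ∞ M]
    [IsManifold 𝓘(ℝ, E) 1 M]
    {P : SharpField E M} {V : Π ξ : Cotangent E M, TangentSpace (cotangentModel E) ξ}
    {φ ψ : ℝ → Cotangent E M → Cotangent E M} {c : Cotangent E M} {δ : ℝ}
    {O Ω : Set (Cotangent E M)}

lemma IsSmoothFlow.mfderiv_chart_formPullback
    {J : Set ℝ} (h : IsSmoothFlow (cotangentModel E) V Ω J O ψ) (hJ : IsOpen J)
    {c c' : Cotangent E M} {s : ℝ} (hs : s ∈ J) {ξ : Cotangent E M}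
    (hξ : ξ ∈ (chartAt (ModelProd E (E →L[ℝ] ℝ)) c).source) (hξO : ξ ∈ O)
    (hc' : ψ s ξ ∈ (chartAt (ModelProd E (E →L[ℝ] ℝ)) c').source)
    (u v : TangentSpace (cotangentModel E) ξ) :
    formPullback (cotangentModel E) (cotangentModel E) (ψ s) (canonicalForm E M) ξ ![u, v] =
      modelSymplectic E
        (fderiv ℝ (flowInChart (cotangentModel E) ψ c c') (s, extChartAt (cotangentModel E) c ξ)
          (0, chartDeriv (cotangentModel E) c ξ u))
        (fderiv ℝ (flowInChart (cotangentModel E) ψ c c') (s, extChartAt (cotangentModel E) c ξ)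
          (0, chartDeriv (cotangentModel E) c ξ v)) := by
  rw [formPullback, ContinuousAlternatingMap.compContinuousLinearMap_apply,
    canonicalForm_apply_chart (cotangent_mem_chartSource.1 hc')]
  simp only [Function.comp_apply]
  rw [h.chartDeriv_mfderiv hJ hs hξ hξO hc', h.chartDeriv_mfderiv hJ hs hξ hξO hc']
  rfl

lemma cotangent_extChartAt_snd_eq_zero (hc : c ∈ cotangentZero E M) :
    (extChartAt (cotangentModel E) c c).2 = 0 := by
  refine ContinuousLinearMap.ext fun u ↦ ?_
  obtain ⟨u, rfl⟩ := (chartDeriv_bijective (I := 𝓘(ℝ, E)) (mem_chart_source E c.proj)).2 u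
  rw [cotangent_extChartAt_snd (mem_chart_source E c.proj)]
  exact congr($(show c.2 = 0 from hc) u)

lemma IsPoissonSpray.eq_zero (hV : IsPoissonSpray P V) (hc : c ∈ cotangentZero E M) :
    V c = 0 := by
  apply (chartDeriv_bijective (I := cotangentModel E)
    (mem_chart_source (ModelProd E (E →L[ℝ] ℝ)) c)).1
  have h1 := mem_extChartAt_target (I := cotangentModel E) c
  have h2 : extChartAt (cotangentModel E) c c = ((extChartAt (cotangentModel E) c c).1, 0) :=
    Prod.ext rfl (cotangent_extChartAt_snd_eq_zero hc)
  rw [h2] at h1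
  have h3 := hV.fieldInChart_zero h1
  rw [← h2, fieldInChart, (extChartAt (cotangentModel E) c).left_inv (mem_extChartAt_source c)] at h3
  rw [h3, map_zero]

/-- The averaged forms are non-degenerate along the zero section. -/
theorem IsPoissonSpray.nondegenerate_zero (hV : IsPoissonSpray P V) (hδ : 0 < δ)
    (h : IsSmoothFlow (cotangentModel E) V univ (Ioo (-δ) (1 + δ)) O ψ)
    (hφ : ∀ x ∈ O, ∀ s ∈ Icc (0 : ℝ) 1, ψ s x = φ s x) (hcO : c ∈ O) (hc : c ∈ cotangentZero E M)
    (hfix : ∀ s ∈ Icc (0 : ℝ) 1, ψ s c = c) {ε : ℝ} (hε : ε ∈ Icc (0 : ℝ) 1)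
    {u : TangentSpace (cotangentModel E) c}
    (hu : ∀ w : TangentSpace (cotangentModel E) c, omegaForm φ ε c ![u, w] = 0) : u = 0 := by
  have hJ' : Icc 0 1 ⊆ Ioo (-δ) (1 + δ) := fun x hx ↦ ⟨by linarith [hx.1], by linarith [hx.2]⟩
  set κ := extChartAt (cotangentModel E) c with hκ
  set f := flowInChart (cotangentModel E) ψ c c with hf
  have hcs := mem_chart_source (ModelProd E (E →L[ℝ] ℝ)) c
  have hl : κ.symm (κ c) = c := κ.left_inv (mem_extChartAt_source c)
  have hz : κ c ∈ κ.target := mem_extChartAt_target c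
  have hz0 : ((κ c).1, (0 : E →L[ℝ] ℝ)) = κ c :=
    Prod.ext rfl (cotangent_extChartAt_snd_eq_zero hc).symm
  set A : ℝ → E × (E →L[ℝ] ℝ) → E × (E →L[ℝ] ℝ) := fun s u ↦ fderiv ℝ f (s, κ c) (0, u) with hA
  have hfz : ∀ s ∈ Icc (0 : ℝ) 1, f (s, κ c) = κ c := by
    intro s hs
    simp only [hf, flowInChart, ← hκ, hl, hfix s hs]
  have hAd : ∀ u, ∀ s ∈ Icc (0 : ℝ) 1, HasDerivAt (fun s ↦ A s u)
      (fderiv ℝ (fieldInChart (cotangentModel E) V c) (κ c) (A s u)) s := by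
    intro u s hs
    have := h.hasDerivAt_fderiv_flowInChart isOpen_Ioo isOpen_univ (contMDiffOn_univ.2 hV.smooth)
      (c := c) (c' := c) (hJ' hs) hz (by rwa [← hκ, hl]) (by rw [← hκ, hl, hfix s hs]; exact hcs) u
    rwa [← hf, hfz s hs] at this
  have hA0 : ∀ u, A 0 u = u := fun u ↦ h.fderiv_flowInChart_zero isOpen_Ioo (hJ' (by simp)) hz
    (by rwa [← hκ, hl]) u
  -- The linearisation of `V` on the zero section has no fibre component, so the variational
  -- equation keeps the fibre component constant.
  have hA2 : ∀ u, ∀ s ∈ Icc (0 : ℝ) 1, (A s u).2 = u.2 := by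
    intro u s hs
    have hd : ∀ s ∈ Icc (0 : ℝ) 1, HasDerivAt (fun s ↦ (A s u).2) 0 s := by
      intro s hs
      have h1 := (hasFDerivAt_snd (𝕜 := ℝ)).comp_hasDerivAt s (hAd u s hs)
      rw [← hz0] at hz
      have h2 := hV.fderiv_fieldInChart_snd hz (A s u)
      rw [hz0] at h2
      rw [← h2]
      exact h1
    have := constant_of_has_deriv_right_zero (a := 0) (b := 1)
      (fun s hs ↦ (hd s hs).continuousAt.continuousWithinAt)
      (fun s hs ↦ (hd s ⟨hs.1, hs.2.le⟩).hasDerivWithinAt) s hs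
    rw [this, hA0]
  -- A vector without fibre component keeps this property, and the linearised field kills such
  -- vectors, so it stays fixed.
  have hA1 : ∀ u : E × (E →L[ℝ] ℝ), u.2 = 0 → ∀ s ∈ Icc (0 : ℝ) 1, A s u = u := by
    intro u hu s hs
    have hd : ∀ s ∈ Icc (0 : ℝ) 1, HasDerivAt (fun s ↦ A s u) 0 s := by
      intro s hs
      have h1 := hAd u s hs
      rw [← hz0] at hz
      have h2 := hV.fderiv_fieldInChart_inl hz (A s u).1
      rw [hz0] at h2
      have h3 : ((A s u).1, (0 : E →L[ℝ] ℝ)) = A s u :=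
        Prod.ext rfl ((hA2 u s hs).trans hu).symm
      rw [h3] at h2
      rwa [h2] at h1
    have := constant_of_has_deriv_right_zero (a := 0) (b := 1)
      (fun s hs ↦ (hd s hs).continuousAt.continuousWithinAt)
      (fun s hs ↦ (hd s ⟨hs.1, hs.2.le⟩).hasDerivWithinAt) s hs
    rw [this, hA0]
  have hω : ∀ v w : TangentSpace (cotangentModel E) c, omegaForm φ ε c ![v, w] =
      ∫ s in (0 : ℝ)..1, modelSymplectic E (A (ε * s) (chartDeriv (cotangentModel E) c c v))
        (A (ε * s) (chartDeriv (cotangentModel E) c c w)) := by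
    intro v w
    rw [omegaForm, h.flowAverage_apply isOpen_Ioo hJ' differentiableOn_formInChart_canonicalForm hφ
      hcO hε]
    refine intervalIntegral.integral_congr fun s hs ↦ ?_
    rw [uIcc_of_le zero_le_one] at hs
    have hs' : ε * s ∈ Icc (0 : ℝ) 1 :=
      ⟨mul_nonneg hε.1 hs.1, mul_le_one₀ hε.2 hs.1 hs.2⟩
    exact h.mfderiv_chart_formPullback isOpen_Ioo (hJ' hs') hcs hcO
      (by rw [hfix _ hs']; exact hcs) v w
  have hb := chartDeriv_bijective (I := cotangentModel E) hcs
  apply hb.1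
  rw [map_zero]
  set u' := chartDeriv (cotangentModel E) c c u with hu'
  have hmem : ∀ s ∈ uIcc (0 : ℝ) 1, ε * s ∈ Icc (0 : ℝ) 1 := by
    intro s hs
    rw [uIcc_of_le zero_le_one] at hs
    exact ⟨mul_nonneg hε.1 hs.1, mul_le_one₀ hε.2 hs.1 hs.2⟩
  -- Against `(x, 0)` the integrand is the constant `u'.2 x`. Once `u'.2 = 0`, the vector `u'` is
  -- fixed as well, and against any `w'` the integrand is constantly `modelSymplectic E u' w'`.
  have hu2 : u'.2 = 0 := by
    refine ContinuousLinearMap.ext fun x ↦ ?_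
    obtain ⟨w, hw⟩ := hb.2 (x, 0)
    have h1 := hu w
    rw [hω, hw, intervalIntegral.integral_congr (g := fun _ ↦ u'.2 x)] at h1
    · simpa using h1
    · intro s hs
      simp only [hA1 (x, 0) rfl _ (hmem s hs), modelSymplectic_apply, ← hu', hA2 u' _ (hmem s hs)]
      simp
  refine modelSymplectic_nondegenerate fun w' ↦ ?_
  obtain ⟨w, hw⟩ := hb.2 w'
  have h1 := hu w
  rw [hω, hw, intervalIntegral.integral_congr (g := fun _ ↦ modelSymplectic E u' w')] at h1
  · simpa using h1
  · intro s hs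
    simp only [← hu', hA1 u' hu2 _ (hmem s hs), modelSymplectic_apply, hA2 w' _ (hmem s hs), hu2]
    simp

end ZeroSection

/-! ### Existence of a domain for the flow and the averaged forms. -/

section Existence

variable {E : Type*} [NormedAddCommGroup E] [NormedSpace ℝ E] [CompleteSpace E]
    {M : Type*} [TopologicalSpace M] [T2Space M] [ChartedSpace E M] [IsManifold 𝓘(ℝ, E) ∞ M]
    [IsManifold 𝓘(ℝ, E) 1 M]
    {P : SharpField E M} {V : Π ξ : Cotangent E M, TangentSpace (cotangentModel E) ξ}
    {φ : ℝ → Cotangent E M → Cotangent E M} {c : Cotangent E M}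

lemma IsPoissonSpray.isIntegralCurve_const (hV : IsPoissonSpray P V) (hc : c ∈ cotangentZero E M)
    (s : Set ℝ) (t : ℝ) :
    HasMFDerivWithinAt 𝓘(ℝ, ℝ) (cotangentModel E) (fun _ : ℝ ↦ c) s t
      ((1 : ℝ →L[ℝ] ℝ).smulRight (V c)) := by
  rw [hV.eq_zero hc]
  refine (hasMFDerivWithinAt_const c s t).congr_mfderiv ?_
  ext
  exact (smul_zero (1 : ℝ)).symm

/-- The flow of a spray fixes the zero section. -/
lemma IsPoissonSpray.flow_zero (hV : IsPoissonSpray P V) (hc : c ∈ cotangentZero E M)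
    {U : Set (Cotangent E M)} (hφ : IsFlowOn (cotangentModel E) (fun _ ↦ V) univ φ U) (hcU : c ∈ U)
    {s : ℝ} (hs : s ∈ Icc (0 : ℝ) 1) : φ s c = c :=
  eqOn_integralCurves (X := fun _ ↦ V) (a := 0) (b := 1) (s := 0)
    (γ₁ := fun t ↦ φ t c) (γ₂ := fun _ ↦ c) isOpen_univ
    (contMDiffOn_timeField (contMDiffOn_univ.2 hV.smooth))
    (fun t ht ↦ ⟨mem_univ _, hφ.deriv c hcU t ht⟩)
    (fun t _ ↦ ⟨mem_univ _, hV.isIntegralCurve_const hc _ t⟩) (by simp) (hφ.initial c hcU) hs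

/-- A potential exists near every point of the domain of the flow. -/
theorem IsPoissonSpray.exists_isPotential (hV : IsPoissonSpray P V)
    {U : Set (Cotangent E M)} (hU : IsOpen U)
    (hφ : IsFlowOn (cotangentModel E) (fun _ ↦ V) univ φ U) (hcU : c ∈ U) :
    ∃ δ O' Θ, IsPotential φ c δ O' Θ ∧ extChartAt (cotangentModel E) c c ∈ O' ∧
      (extChartAt (cotangentModel E) c).symm '' O' ⊆ U := by
  obtain ⟨δ, hδ, O, hOU, hcO, ψ, h, hψ⟩ :=
    hφ.exists_isSmoothFlow isOpen_univ (contMDiffOn_univ.2 hV.smooth) hU hcU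
  refine ⟨δ, _, _, h.isPotential hδ hψ c, ⟨mem_extChartAt_target c, ?_⟩, ?_⟩
  · rw [mem_preimage, (extChartAt (cotangentModel E) c).left_inv (mem_extChartAt_source c)]
    exact hcO
  · rintro _ ⟨z, hz, rfl⟩
    exact hOU hz.2

/-- Points of the zero section are rest points of `V`, so nearby integral curves live on `[0, 1]`;
non-degeneracy on the zero section spreads to a neighbourhood, uniformly in `ε`. -/
theorem IsPoissonSpray.exists_isSprayDomain [FiniteDimensional ℝ E] (hV : IsPoissonSpray P V) :
    ∃ (φ : ℝ → Cotangent E M → Cotangent E M) (U : Set (Cotangent E M)), IsSprayDomain V φ U := by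
  classical
  have hVs := contMDiffOn_univ.2 hV.smooth
  set good : Cotangent E M → (ℝ → Cotangent E M) → Prop := fun ξ γ ↦ γ 0 = ξ ∧
    ∀ t ∈ Icc (0 : ℝ) 1, HasMFDerivWithinAt 𝓘(ℝ, ℝ) (cotangentModel E) γ (Icc 0 1) t
      ((1 : ℝ →L[ℝ] ℝ).smulRight (V (γ t))) with hgood
  set φ : ℝ → Cotangent E M → Cotangent E M :=
    fun s ξ ↦ if h : ∃ γ, good ξ γ then h.choose s else ξ with hφdef
  have hφgood : ∀ ξ, (∃ γ, good ξ γ) → good ξ (fun s ↦ φ s ξ) := by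
    intro ξ h
    have : (fun s ↦ φ s ξ) = h.choose := by
      funext s
      simp only [hφdef, dif_pos h]
    rw [this]
    exact h.choose_spec
  set U₀ := interior {ξ | ∃ γ, good ξ γ} with hU₀
  have hU₀o : IsOpen U₀ := isOpen_interior
  have hflow : IsFlowOn (cotangentModel E) (fun _ ↦ V) univ φ U₀ :=
    ⟨fun ξ hξ ↦ (hφgood ξ (interior_subset (s := {ξ | ∃ γ, good ξ γ}) hξ)).1, fun _ _ _ _ ↦ mem_univ _,
      fun ξ hξ ↦ (hφgood ξ (interior_subset (s := {ξ | ∃ γ, good ξ γ}) hξ)).2⟩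
  have hzero : cotangentZero E M ⊆ U₀ := by
    intro c hc
    obtain ⟨δ, hδ, O, hO, ψ, h⟩ := exists_isSmoothFlow (γ := fun _ ↦ c) isOpen_univ hVs
      fun t _ ↦ ⟨mem_univ _, hV.isIntegralCurve_const hc _ t⟩
    have hsub : O ⊆ {ξ | ∃ γ, good ξ γ} := by
      refine fun ξ hξ ↦ ⟨fun s ↦ ψ s ξ, h.initial ξ hξ, fun t ht ↦ ?_⟩
      exact (h.deriv ξ hξ t ⟨by linarith [ht.1], by linarith [ht.2]⟩).hasMFDerivWithinAt
    exact interior_maximal hsub h.isOpen hO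
  set U := interior {ξ ∈ U₀ | ∀ ε ∈ Icc (0 : ℝ) 1, ∀ v : TangentSpace (cotangentModel E) ξ,
    (∀ w : TangentSpace (cotangentModel E) ξ, omegaForm φ ε ξ ![v, w] = 0) → v = 0} with hU
  refine ⟨φ, U, isOpen_interior, fun c hc ↦ ?_, ?_, fun ε hε ξ hξ ↦ (interior_subset hξ).2 ε hε⟩
  · obtain ⟨δ, hδ, O, hOU, hcO, ψ, h, hψ⟩ := hflow.exists_isSmoothFlow isOpen_univ hVs hU₀o (hzero hc)
    have hpot := h.isPotential hδ hψ c
    set κ := extChartAt (cotangentModel E) c with hκ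
    set O' : Set (E × (E →L[ℝ] ℝ)) := κ.target ∩ κ.symm ⁻¹' O with hO'
    set Θ := averagedDensity ψ c
    have hcs := mem_chart_source (ModelProd E (E →L[ℝ] ℝ)) c
    have hl : κ.symm (κ c) = c := κ.left_inv (mem_extChartAt_source c)
    have hcO' : κ c ∈ O' := ⟨mem_extChartAt_target c, by rw [mem_preimage, hl]; exact hcO⟩
    set S : Set (ℝ × (E × (E →L[ℝ] ℝ))) := (Ioo (-δ) (1 + δ) ×ˢ O') ∩
      spatialExtDeriv Θ ⁻¹' (range ((↑) : ((E × (E →L[ℝ] ℝ)) ≃L[ℝ] ((E × (E →L[ℝ] ℝ)) →L[ℝ] ℝ)) →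
        ((E × (E →L[ℝ] ℝ)) →L[ℝ] ((E × (E →L[ℝ] ℝ)) →L[ℝ] ℝ)))) with hS
    have hSo : IsOpen S :=
      (hpot.smooth.spatialExtDeriv (isOpen_Ioo.prod hpot.isOpen)).continuousOn.isOpen_inter_preimage
        (isOpen_Ioo.prod hpot.isOpen) ContinuousLinearEquiv.isOpen
    -- A tube argument: as `[0, 1]` is compact, the points whose entire time slice lies in `S` form
    -- an open set.
    have hO'' := isOpen_slice_subset hSo
    refine interior_maximal (t := κ.source ∩ κ ⁻¹' {z | ∀ s ∈ Icc (0 : ℝ) 1, (s, z) ∈ S}) ?_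
      ((continuousOn_extChartAt c).isOpen_inter_preimage (isOpen_extChartAt_source c) hO'')
      ⟨mem_extChartAt_source c, ?_⟩
    · rintro ξ ⟨hξ, hξS⟩
      have hξ' := hξ
      rw [hκ, extChartAt_source] at hξ'
      refine ⟨?_, fun ε hε ↦ ?_⟩
      · have := (hξS 0 (by simp)).1.2.2
        rw [mem_preimage, κ.left_inv hξ] at this
        exact hOU this
      · rw [hpot.nondegenerate_iff hε hξ' (hξS ε hε).1.2]
        obtain ⟨B, hB⟩ := (hξS ε hε).2
        rw [← hκ, ← hB]
        exact B.injective
    · intro ε hε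
      refine ⟨⟨⟨by linarith [hε.1], by linarith [hε.2]⟩, hcO'⟩, ?_⟩
      have hfix : ∀ s ∈ Icc (0 : ℝ) 1, ψ s c = c := fun s hs ↦
        (hψ c hcO s hs).trans (hV.flow_zero hc hflow (hzero hc) hs)
      exact ContinuousLinearMap.isInvertible_of_injective_dual
        ((hpot.nondegenerate_iff hε hcs hcO').1
          fun u hu ↦ hV.nondegenerate_zero hδ h hψ hcO hc hfix hε hu)
  · exact ⟨fun ξ hξ ↦ hflow.initial ξ (interior_subset hξ).1, fun _ _ _ _ ↦ mem_univ _,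
      fun ξ hξ ↦ hflow.deriv ξ (interior_subset hξ).1⟩

end Existence

/-! ### Jacobi's identity in charts. -/

section PoissonInCharts

variable {E : Type*} [NormedAddCommGroup E] [NormedSpace ℝ E]
    {M : Type*} [TopologicalSpace M] [ChartedSpace E M] [IsManifold 𝓘(ℝ, E) ∞ M]
    [IsManifold 𝓘(ℝ, E) 1 M]
    {P : SharpField E M} {V : Π ξ : Cotangent E M, TangentSpace (cotangentModel E) ξ}

lemma IsPoisson.sharpInChart_skew (hP : IsPoisson P) (b : M) (x : E) (α β : E →L[ℝ] ℝ) :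
    β (sharpInChart P b x α) = -α (sharpInChart P b x β) :=
  hP.skew _ (α ∘L chartDeriv 𝓘(ℝ, E) b ((extChartAt 𝓘(ℝ, E) b).symm x))
    (β ∘L chartDeriv 𝓘(ℝ, E) b ((extChartAt 𝓘(ℝ, E) b).symm x))

/-- The base component of the spray in a chart is `(x, p) ↦ S(x) p`. Finite dimension upgrades
smoothness for each `p` to smoothness of the operator-valued map. -/
lemma IsPoissonSpray.contDiffOn_sharpInChart [FiniteDimensional ℝ E] (hV : IsPoissonSpray P V)
    (b : M) : ContDiffOn ℝ ∞ (sharpInChart P b) (extChartAt 𝓘(ℝ, E) b).target := by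
  rw [contDiffOn_clm_apply]
  intro p
  set c : Cotangent E M := ⟨b, 0⟩
  have hm : ∀ x ∈ (extChartAt 𝓘(ℝ, E) b).target,
      ((x, p) : E × (E →L[ℝ] ℝ)) ∈ (extChartAt (cotangentModel E) c).target := by
    intro x hx
    rw [cotangent_extChartAt_target]
    exact ⟨hx, mem_univ _⟩
  have h1 : ContDiffOn ℝ ∞ (fun x ↦ (fieldInChart (cotangentModel E) V c (x, p)).1)
      (extChartAt 𝓘(ℝ, E) b).target :=
    contDiff_fst.comp_contDiffOn ((hV.contDiffOn_fieldInChart c).comp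
      (contDiffOn_id.prodMk contDiffOn_const) hm)
  exact h1.congr fun x hx ↦ (hV.fieldInChart_fst (hm x hx)).symm

lemma mvfderiv_comp_extChartAt {b y : M} (hy : y ∈ (chartAt E b).source) {G : E → ℝ}
    (hG : DifferentiableAt ℝ G (extChartAt 𝓘(ℝ, E) b y)) {f : M → ℝ}
    (hf : f =ᶠ[𝓝 y] fun x ↦ G (extChartAt 𝓘(ℝ, E) b x)) (v : TangentSpace 𝓘(ℝ, E) y) :
    mvfderiv 𝓘(ℝ, E) f y v =
      fderiv ℝ G (extChartAt 𝓘(ℝ, E) b y) (chartDeriv 𝓘(ℝ, E) b y v) := by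
  have h1 : HasMFDerivAt 𝓘(ℝ, E) 𝓘(ℝ, ℝ) (fun x ↦ G (extChartAt 𝓘(ℝ, E) b x)) y _ :=
    hG.hasFDerivAt.hasMFDerivAt.comp y (hasMFDerivAt_chartDeriv (I := 𝓘(ℝ, E)) hy)
  have h2 := (h1.congr_of_eventuallyEq hf).mfderiv
  exact congr($h2 v)

/-- Jacobi's identity is assumed for functions on all of `M`; bump functions make it applicable to
coordinate functions. -/
lemma exists_contMDiff_eventuallyEq_chart [FiniteDimensional ℝ E] [T2Space M] {b y : M}
    (hy : y ∈ (chartAt E b).source) (α : E →L[ℝ] ℝ) :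
    ∃ f : M → ℝ, ContMDiff 𝓘(ℝ, E) 𝓘(ℝ, ℝ) ∞ f ∧
      f =ᶠ[𝓝 y] fun x ↦ α (extChartAt 𝓘(ℝ, E) b x) := by
  obtain ⟨χ, -, hχ⟩ := (SmoothBumpFunction.nhds_basis_tsupport (I := 𝓘(ℝ, E)) y).mem_iff.1
    ((chartAt E b).open_source.mem_nhds hy)
  refine ⟨fun x ↦ χ x • α (extChartAt 𝓘(ℝ, E) b x), contMDiff_of_tsupport fun x hx ↦ ?_, ?_⟩
  · have hx' := hχ (closure_mono (Function.support_smul_subset_left _ _) hx)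
    refine (χ.contMDiff x).smul ?_
    exact ContMDiffAt.comp (I' := 𝓘(ℝ, E)) x (contMDiffAt_iff_contDiffAt.2 α.contDiff.contDiffAt)
      (contMDiffAt_extChartAt' hx')
  · filter_upwards [χ.eventuallyEq_one] with x hx
    rw [hx, Pi.one_apply, one_smul]

/-- Jacobi's identity in a chart. -/
theorem IsPoisson.jacobi_chart [FiniteDimensional ℝ E] [T2Space M] (hP : IsPoisson P)
    {b : M} (hs : ContDiffOn ℝ ∞ (sharpInChart P b) (extChartAt 𝓘(ℝ, E) b).target) {x : E}
    (hx : x ∈ (extChartAt 𝓘(ℝ, E) b).target) (p β γ : E →L[ℝ] ℝ) :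
    γ (fderiv ℝ (sharpInChart P b) x (sharpInChart P b x p) β) +
      p (fderiv ℝ (sharpInChart P b) x (sharpInChart P b x β) γ) +
      β (fderiv ℝ (sharpInChart P b) x (sharpInChart P b x γ) p) = 0 := by
  set κ := extChartAt 𝓘(ℝ, E) b with hκ
  set y := κ.symm x with hy
  have hxy : κ y = x := κ.right_inv hx
  have hys : y ∈ (chartAt E b).source := by
    rw [← extChartAt_source 𝓘(ℝ, E)]; exact κ.map_target hx
  have hd : ∀ α β : E →L[ℝ] ℝ, HasFDerivAt (fun x ↦ β (sharpInChart P b x α))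
      (β ∘L (fderiv ℝ (sharpInChart P b) x).flip α) x := by
    intro α β
    have h1 : HasFDerivAt (sharpInChart P b) (fderiv ℝ (sharpInChart P b) x) x :=
      ((hs.contDiffAt ((isOpen_extChartAt_target b).mem_nhds hx)).differentiableAt
        (by simp)).hasFDerivAt
    exact (β.hasFDerivAt.comp x (h1.clm_apply (hasFDerivAt_const α x))).congr_fderiv
      (by ext; simp)
  obtain ⟨f, hf, hf'⟩ := exists_contMDiff_eventuallyEq_chart hys p
  obtain ⟨g, hg, hg'⟩ := exists_contMDiff_eventuallyEq_chart hys β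
  obtain ⟨h, hh, hh'⟩ := exists_contMDiff_eventuallyEq_chart hys γ
  have hdf : ∀ {f : M → ℝ} {α : E →L[ℝ] ℝ} {y : M}, y ∈ (chartAt E b).source →
      f =ᶠ[𝓝 y] (fun x ↦ α (κ x)) →
      mvfderiv 𝓘(ℝ, E) f y = α ∘L chartDeriv 𝓘(ℝ, E) b y := by
    intro f α y hy hf
    ext v
    rw [mvfderiv_comp_extChartAt hy α.differentiableAt hf, ContinuousLinearMap.fderiv]
    rfl
  have hbr : ∀ {f g : M → ℝ} {α β : E →L[ℝ] ℝ} {y : M}, y ∈ (chartAt E b).source →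
      f =ᶠ[𝓝 y] (fun x ↦ α (κ x)) → g =ᶠ[𝓝 y] (fun x ↦ β (κ x)) →
      poissonBracket P f g y = β (sharpInChart P b (κ y) α) := by
    intro f g α β y hy hf hg
    rw [poissonBracket, hdf hy hf, hdf hy hg, sharpInChart_apply hy]
    rfl
  have hbr' : ∀ {f g h : M → ℝ} {α β γ : E →L[ℝ] ℝ},
      f =ᶠ[𝓝 y] (fun x ↦ α (κ x)) → g =ᶠ[𝓝 y] (fun x ↦ β (κ x)) → h =ᶠ[𝓝 y] (fun x ↦ γ (κ x)) →
      poissonBracket P f (poissonBracket P g h) y =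
        γ (fderiv ℝ (sharpInChart P b) x (sharpInChart P b x α) β) := by
    intro f g h α β γ hf hg hh
    have h1 : poissonBracket P g h =ᶠ[𝓝 y] fun x ↦ γ (sharpInChart P b (κ x) β) := by
      filter_upwards [hg.eventuallyEq_nhds, hh.eventuallyEq_nhds,
        (chartAt E b).open_source.mem_nhds hys] with y' h1 h2 h3
      exact hbr h3 h1 h2
    have h2 := hd β γ
    rw [← hxy] at h2
    rw [poissonBracket, mvfderiv_comp_extChartAt hys h2.differentiableAt h1, h2.fderiv,
      hdf hys hf, ← sharpInChart_apply hys, ← hκ, hxy]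
    rfl
  have := hP.jacobi f g h hf hg hh y
  rwa [hbr' hf' hg' hh', hbr' hg' hh' hf', hbr' hh' hf' hg'] at this

lemma IsPoisson.fderiv_sharpInChart_skew (hP : IsPoisson P)
    {b : M} (hs : ContDiffOn ℝ ∞ (sharpInChart P b) (extChartAt 𝓘(ℝ, E) b).target) {x : E}
    (hx : x ∈ (extChartAt 𝓘(ℝ, E) b).target) (u : E) (α β : E →L[ℝ] ℝ) :
    β (fderiv ℝ (sharpInChart P b) x u α) = -α (fderiv ℝ (sharpInChart P b) x u β) := by
  have hd : ∀ α β : E →L[ℝ] ℝ, HasFDerivAt (fun x ↦ β (sharpInChart P b x α))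
      (β ∘L (fderiv ℝ (sharpInChart P b) x).flip α) x := by
    intro α β
    have h1 : HasFDerivAt (sharpInChart P b) (fderiv ℝ (sharpInChart P b) x) x :=
      ((hs.contDiffAt ((isOpen_extChartAt_target b).mem_nhds hx)).differentiableAt
        (by simp)).hasFDerivAt
    exact (β.hasFDerivAt.comp x (h1.clm_apply (hasFDerivAt_const α x))).congr_fderiv
      (by ext; simp)
  have h1 : (fun x ↦ β (sharpInChart P b x α)) = fun x ↦ -α (sharpInChart P b x β) :=
    funext fun x ↦ hP.sharpInChart_skew b x α β
  have h2 := hd α β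
  rw [h1] at h2
  exact congr($(h2.unique (hd β α).neg) u)

/-- A form of Jacobi's identity in a chart. -/
lemma IsPoisson.jacobi_chart_sharp [FiniteDimensional ℝ E] [T2Space M] (hP : IsPoisson P)
    {b : M} (hs : ContDiffOn ℝ ∞ (sharpInChart P b) (extChartAt 𝓘(ℝ, E) b).target) {x : E}
    (hx : x ∈ (extChartAt 𝓘(ℝ, E) b).target) (p β : E →L[ℝ] ℝ) :
    fderiv ℝ (sharpInChart P b) x (sharpInChart P b x p) β -
      fderiv ℝ (sharpInChart P b) x (sharpInChart P b x β) p =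
      sharpInChart P b x (β ∘L (fderiv ℝ (sharpInChart P b) x).flip p) := by
  rw [← sub_eq_zero]
  by_contra hne
  -- It suffices to pair with covectors `γ`: skew-symmetry of `S` and of its derivative brings `γ`
  -- to the front of every term of the cyclic identity.
  obtain ⟨γ, -, hγ⟩ := exists_dual_vector ℝ _ (norm_ne_zero_iff.2 hne)
  have h1 := hP.jacobi_chart hs hx p β γ
  have h2 := hP.fderiv_sharpInChart_skew hs hx (sharpInChart P b x β) p γ
  have h3 := hP.sharpInChart_skew b x (β ∘L (fderiv ℝ (sharpInChart P b) x).flip p) γ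
  have h4 : γ (fderiv ℝ (sharpInChart P b) x (sharpInChart P b x p) β -
      fderiv ℝ (sharpInChart P b) x (sharpInChart P b x β) p -
      sharpInChart P b x (β ∘L (fderiv ℝ (sharpInChart P b) x).flip p)) = 0 := by
    rw [map_sub, map_sub, h3]
    simp only [ContinuousLinearMap.comp_apply, ContinuousLinearMap.flip_apply]
    linarith
  rw [h4] at hγ
  exact hne (norm_eq_zero.1 (by exact_mod_cast hγ.symm))

end PoissonInCharts

/-! ### Linear differential equations with a prescribed final value. -/

section LinearODE

variable {X : Type*} [NormedAddCommGroup X] [NormedSpace ℝ X]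

/-- Solvability of a linear differential equation on a short interval. -/
lemma exists_linearODE [CompleteSpace X] {L : ℝ → X →L[ℝ] X} {g : ℝ → X} {a b K : ℝ} (hab : a ≤ b)
    (hL : ContinuousOn L (Icc a b)) (hg : ContinuousOn g (Icc a b)) (hK0 : 0 ≤ K)
    (hK : ∀ t ∈ Icc a b, ‖L t‖ ≤ K) (h : (b - a) * K ≤ 1 / 2) (x₀ : X) :
    ∃ α : ℝ → X, α b = x₀ ∧
      ∀ t ∈ Icc a b, HasDerivWithinAt α (L t (α t) + g t) (Icc a b) t := by
  obtain ⟨C, hC⟩ := isCompact_Icc.exists_bound_of_continuousOn hg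
  have hC0 : 0 ≤ C := (norm_nonneg _).trans (hC a ⟨le_rfl, hab⟩)
  set B := K * ‖x₀‖ + C with hB
  have hB0 : 0 ≤ B := by positivity
  have hba : 0 ≤ b - a := sub_nonneg.2 hab
  -- `B` bounds the field at `x₀` and `K R + B` bounds it on the ball of radius `R`. As `(b - a) K ≤
  -- 1/2`, this choice of `R` gives `(K R + B) (b - a) ≤ R`, so solutions do not leave the ball.
  set R := 2 * (b - a) * B with hR
  have hR0 : 0 ≤ R := by positivity
  have hpl : IsPicardLindelof (fun t x ↦ L t x + g t) (⟨b, hab, le_rfl⟩ : Icc a b) x₀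
      ⟨R, hR0⟩ 0 ⟨K * R + B, by positivity⟩ ⟨K, hK0⟩ := by
    refine ⟨fun t ht ↦ ?_, fun x _ ↦ ?_, fun t ht x hx ↦ ?_, ?_⟩
    · refine LipschitzWith.lipschitzOnWith (LipschitzWith.of_dist_le_mul fun x y ↦ ?_)
      rw [dist_add_right, dist_eq_norm, dist_eq_norm, ← map_sub]
      exact (L t).le_of_opNorm_le (hK t ht) _
    · exact (hL.clm_apply continuousOn_const).add hg
    · have hx' : ‖x‖ ≤ ‖x₀‖ + R := by
        have h1 : ‖x - x₀‖ ≤ R := by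
          rw [← dist_eq_norm]
          exact hx
        have h2 := norm_add_le x₀ (x - x₀)
        rw [add_sub_cancel] at h2
        linarith
      calc ‖L t x + g t‖ ≤ K * ‖x‖ + C :=
            (norm_add_le _ _).trans (add_le_add ((L t).le_of_opNorm_le (hK t ht) _) (hC t ht))
        _ ≤ K * (‖x₀‖ + R) + C := by gcongr
        _ = K * R + B := by rw [hB]; ring
    · simp only [sub_self, NNReal.coe_zero, sub_zero, max_eq_right hba]
      change (K * R + B) * (b - a) ≤ R
      have : (b - a) * K * R ≤ 1 / 2 * R := by gcongr
      nlinarith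
  obtain ⟨α, hα, hα'⟩ := hpl.exists_eq_forall_mem_Icc_hasDerivWithinAt₀
  exact ⟨α, hα, hα'⟩

/-- Solutions of homogeneous linear differential equations that vanish at the right end point
vanish. -/
lemma eq_zero_of_linearODE {L : ℝ → X →L[ℝ] X} {y : ℝ → X} {a b K : ℝ}
    (hK : ∀ t ∈ Icc a b, ‖L t‖ ≤ K) (hy : ∀ t ∈ Icc a b, HasDerivWithinAt y (L t (y t)) (Icc a b) t)
    (hb : y b = 0) : ∀ t ∈ Icc a b, y t = 0 := by
  have hmem : ∀ t ∈ Ioc a b, Icc a b ∈ 𝓝[Iic t] t := fun t ht ↦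
    Filter.mem_of_superset (Ioc_mem_nhdsLE ht.1) fun u hu ↦ ⟨hu.1.le, hu.2.trans ht.2⟩
  refine ODE_solution_unique_of_mem_Icc_left (v := fun t x ↦ L t x) (s := fun _ ↦ univ)
    (K := K.toNNReal) (g := fun _ ↦ 0) (fun t ht ↦ ?_) (fun t ht ↦ (hy t ht).continuousWithinAt)
    (fun t ht ↦ (hy t ⟨ht.1.le, ht.2⟩).mono_of_mem_nhdsWithin (hmem t ht)) (fun _ _ ↦ mem_univ _)
    continuousOn_const (fun t _ ↦ ?_) (fun _ _ ↦ mem_univ _) hb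
  · refine LipschitzWith.lipschitzOnWith (LipschitzWith.of_dist_le_mul fun x y ↦ ?_)
    rw [dist_eq_norm, dist_eq_norm, ← map_sub]
    exact (L t).le_of_opNorm_le ((hK t ⟨ht.1.le, ht.2⟩).trans (Real.le_coe_toNNReal K)) _
  · rw [map_zero]
    exact hasDerivWithinAt_const _ _ _

end LinearODE

/-! ### Variations of cotangent paths and their covectors. -/

section Variation

variable {E : Type*} [NormedAddCommGroup E] [NormedSpace ℝ E] [FiniteDimensional ℝ E]
    {M : Type*} [TopologicalSpace M] [T2Space M] [ChartedSpace E M] [IsManifold 𝓘(ℝ, E) ∞ M]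
    [IsManifold 𝓘(ℝ, E) 1 M]
    {P : SharpField E M} {V : Π ξ : Cotangent E M, TangentSpace (cotangentModel E) ξ}

lemma fst_mem_target {c : Cotangent E M} {z : E × (E →L[ℝ] ℝ)}
    (hz : z ∈ (extChartAt (cotangentModel E) c).target) :
    z.1 ∈ (extChartAt 𝓘(ℝ, E) c.proj).target := by
  rw [cotangent_extChartAt_target] at hz
  exact hz.1

lemma IsPoissonSpray.hasFDerivAt_sharpInChart (hV : IsPoissonSpray P V) {b : M} {x : E}
    (hx : x ∈ (extChartAt 𝓘(ℝ, E) b).target) :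
    HasFDerivAt (sharpInChart P b) (fderiv ℝ (sharpInChart P b) x) x :=
  (((hV.contDiffOn_sharpInChart b).contDiffAt
    ((isOpen_extChartAt_target b).mem_nhds hx)).differentiableAt (by simp)).hasFDerivAt

lemma IsPoissonSpray.fderiv_fieldInChart_fst (hV : IsPoissonSpray P V) {c : Cotangent E M}
    {z : E × (E →L[ℝ] ℝ)} (hz : z ∈ (extChartAt (cotangentModel E) c).target)
    (u : E × (E →L[ℝ] ℝ)) :
    (fderiv ℝ (fieldInChart (cotangentModel E) V c) z u).1 =
      fderiv ℝ (sharpInChart P c.proj) z.1 u.1 z.2 + sharpInChart P c.proj z.1 u.2 := by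
  have h1 := ((hV.contDiffAt_fieldInChart hz).differentiableAt (by simp)).hasFDerivAt
  have h2 : HasFDerivAt (fun z ↦ (fieldInChart (cotangentModel E) V c z).1) _ z := h1.fst
  have h3 : HasFDerivAt (fun z : E × (E →L[ℝ] ℝ) ↦ sharpInChart P c.proj z.1 z.2) _ z :=
    ((hV.hasFDerivAt_sharpInChart (fst_mem_target hz)).comp z
      (hasFDerivAt_fst (𝕜 := ℝ) (p := z))).clm_apply (hasFDerivAt_snd (𝕜 := ℝ) (p := z))
  have h4 : (fun z ↦ (fieldInChart (cotangentModel E) V c z).1) =ᶠ[𝓝 z]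
      fun z : E × (E →L[ℝ] ℝ) ↦ sharpInChart P c.proj z.1 z.2 := by
    filter_upwards [(isOpen_extChartAt_target c).mem_nhds hz] with z hz
    exact hV.fieldInChart_fst hz
  have h5 := congr($(h2.unique (h3.congr_of_eventuallyEq h4)) u)
  refine Eq.trans h5 ?_
  simp [add_comm]

/-- The covectors that represent a variation of a cotangent path. -/
theorem IsPoissonSpray.exists_covector_chart (hP : IsPoisson P) (hV : IsPoissonSpray P V)
    {c : Cotangent E M} {z : ℝ → E × (E →L[ℝ] ℝ)} {a b K : ℝ} (hab : a ≤ b)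
    (hz : ∀ s ∈ Icc a b, z s ∈ (extChartAt (cotangentModel E) c).target)
    (hz' : ∀ s ∈ Icc a b, HasDerivAt z (fieldInChart (cotangentModel E) V c (z s)) s)
    (hK : ∀ s ∈ Icc a b, ‖(fderiv ℝ (sharpInChart P c.proj) (z s).1).flip (z s).2‖ ≤ K)
    (h : (b - a) * K ≤ 1 / 2) {w : ℝ → E × (E →L[ℝ] ℝ)}
    (hw : ∀ s ∈ Icc a b, HasDerivAt w
      (fderiv ℝ (fieldInChart (cotangentModel E) V c) (z s) (w s)) s)
    {βb : E →L[ℝ] ℝ} (hβb : sharpInChart P c.proj (z b).1 βb = (w b).1) :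
    ∃ βa : E →L[ℝ] ℝ, sharpInChart P c.proj (z a).1 βa = (w a).1 ∧
      ∀ v : ℝ → E × (E →L[ℝ] ℝ), (∀ s ∈ Icc a b, HasDerivAt v
        (fderiv ℝ (fieldInChart (cotangentModel E) V c) (z s) (v s)) s) →
        βb (v b).1 - βa (v a).1 = ∫ s in a..b, modelSymplectic E (w s) (v s) := by
  set S := sharpInChart P c.proj with hS
  have hs := hV.contDiffOn_sharpInChart c.proj
  set A : ℝ → E →L[ℝ] E := fun s ↦ (fderiv ℝ S (z s).1).flip (z s).2 with hA
  set L : ℝ → (E →L[ℝ] ℝ) →L[ℝ] (E →L[ℝ] ℝ) :=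
    fun s ↦ -((ContinuousLinearMap.compL ℝ E E ℝ).flip (A s)) with hL
  have hzc : ContinuousOn z (Icc a b) := fun s hs ↦ (hz' s hs).continuousAt.continuousWithinAt
  have hwc : ContinuousOn w (Icc a b) := fun s hs ↦ (hw s hs).continuousAt.continuousWithinAt
  have hAc : ContinuousOn A (Icc a b) := by
    have h1 : ContinuousOn (fun s ↦ fderiv ℝ S (z s).1) (Icc a b) :=
      (hs.continuousOn_fderiv_of_isOpen (isOpen_extChartAt_target c.proj) (by simp)).comp
        (continuous_fst.comp_continuousOn hzc) fun s hs ↦ fst_mem_target (hz s hs)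
    exact ((ContinuousLinearMap.flipₗᵢ ℝ E (E →L[ℝ] ℝ) E).continuous.comp_continuousOn
      h1).clm_apply (continuous_snd.comp_continuousOn hzc)
  have hLc : ContinuousOn L (Icc a b) :=
    ((ContinuousLinearMap.compL ℝ E E ℝ).flip.continuous.comp_continuousOn hAc).neg
  have hLK : ∀ s ∈ Icc a b, ‖L s‖ ≤ K := by
    intro s hs
    rw [hL, norm_neg]
    refine ContinuousLinearMap.opNorm_le_bound _ ((norm_nonneg _).trans (hK s hs)) fun β ↦ ?_
    calc ‖β ∘L A s‖ ≤ ‖β‖ * ‖A s‖ := β.opNorm_comp_le _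
      _ ≤ ‖β‖ * K := by gcongr; exact hK s hs
      _ = K * ‖β‖ := mul_comm _ _
  -- The equation is `β' = -β ∘ A + w₂` with final value `βb`. It is designed so that `d/ds β(v₁)`
  -- becomes `dp ∧ dx (w, v)` as long as `S β = w₁`.
  obtain ⟨β, hβ, hβ'⟩ := exists_linearODE hab hLc (continuous_snd.comp_continuousOn hwc)
    ((norm_nonneg _).trans (hK a ⟨le_rfl, hab⟩)) hLK h βb
  have hv1 : ∀ v : ℝ → E × (E →L[ℝ] ℝ), (∀ s ∈ Icc a b, HasDerivAt v
      (fderiv ℝ (fieldInChart (cotangentModel E) V c) (z s) (v s)) s) → ∀ s ∈ Icc a b,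
      HasDerivAt (fun s ↦ (v s).1) (A s (v s).1 + S (z s).1 (v s).2) s := by
    intro v hv s hs
    have h1 := (hasFDerivAt_fst (𝕜 := ℝ)).comp_hasDerivAt s (hv s hs)
    have h2 := hV.fderiv_fieldInChart_fst (hz s hs) (v s)
    exact h1.congr_deriv h2
  have hx : ∀ s ∈ Icc a b, HasDerivAt (fun s ↦ (z s).1) (S (z s).1 (z s).2) s := by
    intro s hs
    have h1 := (hasFDerivAt_fst (𝕜 := ℝ)).comp_hasDerivAt s (hz' s hs)
    exact h1.congr_deriv (hV.fieldInChart_fst (hz s hs))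
  -- By Jacobi's identity the defect `y = S β - w₁` solves the homogeneous equation `y' = A y`; it
  -- is zero at `b`, hence everywhere.
  have hy : ∀ s ∈ Icc a b, S (z s).1 (β s) - (w s).1 = 0 := by
    refine eq_zero_of_linearODE (L := A) hK (fun s hs' ↦ ?_) (by rw [hβ, hβb, sub_self])
    have hzs := fst_mem_target (hz s hs')
    have h1 := ((hV.hasFDerivAt_sharpInChart hzs).comp_hasDerivAt s (hx s hs')).hasDerivWithinAt
      (s := Icc a b)
    have h2 := (h1.clm_apply (hβ' s hs')).sub (hv1 w hw s hs').hasDerivWithinAt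
    refine h2.congr_deriv ?_
    have h3 := hP.jacobi_chart_sharp hs hzs (z s).2 (β s)
    have h4 : (L s (β s)) = -(β s ∘L (fderiv ℝ S (z s).1).flip (z s).2) := rfl
    rw [← hS] at h3
    simp only [Function.comp_apply, h4, map_add, map_neg, ← hS]
    rw [← h3]
    simp only [hA, ContinuousLinearMap.flip_apply, map_sub]
    abel
  refine ⟨β a, sub_eq_zero.1 (hy a ⟨le_rfl, hab⟩), fun v hv ↦ ?_⟩
  have hvc : ContinuousOn v (Icc a b) := fun s hs ↦ (hv s hs).continuousAt.continuousWithinAt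
  -- The terms containing `A` cancel, and skew-symmetry together with `S β = w₁` gives `β(S v₂) =
  -- -v₂(w₁)`.
  have hd : ∀ s ∈ Icc a b, HasDerivWithinAt (fun s ↦ β s (v s).1)
      (modelSymplectic E (w s) (v s)) (Icc a b) s := by
    intro s hs'
    refine ((hβ' s hs').clm_apply (hv1 v hv s hs').hasDerivWithinAt).congr_deriv ?_
    have h1 := hP.sharpInChart_skew c.proj (z s).1 (v s).2 (β s)
    rw [← hS, sub_eq_zero.1 (hy s hs')] at h1
    have h4 : (L s (β s)) (v s).1 = -(β s (A s (v s).1)) := rfl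
    rw [add_apply, map_add, h1, h4, modelSymplectic_apply, Function.comp_apply]
    ring
  have hint : IntervalIntegrable (fun s ↦ modelSymplectic E (w s) (v s)) MeasureTheory.volume a b :=
    ContinuousOn.intervalIntegrable_of_Icc hab
      (((modelSymplectic E).continuous.comp_continuousOn hwc).clm_apply hvc)
  rw [intervalIntegral.integral_eq_sub_of_hasDerivAt_of_le hab
    (fun s hs ↦ (hd s hs).continuousWithinAt)
    (fun s hs ↦ (hd s ⟨hs.1.le, hs.2.le⟩).hasDerivAt (Icc_mem_nhds hs.1 hs.2)) hint, hβ]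

end Variation

/-! ### Covectors along a whole integral curve of the spray. -/

section PoissonMap

variable {E : Type*} [NormedAddCommGroup E] [NormedSpace ℝ E] [FiniteDimensional ℝ E]
    {M : Type*} [TopologicalSpace M] [T2Space M] [ChartedSpace E M] [IsManifold 𝓘(ℝ, E) ∞ M]
    [IsManifold 𝓘(ℝ, E) 1 M]
    {P : SharpField E M} {V : Π ξ : Cotangent E M, TangentSpace (cotangentModel E) ξ}
    {φ ψ : ℝ → Cotangent E M → Cotangent E M} {J : Set ℝ} {O : Set (Cotangent E M)}
    {ξ : Cotangent E M}

/-- The derivative of `q ∘ ψ s` at `ξ`. -/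
def baseDeriv (ψ : ℝ → Cotangent E M → Cotangent E M) (ξ : Cotangent E M) (s : ℝ) :
    TangentSpace (cotangentModel E) ξ →L[ℝ] TangentSpace 𝓘(ℝ, E) (ψ s ξ).proj :=
  mfderiv (cotangentModel E) 𝓘(ℝ, E) (cotangentProj E M) (ψ s ξ) ∘L
    mfderiv (cotangentModel E) (cotangentModel E) (ψ s) ξ

lemma exists_comp_chartDeriv {b y : M} (hy : y ∈ (chartAt E b).source)
    (β : TangentSpace 𝓘(ℝ, E) y →L[ℝ] ℝ) :
    ∃ β' : E →L[ℝ] ℝ, β' ∘L chartDeriv 𝓘(ℝ, E) b y = β := by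
  obtain ⟨e, he⟩ : (chartDeriv 𝓘(ℝ, E) b y).IsInvertible :=
    isInvertible_mfderiv_extChartAt (I := 𝓘(ℝ, E)) (by rwa [extChartAt_source])
  refine ⟨β ∘L (e.symm : E →L[ℝ] TangentSpace 𝓘(ℝ, E) y), ?_⟩
  rw [← he]
  ext v
  simp

/-- The relation between the end points of a variation of a cotangent path. -/
def VariationRelation (P : SharpField E M) (ψ : ℝ → Cotangent E M → Cotangent E M)
    (ξ : Cotangent E M) (a b : ℝ) : Prop :=
  ∀ (w : TangentSpace (cotangentModel E) ξ)
    (βb : TangentSpace 𝓘(ℝ, E) (ψ b ξ).proj →L[ℝ] ℝ),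
    P (ψ b ξ).proj βb = baseDeriv ψ ξ b w →
    ∃ βa : TangentSpace 𝓘(ℝ, E) (ψ a ξ).proj →L[ℝ] ℝ,
      P (ψ a ξ).proj βa = baseDeriv ψ ξ a w ∧
      ∀ v : TangentSpace (cotangentModel E) ξ,
        βb (baseDeriv ψ ξ b v) - βa (baseDeriv ψ ξ a v) =
          ∫ s in a..b, formPullback (cotangentModel E) (cotangentModel E) (ψ s)
            (canonicalForm E M) ξ ![w, v]

lemma IsSmoothFlow.continuousOn_formPullback_canonicalForm {Ω : Set (Cotangent E M)}
    (h : IsSmoothFlow (cotangentModel E) V Ω J O ψ) (hJ : IsOpen J) (hξ : ξ ∈ O)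
    (v : Fin 2 → TangentSpace (cotangentModel E) ξ) :
    ContinuousOn (fun s ↦ formPullback (cotangentModel E) (cotangentModel E) (ψ s)
      (canonicalForm E M) ξ v) J :=
  (ContinuousAlternatingMap.apply ℝ (E × (E →L[ℝ] ℝ)) ℝ
    (fun i ↦ (tangentIdent (cotangentModel E) ξ).symm (v i))).continuous.comp_continuousOn
    (h.continuousOn_formPullback hJ differentiableOn_formInChart_canonicalForm hξ)

/-- In the chart at `ψ s₀ ξ` the images of tangent vectors under the flow solve the variational
equation, so `IsPoissonSpray.exists_covector_chart` applies for times close to `s₀`. -/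
lemma IsPoissonSpray.variationRelation_local (hP : IsPoisson P) (hV : IsPoissonSpray P V)
    (h : IsSmoothFlow (cotangentModel E) V univ J O ψ) (hJ : IsOpen J) (hξ : ξ ∈ O)
    {s₀ : ℝ} (hs₀ : s₀ ∈ J) :
    ∃ δ > 0, ∀ a b : ℝ, |a - s₀| < δ → |b - s₀| < δ → a ≤ b → VariationRelation P ψ ξ a b := by
  set c' := ψ s₀ ξ with hc'
  set κ := extChartAt (cotangentModel E) ξ with hκ
  set κ' := extChartAt (cotangentModel E) c' with hκ'
  set f := flowInChart (cotangentModel E) ψ ξ c' with hf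
  have hl : κ.symm (κ ξ) = ξ := κ.left_inv (mem_extChartAt_source ξ)
  have hc's := mem_chart_source (ModelProd E (E →L[ℝ] ℝ)) c'
  have hξs := mem_chart_source (ModelProd E (E →L[ℝ] ℝ)) ξ
  have hcont : ContinuousAt (fun t : ℝ ↦ (t, κ ξ)) s₀ := by fun_prop
  have hev := hcont.eventually (h.eventually_flowInChart hJ hs₀ (mem_extChartAt_target ξ)
    (c' := c') (by rwa [← hκ, hl]) (by rwa [← hκ, hl]))
  set z : ℝ → E × (E →L[ℝ] ℝ) := fun s ↦ f (s, κ ξ) with hz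
  have hzκ : ∀ s, z s = κ' (ψ s ξ) := by
    intro s
    simp only [hz, hf, flowInChart, ← hκ, hl]
    rfl
  have hzt : ∀ s, ψ s ξ ∈ (chartAt (ModelProd E (E →L[ℝ] ℝ)) c').source → z s ∈ κ'.target := by
    intro s hs
    rw [hzκ]
    exact κ'.map_source (by rwa [hκ', extChartAt_source])
  have hzd : ∀ s ∈ J, ψ s ξ ∈ (chartAt (ModelProd E (E →L[ℝ] ℝ)) c').source →
      HasDerivAt z (fieldInChart (cotangentModel E) V c' (z s)) s := by
    intro s hs hs'
    have h1 := ((h.contDiffAt_flowInChart hJ (c := ξ) (c' := c') hs (mem_extChartAt_target ξ)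
      (by rwa [← hκ, hl]) (by rwa [← hκ, hl])).differentiableAt (by simp)).hasFDerivAt
    have h2 := (h1.comp s (hasFDerivAt_prodMk_left (𝕜 := ℝ) s (κ ξ))).hasDerivAt
    refine h2.congr_deriv ?_
    exact h.fderiv_flowInChart_time hJ (c := ξ) (c' := c') hs
      (mem_extChartAt_target ξ) (by rwa [← hκ, hl]) (by rwa [← hκ, hl])
  set W : TangentSpace (cotangentModel E) ξ → ℝ → E × (E →L[ℝ] ℝ) := fun w s ↦
    fderiv ℝ f (s, κ ξ) (0, chartDeriv (cotangentModel E) ξ ξ w) with hW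
  have hWd : ∀ w, ∀ s ∈ J, ψ s ξ ∈ (chartAt (ModelProd E (E →L[ℝ] ℝ)) c').source →
      HasDerivAt (W w) (fderiv ℝ (fieldInChart (cotangentModel E) V c') (z s) (W w s)) s :=
    fun w s hs hs' ↦ h.hasDerivAt_fderiv_flowInChart hJ isOpen_univ (contMDiffOn_univ.2 hV.smooth)
      hs (mem_extChartAt_target ξ) (by rwa [← hκ, hl]) (by rwa [← hκ, hl]) _
  have hW1 : ∀ w, ∀ s ∈ J, ψ s ξ ∈ (chartAt (ModelProd E (E →L[ℝ] ℝ)) c').source →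
      (W w s).1 = chartDeriv 𝓘(ℝ, E) c'.proj (ψ s ξ).proj (baseDeriv ψ ξ s w) := by
    intro w s hs hs'
    simp only [hW]
    rw [← h.chartDeriv_mfderiv hJ hs hξs hξ hs',
      cotangent_chartDeriv_fst (cotangent_mem_chartSource.1 hs')]
    rfl
  set A : ℝ → E →L[ℝ] E := fun s ↦ (fderiv ℝ (sharpInChart P c'.proj) (z s).1).flip (z s).2 with hA
  have hAc : ContinuousAt A s₀ := by
    have hz0 := (hzd s₀ hs₀ hc's).continuousAt
    have h1 : ContinuousAt (fun s ↦ fderiv ℝ (sharpInChart P c'.proj) (z s).1) s₀ :=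
      ContinuousAt.comp (g := fderiv ℝ (sharpInChart P c'.proj)) (f := fun s ↦ (z s).1)
        (((hV.contDiffOn_sharpInChart c'.proj).continuousOn_fderiv_of_isOpen
        (isOpen_extChartAt_target c'.proj) (by simp)).continuousAt
          ((isOpen_extChartAt_target c'.proj).mem_nhds (fst_mem_target (hzt s₀ hc's))))
        (continuous_fst.continuousAt.comp hz0)
    exact ((ContinuousLinearMap.flipₗᵢ ℝ E (E →L[ℝ] ℝ) E).continuous.continuousAt.comp
      h1).clm_apply (continuous_snd.continuousAt.comp hz0)
  set K := ‖A s₀‖ + 1 with hK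
  have hK0 : 0 < K := by positivity
  have hAK : ∀ᶠ s in 𝓝 s₀, ‖A s‖ < K :=
    hAc.norm.eventually (gt_mem_nhds (lt_add_one _))
  obtain ⟨δ, hδ, hδ'⟩ := Metric.eventually_nhds_iff.1 (hev.and hAK)
  -- Two times within `1 / (4K)` of `s₀` satisfy `(b - a) K ≤ 1/2`, the condition for solving the
  -- linear equation on `[a, b]`.
  refine ⟨min δ (1 / (4 * K)), by positivity, fun a b ha hb hab w βb hβb ↦ ?_⟩
  rw [lt_min_iff] at ha hb
  have hmem : ∀ s ∈ Icc a b, s ∈ J ∧ ψ s ξ ∈ (chartAt (ModelProd E (E →L[ℝ] ℝ)) c').source ∧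
      ‖A s‖ < K := by
    intro s hs
    have h1 : dist s s₀ < δ := by
      rw [Real.dist_eq, abs_lt]
      exact ⟨by linarith [(abs_lt.1 ha.1).1, hs.1], by linarith [(abs_lt.1 hb.1).2, hs.2]⟩
    have h2 := hδ' h1
    rw [hl] at h2
    exact ⟨h2.1.1, h2.1.2.2.2, h2.2⟩
  have ha' := hmem a ⟨le_rfl, hab⟩
  have hb' := hmem b ⟨hab, le_rfl⟩
  have has := cotangent_mem_chartSource.1 ha'.2.1
  have hbs := cotangent_mem_chartSource.1 hb'.2.1
  have hbK : (b - a) * K ≤ 1 / 2 := by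
    have h1 : b - a ≤ 2 * (1 / (4 * K)) := by
      linarith [(abs_lt.1 ha.2).1, (abs_lt.1 hb.2).2]
    calc (b - a) * K ≤ 2 * (1 / (4 * K)) * K := by gcongr
      _ = 1 / 2 := by field_simp; norm_num
  obtain ⟨βb', rfl⟩ := exists_comp_chartDeriv hbs βb
  have hz1 : ∀ s, (z s).1 = extChartAt 𝓘(ℝ, E) c'.proj (ψ s ξ).proj := by
    intro s
    rw [hzκ, hκ', cotangent_extChartAt_fst]
  obtain ⟨βa', hβa, hβ⟩ := hV.exists_covector_chart hP (c := c') (z := z) (w := W w) (K := K)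
    (βb := βb') hab (fun s hs ↦ hzt s (hmem s hs).2.1)
    (fun s hs ↦ hzd s (hmem s hs).1 (hmem s hs).2.1) (fun s hs ↦ (hmem s hs).2.2.le) hbK
    (fun s hs ↦ hWd w s (hmem s hs).1 (hmem s hs).2.1)
    (by rw [hz1, sharpInChart_apply hbs, hβb, hW1 w b hb'.1 hb'.2.1])
  refine ⟨βa' ∘L chartDeriv 𝓘(ℝ, E) c'.proj (ψ a ξ).proj, ?_, fun v ↦ ?_⟩
  · apply (chartDeriv_bijective (I := 𝓘(ℝ, E)) has).1
    rw [← sharpInChart_apply has, ← hz1, hβa, hW1 w a ha'.1 ha'.2.1]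
  · have h1 := hβ (W v) (fun s hs ↦ hWd v s (hmem s hs).1 (hmem s hs).2.1)
    rw [hW1 v a ha'.1 ha'.2.1, hW1 v b hb'.1 hb'.2.1] at h1
    refine h1.trans ?_
    refine intervalIntegral.integral_congr fun s hs ↦ ?_
    rw [uIcc_of_le hab] at hs
    exact (h.mfderiv_chart_formPullback hJ (hmem s hs).1 hξs hξ (hmem s hs).2.1 w v).symm

/-- The relation is transitive, since the covectors can be passed on from one interval to the next
and the integrals add up; hence the local version suffices. -/
theorem IsPoissonSpray.variationRelation (hP : IsPoisson P) (hV : IsPoissonSpray P V)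
    (h : IsSmoothFlow (cotangentModel E) V univ J O ψ) (hJ : IsOpen J) (hξ : ξ ∈ O)
    (hJ' : Icc 0 1 ⊆ J) {ε : ℝ} (hε : ε ∈ Icc (0 : ℝ) 1) : VariationRelation P ψ ξ 0 ε := by
  refine Icc_chain (a := 0) (b := 1) (R := VariationRelation P ψ ξ) ?_ ?_ ?_ 0 (by simp) ε hε hε.1
  · intro s _ w β hβ
    exact ⟨β, hβ, fun v ↦ by simp⟩
  · intro x hx y hy z hz hxy hyz hR hR' w βz hβz
    obtain ⟨βy, hβy, h1⟩ := hR' w βz hβz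
    obtain ⟨βx, hβx, h2⟩ := hR w βy hβy
    refine ⟨βx, hβx, fun v ↦ ?_⟩
    have hc := h.continuousOn_formPullback_canonicalForm hJ hξ ![w, v]
    rw [← intervalIntegral.integral_add_adjacent_intervals (b := y), ← h1, ← h2]
    · ring
    · exact ContinuousOn.intervalIntegrable_of_Icc hxy
        (hc.mono ((Icc_subset_Icc hx.1 hy.2).trans hJ'))
    · exact ContinuousOn.intervalIntegrable_of_Icc hyz
        (hc.mono ((Icc_subset_Icc hy.1 hz.2).trans hJ'))
  · intro s hs
    obtain ⟨δ, hδ, H⟩ := hV.variationRelation_local hP h hJ hξ (hJ' hs)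
    exact ⟨δ, hδ, fun x _ y _ hx hy hxy ↦ H x y hx hy hxy⟩

end PoissonMap

/-! ### The projection is a Poisson map for `ω_{V,ε}`. -/

section PoissonMap

variable {E : Type*} [NormedAddCommGroup E] [NormedSpace ℝ E] [FiniteDimensional ℝ E]

lemma finrank_continuousDual : Module.finrank ℝ (E →L[ℝ] ℝ) = Module.finrank ℝ E := by
  rw [← (LinearMap.toContinuousLinearMap (𝕜 := ℝ) (E := E) (F' := ℝ)).finrank_eq]
  exact Subspace.dual_finrank_eq (K := ℝ) (V := E)

/-- The linear algebra behind the Poisson property: if `B` is non-degenerate, and `B w` is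
horizontal and dual to `w` for all `w` in the kernel of a map to `E`, then the same is true for all
horizontal covectors. -/
lemma fst_eq_of_ker {B : E × (E →L[ℝ] ℝ) →L[ℝ] (E × (E →L[ℝ] ℝ)) →L[ℝ] ℝ}
    (hB : Function.Injective B) {k : E × (E →L[ℝ] ℝ) →ₗ[ℝ] E} {S : (E →L[ℝ] ℝ) →L[ℝ] E}
    (hk : ∀ u, k u = 0 → ∃ β : E →L[ℝ] ℝ, S β = u.1 ∧ ∀ v, B u v = -β v.1) (β : E →L[ℝ] ℝ) :
    ∃ u, u.1 = S β ∧ ∀ v, B u v = -β v.1 := by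
  obtain ⟨e, he⟩ := ContinuousLinearMap.isInvertible_of_injective_dual hB
  -- `T β` is the unique vector that `B` sends to `-β ∘ fst`.
  set T : (E →L[ℝ] ℝ) →ₗ[ℝ] E × (E →L[ℝ] ℝ) :=
    e.symm.toLinearEquiv.toLinearMap ∘ₗ
      (-((ContinuousLinearMap.compL ℝ (E × (E →L[ℝ] ℝ)) E ℝ).flip
        (ContinuousLinearMap.fst ℝ E (E →L[ℝ] ℝ)))).toLinearMap with hT
  have hBT : ∀ β v, B (T β) v = -β v.1 := by
    intro β v
    have h1 : e (T β) = -(β ∘L ContinuousLinearMap.fst ℝ E (E →L[ℝ] ℝ)) :=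
      e.apply_symm_apply _
    rw [← he]
    exact congr($h1 v)
  have hTB : ∀ u β, (∀ v, B u v = -β v.1) → u = T β := by
    intro u β h
    exact hB (ContinuousLinearMap.ext fun v ↦ (h v).trans (hBT β v).symm)
  have hle : LinearMap.ker k ≤ LinearMap.range T := by
    intro u hu
    obtain ⟨β, -, h⟩ := hk u hu
    exact ⟨β, (hTB u β h).symm⟩
  have hfin : Module.finrank ℝ (LinearMap.range T) ≤ Module.finrank ℝ (LinearMap.ker k) := by
    have h1 := LinearMap.finrank_range_add_finrank_ker k
    have h2 := LinearMap.finrank_range_le T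
    have h3 := Submodule.finrank_le (LinearMap.range k)
    rw [Module.finrank_prod, finrank_continuousDual] at h1
    rw [finrank_continuousDual] at h2
    omega
  have heq := Submodule.eq_of_le_of_finrank_le hle hfin
  have hmem : T β ∈ LinearMap.ker k := heq ▸ LinearMap.mem_range_self T β
  obtain ⟨β', h1, h2⟩ := hk _ hmem
  have h3 : β = β' := by
    ext x
    have := (hBT β (x, 0)).symm.trans (h2 (x, 0))
    simpa using this
  subst h3
  exact ⟨T β, h1.symm, hBT β⟩

variable {M : Type*} [TopologicalSpace M] [T2Space M] [ChartedSpace E M] [IsManifold 𝓘(ℝ, E) ∞ M]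
    [IsManifold 𝓘(ℝ, E) 1 M]
    {P : SharpField E M} {V : Π ξ : Cotangent E M, TangentSpace (cotangentModel E) ξ}
    {φ : ℝ → Cotangent E M → Cotangent E M} {U : Set (Cotangent E M)}
    {ξ : Cotangent E M}

/-- The projection `q : (U, ω_{V,ε}) → (M, -επ)` is a Poisson map. -/
theorem IsSprayDomain.poisson (hP : IsPoisson P) (hV : IsPoissonSpray P V)
    (hU : IsSprayDomain V φ U) (hξ : ξ ∈ U) {ε : ℝ} (hε : ε ∈ Icc (0 : ℝ) 1)
    (α : TangentSpace 𝓘(ℝ, E) ξ.proj →L[ℝ] ℝ) :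
    ∃ Y : TangentSpace (cotangentModel E) ξ,
      (∀ w : TangentSpace (cotangentModel E) ξ, omegaForm φ ε ξ ![Y, w] =
        α (mfderiv (cotangentModel E) 𝓘(ℝ, E) (cotangentProj E M) ξ w)) ∧
      mfderiv (cotangentModel E) 𝓘(ℝ, E) (cotangentProj E M) ξ Y = (-ε) • P ξ.proj α := by
  have := FiniteDimensional.complete ℝ E
  set κ := extChartAt (cotangentModel E) ξ with hκ
  have hb := mem_chart_source E ξ.proj
  have hs := mem_chart_source (ModelProd E (E →L[ℝ] ℝ)) ξ
  have hbij := chartDeriv_bijective (I := cotangentModel E) hs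
  obtain ⟨α', rfl⟩ := exists_comp_chartDeriv hb α
  suffices H : ∃ u : E × (E →L[ℝ] ℝ), u.1 = (-ε) • sharpInChart P ξ.proj (κ ξ).1 α' ∧
      ∀ w v : TangentSpace (cotangentModel E) ξ, chartDeriv (cotangentModel E) ξ ξ w = u →
        omegaForm φ ε ξ ![w, v] = α' (chartDeriv (cotangentModel E) ξ ξ v).1 by
    obtain ⟨u, hu1, hu2⟩ := H
    obtain ⟨Y, rfl⟩ := hbij.2 u
    refine ⟨Y, fun w ↦ ?_, ?_⟩
    · rw [hu2 Y w rfl, cotangent_chartDeriv_fst hb]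
      rfl
    · apply (chartDeriv_bijective (I := 𝓘(ℝ, E)) hb).1
      rw [← cotangent_chartDeriv_fst hb, hu1, map_smul, hκ, cotangent_extChartAt_fst,
        sharpInChart_apply hb]
  obtain ⟨δ, hδ, O, hOU, hξO, ψ, h, hψ⟩ :=
    hU.flow.exists_isSmoothFlow isOpen_univ (contMDiffOn_univ.2 hV.smooth) hU.isOpen hξ
  have hpot := h.isPotential hδ hψ ξ
  have hJ' : Icc 0 1 ⊆ Ioo (-δ) (1 + δ) := fun x hx ↦ ⟨by linarith [hx.1], by linarith [hx.2]⟩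
  have hl : κ.symm (κ ξ) = ξ := κ.left_inv (mem_extChartAt_source ξ)
  have hz : κ ξ ∈ κ.target := mem_extChartAt_target ξ
  have hξO' : κ ξ ∈ κ.target ∩ κ.symm ⁻¹' O := ⟨hz, by rw [mem_preimage, hl]; exact hξO⟩
  -- For `ε = 0` the form `ε B` used below degenerates. There the vertical vector `(0, α')`
  -- represents `α'`, and its projection is zero, as it should be.
  rcases eq_or_lt_of_le hε.1 with rfl | hε0
  · refine ⟨(0, α'), by simp, fun w v hw ↦ ?_⟩
    rw [omegaForm, flowAverage, if_pos rfl, canonicalForm_apply_chart hb]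
    simp only [Matrix.cons_val_zero, Matrix.cons_val_one]
    rw [hw]
    simp
  set B := spatialExtDeriv (averagedDensity ψ ξ) (ε, κ ξ) with hB
  have hBω : ∀ u v : TangentSpace (cotangentModel E) ξ, omegaForm φ ε ξ ![u, v] =
      B (chartDeriv (cotangentModel E) ξ ξ u) (chartDeriv (cotangentModel E) ξ ξ v) :=
    hpot.omega_apply hε hs hξO'
  have hBinj : Function.Injective (ε • B) := by
    have h1 := (hpot.nondegenerate_iff hε hs hξO').1 (hU.nondegenerate ε hε ξ hξ)
    intro u v huv
    exact h1 (smul_right_injective _ hε0.ne' huv)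
  obtain ⟨e, he⟩ : (chartDeriv (cotangentModel E) ξ ξ).IsInvertible :=
    isInvertible_mfderiv_extChartAt (I := cotangentModel E) (mem_extChartAt_source ξ)
  have he' : ∀ u, chartDeriv (cotangentModel E) ξ ξ (e.symm u) = u := fun u ↦ by rw [← he]; simp
  -- `k` is the derivative of `q ∘ ψ ε` at `ξ`, on vectors in chart coordinates.
  set k : E × (E →L[ℝ] ℝ) →ₗ[ℝ] E :=
    (baseDeriv ψ ξ ε ∘L (e.symm : E × (E →L[ℝ] ℝ) →L[ℝ] TangentSpace (cotangentModel E) ξ)).toLinearMap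
    with hk
  have hψ0 : ψ 0 ξ = ξ := h.initial ξ hξO
  have hb0 : (ψ 0 ξ).proj ∈ (chartAt E ξ.proj).source := by rw [hψ0]; exact hb
  have hbase : ∀ v, chartDeriv 𝓘(ℝ, E) ξ.proj (ψ 0 ξ).proj (baseDeriv ψ ξ 0 v) =
      (chartDeriv (cotangentModel E) ξ ξ v).1 := by
    intro v
    have h1 := h.chartDeriv_mfderiv isOpen_Ioo (c := ξ) (c' := ξ) (hJ' (by simp : (0 : ℝ) ∈ Icc 0 1))
      hs hξO (by rwa [hψ0]) v
    rw [h.fderiv_flowInChart_zero isOpen_Ioo (hJ' (by simp)) hz hξO'.2] at h1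
    rw [← h1, cotangent_chartDeriv_fst hb0]
    rfl
  -- On the kernel the final covector can be chosen to be `0`. The variation relation then produces
  -- an initial covector, and its integral over `[0, ε]` is `ε` times the averaged form.
  have hker : ∀ u, k u = 0 → ∃ β : E →L[ℝ] ℝ, sharpInChart P ξ.proj (κ ξ).1 β = u.1 ∧
      ∀ v, (ε • B) u v = -β v.1 := by
    intro u hu
    have hw : baseDeriv ψ ξ ε (e.symm u) = 0 := hu
    obtain ⟨β, hβ, hβ'⟩ := hV.variationRelation hP h isOpen_Ioo hξO hJ' hε (e.symm u) 0
      (by rw [map_zero, hw])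
    obtain ⟨β', rfl⟩ := exists_comp_chartDeriv hb0 β
    refine ⟨β', ?_, fun v ↦ ?_⟩
    · rw [hκ, cotangent_extChartAt_fst]
      have h1 := sharpInChart_apply (P := P) hb0 β'
      rw [hβ, hbase, he', hψ0] at h1
      exact h1
    · have h1 := hβ' (e.symm v)
      rw [ContinuousLinearMap.comp_apply, hbase, he'] at h1
      have h2 := hBω (e.symm u) (e.symm v)
      rw [he', he', omegaForm, h.flowAverage_apply isOpen_Ioo hJ'
        differentiableOn_formInChart_canonicalForm hψ hξO hε] at h2
      have h3 := intervalIntegral.smul_integral_comp_mul_left (a := 0) (b := 1)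
        (fun s ↦ formPullback (cotangentModel E) (cotangentModel E) (ψ s) (canonicalForm E M) ξ
          ![e.symm u, e.symm v]) ε
      rw [mul_zero, mul_one, h2, ← h1] at h3
      refine Eq.trans h3 ?_
      simp
  -- The covector `-ε α'` gives `(ε B) u = ε α' ∘ fst`; the factor `ε` is cancelled at the end.
  obtain ⟨u, hu1, hu2⟩ := fst_eq_of_ker hBinj hker ((-ε) • α')
  refine ⟨u, by rw [hu1, map_smul], fun w v hw ↦ ?_⟩
  have h1 := hu2 (chartDeriv (cotangentModel E) ξ ξ v)
  rw [hBω, hw]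
  have h2 : ε * B u (chartDeriv (cotangentModel E) ξ ξ v) =
      ε * α' (chartDeriv (cotangentModel E) ξ ξ v).1 := by
    refine Eq.trans h1 ?_
    simp
  exact mul_left_cancel₀ hε0.ne' h2

end PoissonMap

/-! ### Flows of time-dependent vector fields near a rest point. -/

section TimeDependentFlow

variable {F : Type*} [NormedAddCommGroup F] [NormedSpace ℝ F]

/-- The flow of a time-dependent vector field near a constant integral curve. -/
theorem exists_contDiffOn_flow_of_zero [CompleteSpace F] {X : ℝ × F → F} {S : Set (ℝ × F)}
    (hS : IsOpen S) (hX : ContDiffOn ℝ ∞ X S) {z₀ : F}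
    (hz₀ : ∀ t ∈ Icc (0 : ℝ) 1, (t, z₀) ∈ S ∧ X (t, z₀) = 0) :
    ∃ δ > 0, ∃ O : Set F, IsOpen O ∧ z₀ ∈ O ∧ ∃ Z : ℝ × F → F,
      ContDiffOn ℝ ∞ Z (Ioo (-δ) (1 + δ) ×ˢ O) ∧ (∀ z ∈ O, Z (0, z) = z) ∧
      ∀ z ∈ O, ∀ t ∈ Ioo (-δ) (1 + δ), (t, Z (t, z)) ∈ S ∧
        HasDerivAt (fun s ↦ Z (s, z)) (X (t, Z (t, z))) t := by
  -- The suspended autonomous field `(1, X)` on `ℝ × F`; the rest point becomes the integral curve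
  -- `t ↦ (t, z₀)`.
  set V : Π p : ℝ × F, TangentSpace 𝓘(ℝ, ℝ × F) p := fun p ↦ (((1 : ℝ), X p) : ℝ × F) with hVdef
  have hV : ContMDiffOn 𝓘(ℝ, ℝ × F) 𝓘(ℝ, ℝ × F).tangent ∞
      (fun p : ℝ × F ↦ (⟨p, V p⟩ : TangentBundle 𝓘(ℝ, ℝ × F) (ℝ × F))) S :=
    contMDiffOn_vectorSpace_iff_contDiffOn.2 (contDiffOn_const.prodMk hX)
  have hγ : ∀ t ∈ Icc (0 : ℝ) 1, (fun t : ℝ ↦ (t, z₀)) t ∈ S ∧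
      HasMFDerivWithinAt 𝓘(ℝ, ℝ) 𝓘(ℝ, ℝ × F) (fun t : ℝ ↦ (t, z₀)) (Icc 0 1) t
        ((1 : ℝ →L[ℝ] ℝ).smulRight (V (t, z₀))) := by
    intro t ht
    refine ⟨(hz₀ t ht).1, HasFDerivWithinAt.hasMFDerivWithinAt ?_⟩
    have h1 : HasDerivAt (fun t : ℝ ↦ (t, z₀)) ((1 : ℝ), (0 : F)) t :=
      (hasDerivAt_id t).prodMk (hasDerivAt_const t z₀)
    have h2 : V (t, z₀) = ((1 : ℝ), (0 : F)) := by
      simp only [hVdef, (hz₀ t ht).2]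
      rfl
    rw [h2]
    exact h1.hasFDerivAt.hasFDerivWithinAt
  obtain ⟨δ, hδ, O, hO, ψ, h⟩ := exists_isSmoothFlow hS hV hγ
  have h0 : (0 : ℝ) ∈ Ioo (-δ) (1 + δ) := ⟨by linarith, by linarith⟩
  have hd : ∀ z, (0, z) ∈ O → ∀ t ∈ Ioo (-δ) (1 + δ),
      HasDerivAt (fun s ↦ ψ s (0, z)) ((1 : ℝ), X (ψ t (0, z))) t := by
    intro z hz t ht
    have h1 : HasFDerivAt (fun s ↦ ψ s (0, z))
        ((1 : ℝ →L[ℝ] ℝ).smulRight (((1 : ℝ), X (ψ t (0, z))) : ℝ × F)) t :=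
      (h.deriv (0, z) hz t ht).hasFDerivAt
    exact h1.hasDerivAt.congr_deriv (one_smul ℝ _)
  have h1 : ∀ z, (0, z) ∈ O → ∀ t ∈ Ioo (-δ) (1 + δ), (ψ t (0, z)).1 = t := by
    intro z hz t ht
    have hd' : ∀ t ∈ Ioo (-δ) (1 + δ), HasDerivAt (fun s ↦ (ψ s (0, z)).1 - s) 0 t := by
      intro t ht
      have := ((hasFDerivAt_fst (𝕜 := ℝ)).comp_hasDerivAt t (hd z hz t ht)).sub (hasDerivAt_id t)
      exact this.congr_deriv (by simp)
    have h2 := isOpen_Ioo.is_const_of_deriv_eq_zero isPreconnected_Ioo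
      (fun t ht ↦ (hd' t ht).differentiableAt.differentiableWithinAt)
      (fun t ht ↦ (hd' t ht).deriv) ht h0
    rw [h.initial _ hz] at h2
    simpa [sub_eq_zero] using h2
  refine ⟨δ, hδ, (fun z ↦ ((0 : ℝ), z)) ⁻¹' O, h.isOpen.preimage (by fun_prop), hO,
    fun p ↦ (ψ p.1 (0, p.2)).2, ?_, fun z hz ↦ by simp only [h.initial _ hz], fun z hz t ht ↦ ?_⟩
  · have h2 : ContDiffOn ℝ ∞ (fun p : ℝ × (ℝ × F) ↦ ψ p.1 p.2) (Ioo (-δ) (1 + δ) ×ˢ O) := by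
      rw [← contMDiffOn_iff_contDiffOn, modelWithCornersSelf_prod]
      rw [← chartedSpaceSelf_prod]
      exact h.smooth
    exact contDiff_snd.comp_contDiffOn (h2.comp
      (contDiff_fst.prodMk (contDiff_const.prodMk contDiff_snd)).contDiffOn
      fun p hp ↦ ⟨hp.1, hp.2⟩)
  · have h2 : (t, (ψ t (0, z)).2) = ψ t (0, z) := Prod.ext (h1 z hz t ht).symm rfl
    simp only [h2]
    have h3 := (hasFDerivAt_snd (𝕜 := ℝ)).comp_hasDerivAt t (hd z hz t ht)
    exact ⟨h.mem _ hz t ht, h3⟩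

end TimeDependentFlow

/-! ### Moser's argument in a vector space. -/

section Moser

variable {F : Type*} [NormedAddCommGroup F] [NormedSpace ℝ F]
  {Θ : ℝ × F → F →L[ℝ] ℝ} {X Z : ℝ × F → F}

/-- The derivative of the time-dependent flow satisfies the variational equation. -/
lemma hasDerivAt_fderiv_flow {t : ℝ} {z : F} (hZ : ContDiffAt ℝ ∞ Z (t, z))
    (hX : DifferentiableAt ℝ X (t, Z (t, z)))
    (hZX : ∀ᶠ p : ℝ × F in 𝓝 (t, z), fderiv ℝ Z p (1, 0) = X (p.1, Z p)) (u : F) :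
    HasDerivAt (fun s ↦ fderiv ℝ Z (s, z) (0, u))
      (fderiv ℝ X (t, Z (t, z)) (0, fderiv ℝ Z (t, z) (0, u))) t := by
  have hd : HasFDerivAt (fderiv ℝ Z) (fderiv ℝ (fderiv ℝ Z) (t, z)) (t, z) :=
    ((hZ.fderiv_right (m := ∞) le_rfl).differentiableAt (by simp)).hasFDerivAt
  have hsymm : IsSymmSndFDerivAt ℝ Z (t, z) := hZ.isSymmSndFDerivAt (by
    simp only [minSmoothness_of_isRCLikeNormedField]; exact WithTop.coe_le_coe.2 le_top)
  have h1 : HasDerivAt (fun s ↦ fderiv ℝ Z (s, z) (0, u))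
      (fderiv ℝ (fderiv ℝ Z) (t, z) (1, 0) (0, u)) t := by
    have h2 := (hd.comp t (hasFDerivAt_prodMk_left t z)).hasDerivAt
    have h3 := h2.clm_apply (hasDerivAt_const t ((0, u) : ℝ × F))
    simpa using h3
  have h4 : HasFDerivAt (fun p ↦ fderiv ℝ Z p (1, 0))
      (fderiv ℝ X (t, Z (t, z)) ∘L ((ContinuousLinearMap.fst ℝ ℝ F).prod (fderiv ℝ Z (t, z))))
      (t, z) :=
    (hX.hasFDerivAt.comp (t, z) ((hasFDerivAt_fst (𝕜 := ℝ) (p := (t, z))).prodMk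
      (hZ.differentiableAt (by simp)).hasFDerivAt)).congr_of_eventuallyEq hZX
  have h5 : HasFDerivAt (fun p ↦ fderiv ℝ Z p (1, 0))
      ((fderiv ℝ (fderiv ℝ Z) (t, z)).flip (1, 0)) (t, z) := by
    have := hd.clm_apply (hasFDerivAt_const ((1, 0) : ℝ × F) (t, z))
    simpa using this
  have h6 := congr($(h4.unique h5) (0, u))
  rw [hsymm] at h1
  convert h1 using 1
  exact h6

lemma hasFDerivAt_spatialExtDeriv {p : ℝ × F} (hΘ : ContDiffAt ℝ ∞ Θ p) (a b : F) :
    HasFDerivAt (fun p ↦ spatialExtDeriv Θ p a b)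
      (((ContinuousLinearMap.apply ℝ ℝ b) ∘L (fderiv ℝ (fderiv ℝ Θ) p).flip (0, a)) -
        ((ContinuousLinearMap.apply ℝ ℝ a) ∘L (fderiv ℝ (fderiv ℝ Θ) p).flip (0, b))) p := by
  have hd : HasFDerivAt (fderiv ℝ Θ) (fderiv ℝ (fderiv ℝ Θ) p) p :=
    ((hΘ.fderiv_right (m := ∞) le_rfl).differentiableAt (by simp)).hasFDerivAt
  have h1 : ∀ a b : F, HasFDerivAt (fun p ↦ fderiv ℝ Θ p (0, a) b)
      ((ContinuousLinearMap.apply ℝ ℝ b) ∘L (fderiv ℝ (fderiv ℝ Θ) p).flip (0, a)) p := by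
    intro a b
    refine ((hd.clm_apply (hasFDerivAt_const ((0, a) : ℝ × F) p)).clm_apply
      (hasFDerivAt_const b p)).congr_fderiv ?_
    ext <;> simp
  exact (h1 a b).sub (h1 b a)

lemma ContDiffAt.differentiableAt_spatialExtDeriv {p : ℝ × F} (hΘ : ContDiffAt ℝ ∞ Θ p) :
    DifferentiableAt ℝ (spatialExtDeriv Θ) p := by
  have hd : DifferentiableAt ℝ (fderiv ℝ Θ) p :=
    (hΘ.fderiv_right (m := ∞) le_rfl).differentiableAt (by simp)
  have h1 : DifferentiableAt ℝ (fun p ↦ fderiv ℝ Θ p ∘L ContinuousLinearMap.inr ℝ ℝ F) p :=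
    hd.clm_comp (differentiableAt_const _)
  have h2 : DifferentiableAt ℝ
      (fun p ↦ (fderiv ℝ Θ p ∘L ContinuousLinearMap.inr ℝ ℝ F).flip) p :=
    (ContinuousLinearMap.flipₗᵢ ℝ F F ℝ).toContinuousLinearEquiv.differentiableAt.comp p h1
  exact h1.sub h2

lemma fderiv_spatialExtDeriv_apply {p : ℝ × F} (hΘ : ContDiffAt ℝ ∞ Θ p) (w : ℝ × F) (a b : F) :
    fderiv ℝ (spatialExtDeriv Θ) p w a b =
      fderiv ℝ (fderiv ℝ Θ) p w (0, a) b - fderiv ℝ (fderiv ℝ Θ) p w (0, b) a := by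
  have h1 := (hΘ.differentiableAt_spatialExtDeriv.hasFDerivAt.clm_apply
    (hasFDerivAt_const a p)).clm_apply (hasFDerivAt_const b p)
  have h2 := congr($(h1.unique (hasFDerivAt_spatialExtDeriv hΘ a b)) w)
  simpa using h2

set_option maxHeartbeats 1600000 in
/-- Moser's argument: the flow of `X` carries the 2-form `dΘ_0` to `dΘ_t` when
`i_X dΘ_t = -∂Θ_t/∂t`. -/
lemma hasDerivAt_spatialExtDeriv_flow {t : ℝ} {z : F}
    (hΘ : ContDiffAt ℝ ∞ Θ (t, Z (t, z))) (hZ : ContDiffAt ℝ ∞ Z (t, z))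
    (hX : ContDiffAt ℝ ∞ X (t, Z (t, z)))
    (hZX : ∀ᶠ p : ℝ × F in 𝓝 (t, z), fderiv ℝ Z p (1, 0) = X (p.1, Z p))
    (hXΘ : ∀ᶠ p : ℝ × F in 𝓝 (t, Z (t, z)), spatialExtDeriv Θ p (X p) = -fderiv ℝ Θ p (1, 0))
    (u v : F) :
    HasDerivAt (fun s ↦ spatialExtDeriv Θ (s, Z (s, z)) (fderiv ℝ Z (s, z) (0, u))
      (fderiv ℝ Z (s, z) (0, v))) 0 t := by
  set p := (t, Z (t, z)) with hp
  set B := spatialExtDeriv Θ with hB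
  have hd : HasFDerivAt (fderiv ℝ Θ) (fderiv ℝ (fderiv ℝ Θ) p) p :=
    ((hΘ.fderiv_right (m := ∞) le_rfl).differentiableAt (by simp)).hasFDerivAt
  have hsymm : IsSymmSndFDerivAt ℝ Θ p := hΘ.isSymmSndFDerivAt (by
    simp only [minSmoothness_of_isRCLikeNormedField]; exact WithTop.coe_le_coe.2 le_top)
  have hBd : DifferentiableAt ℝ B p := hΘ.differentiableAt_spatialExtDeriv
  have hB' := fderiv_spatialExtDeriv_apply hΘ
  rw [← hB] at hB'
  -- The spatial derivative of the equation `i_X dΘ = -∂Θ/∂t`.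
  have hXB : ∀ a b, fderiv ℝ B p (0, a) (X p) b + B p (fderiv ℝ X p (0, a)) b =
      -fderiv ℝ (fderiv ℝ Θ) p (0, a) (1, 0) b := by
    intro a b
    have h1 := hBd.hasFDerivAt.clm_apply (hX.differentiableAt (by simp)).hasFDerivAt
    have h2 := (hd.clm_apply (hasFDerivAt_const ((1, 0) : ℝ × F) p)).neg
    have h3 := congr($(h1.unique (h2.congr_of_eventuallyEq hXΘ)) (0, a) b)
    simpa [add_comm] using h3
  have hskew : ∀ a b, B p a b = -B p b a := by
    intro a b
    rw [hB, spatialExtDeriv_apply, spatialExtDeriv_apply]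
    ring
  have hJ := hasDerivAt_fderiv_flow hZ (hX.differentiableAt (by simp)) hZX
  have hγ : HasDerivAt (fun s ↦ (s, Z (s, z))) (1, X p) t := by
    have h1 := ((hZ.differentiableAt (by simp)).hasFDerivAt.comp t
      (hasFDerivAt_prodMk_left (𝕜 := ℝ) t z)).hasDerivAt
    have h2 := hZX.self_of_nhds
    exact ((hasDerivAt_id t).prodMk (h1.congr_deriv h2))
  have hmain := ((hBd.hasFDerivAt.comp_hasDerivAt t hγ).clm_apply (hJ u)).clm_apply (hJ v)
  refine hmain.congr_deriv ?_
  set a := fderiv ℝ Z (t, z) (0, u)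
  set b := fderiv ℝ Z (t, z) (0, v)
  have h1 := hXB a b
  have h2 := hXB b a
  have h3 := hskew a (fderiv ℝ X p (0, b))
  have h4 : ((1 : ℝ), X p) = (1, 0) + (0, X p) := by simp
  simp only [Function.comp_apply, add_apply, h4, map_add, hB'] at h1 h2 ⊢
  -- Cartan's formula and `d² = 0` in coordinates: after the differentiated Moser equation is
  -- inserted, the remaining terms cancel by symmetry of the second derivative of `Θ`.
  have s1 := congr($(hsymm (1, 0) (0, a)) b)
  have s2 := congr($(hsymm (1, 0) (0, b)) a)
  have s3 := congr($(hsymm (0, X p) (0, a)) b)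
  have s4 := congr($(hsymm (0, X p) (0, b)) a)
  have s5 := congr($(hsymm (0, a) (0, b)) (X p))
  rw [← hp]
  linarith

end Moser

/-! ### The solution of Moser's equation in a vector space. -/

section MoserField

variable {F : Type*} [NormedAddCommGroup F] [NormedSpace ℝ F]
  {Θ : ℝ × F → F →L[ℝ] ℝ} {S : Set (ℝ × F)}

/-- The points of `S` at which the 2-form `spatialExtDeriv Θ` is non-degenerate. -/
def regularPoints (Θ : ℝ × F → F →L[ℝ] ℝ) (S : Set (ℝ × F)) : Set (ℝ × F) :=
  S ∩ spatialExtDeriv Θ ⁻¹' (range ((↑) : (F ≃L[ℝ] (F →L[ℝ] ℝ)) → (F →L[ℝ] (F →L[ℝ] ℝ))))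

/-- The solution `X` of the equation `i_X ω = -∂θ/∂ε`. -/
def moserField (Θ : ℝ × F → F →L[ℝ] ℝ) (p : ℝ × F) : F :=
  -(spatialExtDeriv Θ p).inverse (fderiv ℝ Θ p (1, 0))

lemma isOpen_regularPoints [CompleteSpace F] (hS : IsOpen S) (hΘ : ContDiffOn ℝ ∞ Θ S) :
    IsOpen (regularPoints Θ S) :=
  (hΘ.spatialExtDeriv hS).continuousOn.isOpen_inter_preimage hS ContinuousLinearEquiv.isOpen

lemma spatialExtDeriv_eq_iff {p : ℝ × F} (hp : p ∈ regularPoints Θ S) (x : F) :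
    spatialExtDeriv Θ p x = -fderiv ℝ Θ p (1, 0) ↔ x = moserField Θ p := by
  obtain ⟨-, B, hB⟩ := hp
  rw [moserField, ← hB, ContinuousLinearMap.inverse_equiv]
  have h := (B.eq_symm_apply (y := x) (x := -fderiv ℝ Θ p (1, 0))).symm
  rwa [map_neg] at h

lemma contDiffOn_moserField [CompleteSpace F] (hS : IsOpen S) (hΘ : ContDiffOn ℝ ∞ Θ S) :
    ContDiffOn ℝ ∞ (moserField Θ) (regularPoints Θ S) := by
  intro p hp
  obtain ⟨hpS, B, hB⟩ := hp
  have h1 : ContDiffAt ℝ ∞ (spatialExtDeriv Θ) p :=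
    (hΘ.spatialExtDeriv hS).contDiffAt (hS.mem_nhds hpS)
  have h2 : ContDiffAt ℝ ∞ ContinuousLinearMap.inverse (spatialExtDeriv Θ p) := by
    rw [← hB]
    exact contDiffAt_map_inverse B
  have h3 : ContDiffAt ℝ ∞ (fun q ↦ fderiv ℝ Θ q (1, 0)) p :=
    ((hΘ.fderiv_of_isOpen hS (m := ∞) le_rfl).contDiffAt (hS.mem_nhds hpS)).clm_apply
      contDiffAt_const
  exact ((h2.comp p h1).clm_apply h3).neg.contDiffWithinAt

end MoserField

/-! ### Moser's equation on the cotangent bundle. -/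

section MoserOnCotangent

variable {E : Type*} [NormedAddCommGroup E] [NormedSpace ℝ E]
    {M : Type*} [TopologicalSpace M] [ChartedSpace E M] [IsManifold 𝓘(ℝ, E) ∞ M]
    [IsManifold 𝓘(ℝ, E) 1 M]
    {φ : ℝ → Cotangent E M → Cotangent E M} {c : Cotangent E M} {δ : ℝ}
    {O' : Set (E × (E →L[ℝ] ℝ))} {Θ : ℝ × (E × (E →L[ℝ] ℝ)) → (E × (E →L[ℝ] ℝ)) →L[ℝ] ℝ}

lemma IsPotential.Icc_subset (h : IsPotential φ c δ O' Θ) : Icc (0 : ℝ) 1 ⊆ Ioo (-δ) (1 + δ) :=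
  fun t ht ↦ ⟨by linarith [ht.1, h.pos], by linarith [ht.2, h.pos]⟩

lemma IsPotential.contDiffAt (h : IsPotential φ c δ O' Θ) {p : ℝ × (E × (E →L[ℝ] ℝ))}
    (hp : p ∈ Ioo (-δ) (1 + δ) ×ˢ O') : ContDiffAt ℝ ∞ Θ p :=
  h.smooth.contDiffAt ((isOpen_Ioo.prod h.isOpen).mem_nhds hp)

lemma IsPotential.hasDerivAt (h : IsPotential φ c δ O' Θ) {ε : ℝ} {z : E × (E →L[ℝ] ℝ)}
    (hp : (ε, z) ∈ Ioo (-δ) (1 + δ) ×ˢ O') :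
    HasDerivAt (fun e ↦ Θ (e, z)) (fderiv ℝ Θ (ε, z) (1, 0)) ε :=
  ((h.contDiffAt hp).differentiableAt (by simp)).hasFDerivAt.comp_hasDerivAt ε
    ((hasDerivAt_id ε).prodMk (hasDerivAt_const ε z))

/-- `Θ` represents the forms only for `ε ∈ [0, 1]`, so derivatives are compared within this
interval; they are unique there, also at its end points. -/
lemma IsPotential.solvesMoser_iff (h : IsPotential φ c δ O' Θ) {ε : ℝ} (hε : ε ∈ Icc (0 : ℝ) 1)
    {ξ : Cotangent E M} (hξ : ξ ∈ (chartAt (ModelProd E (E →L[ℝ] ℝ)) c).source)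
    (hO : extChartAt (cotangentModel E) c ξ ∈ O') (x : TangentSpace (cotangentModel E) ξ) :
    SolvesMoser φ ε ξ x ↔
      spatialExtDeriv Θ (ε, extChartAt (cotangentModel E) c ξ)
        (chartDeriv (cotangentModel E) c ξ x) =
      -fderiv ℝ Θ (ε, extChartAt (cotangentModel E) c ξ) (1, 0) := by
  have hder : ∀ v : TangentSpace (cotangentModel E) ξ,
      HasDerivWithinAt (fun e ↦ thetaForm φ e ξ ![v])
        (fderiv ℝ Θ (ε, extChartAt (cotangentModel E) c ξ) (1, 0)
          (chartDeriv (cotangentModel E) c ξ v)) (Icc 0 1) ε := fun v ↦ by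
    have h1 := (h.hasDerivAt (ε := ε) ⟨h.Icc_subset hε, hO⟩).clm_apply
      (hasDerivAt_const ε (chartDeriv (cotangentModel E) c ξ v))
    simp only [map_zero, add_zero] at h1
    exact h1.hasDerivWithinAt.congr (fun e he ↦ h.theta e he ξ hξ hO v) (h.theta ε hε ξ hξ hO v)
  have hb := chartDeriv_bijective (I := cotangentModel E) hξ
  constructor
  · intro H
    refine ContinuousLinearMap.ext fun w ↦ ?_
    obtain ⟨v, rfl⟩ := hb.2 w
    have h1 := (uniqueDiffOn_Icc zero_lt_one ε hε).eq_deriv _ (H v) (hder v)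
    rw [h.omega_apply hε hξ hO] at h1
    exact neg_eq_iff_eq_neg.1 h1
  · intro H v
    rw [h.omega_apply hε hξ hO, H]
    simpa using hder v

variable [FiniteDimensional ℝ E]

lemma IsPotential.mem_regularPoints (h : IsPotential φ c δ O' Θ) {ε : ℝ}
    (hε : ε ∈ Icc (0 : ℝ) 1) {ξ : Cotangent E M}
    (hξ : ξ ∈ (chartAt (ModelProd E (E →L[ℝ] ℝ)) c).source)
    (hO : extChartAt (cotangentModel E) c ξ ∈ O')
    (hnd : ∀ v : TangentSpace (cotangentModel E) ξ,
      (∀ w : TangentSpace (cotangentModel E) ξ, omegaForm φ ε ξ ![v, w] = 0) → v = 0) :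
    (ε, extChartAt (cotangentModel E) c ξ) ∈ regularPoints Θ (Ioo (-δ) (1 + δ) ×ˢ O') :=
  ⟨⟨h.Icc_subset hε, hO⟩, ContinuousLinearMap.isInvertible_of_injective_dual
    ((h.nondegenerate_iff hε hξ hO).1 hnd)⟩

lemma IsPotential.solvesMoser_iff_eq (h : IsPotential φ c δ O' Θ) {ε : ℝ}
    (hε : ε ∈ Icc (0 : ℝ) 1) {ξ : Cotangent E M}
    (hξ : ξ ∈ (chartAt (ModelProd E (E →L[ℝ] ℝ)) c).source)
    (hO : extChartAt (cotangentModel E) c ξ ∈ O')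
    (hnd : ∀ v : TangentSpace (cotangentModel E) ξ,
      (∀ w : TangentSpace (cotangentModel E) ξ, omegaForm φ ε ξ ![v, w] = 0) → v = 0)
    (x : TangentSpace (cotangentModel E) ξ) :
    SolvesMoser φ ε ξ x ↔ chartDeriv (cotangentModel E) c ξ x =
      moserField Θ (ε, extChartAt (cotangentModel E) c ξ) := by
  rw [h.solvesMoser_iff hε hξ hO, spatialExtDeriv_eq_iff (h.mem_regularPoints hε hξ hO hnd)]

variable [T2Space M] {P : SharpField E M}
    {V : Π ξ : Cotangent E M, TangentSpace (cotangentModel E) ξ} {U : Set (Cotangent E M)}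

theorem IsSprayDomain.existsUnique_solvesMoser (hU : IsSprayDomain V φ U)
    (hV : IsPoissonSpray P V) {ε : ℝ} (hε : ε ∈ Icc (0 : ℝ) 1) {ξ : Cotangent E M} (hξ : ξ ∈ U) :
    ∃! x : TangentSpace (cotangentModel E) ξ, SolvesMoser φ ε ξ x := by
  have := FiniteDimensional.complete ℝ E
  obtain ⟨δ, O', Θ, hpot, hO, -⟩ := hV.exists_isPotential hU.isOpen hU.flow hξ
  have hs := mem_chart_source (ModelProd E (E →L[ℝ] ℝ)) ξ
  have hiff := hpot.solvesMoser_iff_eq hε hs hO (hU.nondegenerate ε hε ξ hξ)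
  obtain ⟨x, hx, hx'⟩ := (chartDeriv_bijective (I := cotangentModel E) hs).existsUnique
    (moserField Θ (ε, extChartAt (cotangentModel E) ξ ξ))
  exact ⟨x, (hiff x).2 hx, fun y hy ↦ hx' y ((hiff y).1 hy)⟩

variable {X : ℝ → Π ξ : Cotangent E M, TangentSpace (cotangentModel E) ξ}

/-- In a chart `X` is the restriction of `moserField Θ`, which is smooth on an open set reaching
past the times `0` and `1`. -/
theorem IsSprayDomain.contMDiffOn_moserField (hU : IsSprayDomain V φ U)
    (hV : IsPoissonSpray P V)
    (hX : ∀ ε ∈ Icc (0 : ℝ) 1, ∀ ξ ∈ U, SolvesMoser φ ε ξ (X ε ξ)) :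
    ContMDiffOn (𝓘(ℝ, ℝ).prod (cotangentModel E)) (cotangentModel E).tangent ∞
      (fun p : ℝ × Cotangent E M ↦
        (⟨p.2, X p.1 p.2⟩ : TangentBundle (cotangentModel E) (Cotangent E M)))
      (Icc 0 1 ×ˢ U) := by
  have := FiniteDimensional.complete ℝ E
  rintro ⟨ε, ξ⟩ ⟨hε, hξ⟩
  obtain ⟨δ, O', Θ, hpot, hO, -⟩ := hV.exists_isPotential hU.isOpen hU.flow hξ
  have hs := mem_chart_source (ModelProd E (E →L[ℝ] ℝ)) ξ
  set κ := extChartAt (cotangentModel E) ξ with hκ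
  have hreg := hpot.mem_regularPoints hε hs hO (hU.nondegenerate ε hε ξ hξ)
  rw [contMDiffWithinAt_field_iff (I := cotangentModel E)
    (f := fun p : ℝ × Cotangent E M ↦ p.2) (X := fun p ↦ X p.1 p.2) (c := ξ) hs]
  refine ⟨contMDiffWithinAt_snd, ?_⟩
  have hSo : IsOpen (Ioo (-δ) (1 + δ) ×ˢ O') := isOpen_Ioo.prod hpot.isOpen
  have h1 : ContDiffAt ℝ ∞ (moserField Θ) (ε, κ ξ) :=
    (contDiffOn_moserField hSo hpot.smooth).contDiffAt
      ((isOpen_regularPoints hSo hpot.smooth).mem_nhds hreg)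
  have h2 : ContMDiffAt (𝓘(ℝ, ℝ).prod (cotangentModel E)) 𝓘(ℝ, ℝ × (E × (E →L[ℝ] ℝ))) ∞
      (fun p : ℝ × Cotangent E M ↦ (p.1, κ p.2)) (ε, ξ) :=
    contMDiffAt_fst.prodMk_space
      (ContMDiffAt.comp (ε, ξ) (contMDiffAt_extChartAt' hs) contMDiffAt_snd)
  have h3 := (ContMDiffAt.comp (ε, ξ) (contMDiffAt_iff_contDiffAt.2 h1) h2).contMDiffWithinAt
    (s := Icc (0 : ℝ) 1 ×ˢ U)
  refine h3.congr_of_eventuallyEq ?_ ((hpot.solvesMoser_iff_eq hε hs hO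
    (hU.nondegenerate ε hε ξ hξ) _).1 (hX ε hε ξ hξ))
  have h4 : ∀ᶠ p : ℝ × Cotangent E M in 𝓝 (ε, ξ),
      p.2 ∈ (chartAt (ModelProd E (E →L[ℝ] ℝ)) ξ).source ∧ κ p.2 ∈ O' :=
    (continuousAt_snd (p := (ε, ξ))).eventually (((chartAt _ ξ).open_source.eventually_mem hs).and
      ((continuousAt_extChartAt ξ).preimage_mem_nhds (hpot.isOpen.mem_nhds hO)))
  filter_upwards [self_mem_nhdsWithin, mem_nhdsWithin_of_mem_nhds h4] with p hp hp'
  exact (hpot.solvesMoser_iff_eq hp.1 hp'.1 hp'.2 (hU.nondegenerate _ hp.1 _ hp.2) _).1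
    (hX _ hp.1 _ hp.2)

end MoserOnCotangent

/-! ### The flow of the Moser field near a point of the zero section. -/

section LocalMoserFlow

variable {E : Type*} [NormedAddCommGroup E] [NormedSpace ℝ E] [FiniteDimensional ℝ E]
    {M : Type*} [TopologicalSpace M] [T2Space M] [ChartedSpace E M] [IsManifold 𝓘(ℝ, E) ∞ M]
    [IsManifold 𝓘(ℝ, E) 1 M]
    {P : SharpField E M} {V : Π ξ : Cotangent E M, TangentSpace (cotangentModel E) ξ}
    {φ : ℝ → Cotangent E M → Cotangent E M} {U : Set (Cotangent E M)}
    {X : ℝ → Π ξ : Cotangent E M, TangentSpace (cotangentModel E) ξ} {c : Cotangent E M}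
    {δ : ℝ} {O' : Set (E × (E →L[ℝ] ℝ))}
    {Θ : ℝ × (E × (E →L[ℝ] ℝ)) → (E × (E →L[ℝ] ℝ)) →L[ℝ] ℝ}

lemma liouville_eq_zero (hc : c ∈ cotangentZero E M) : liouville E M c = 0 := by
  ext v
  have h : c.2 = 0 := hc
  exact congr($h _)

/-- The flow of `V` fixes the zero section, where the Liouville form vanishes pointwise. -/
lemma IsSprayDomain.thetaForm_zero (hU : IsSprayDomain V φ U) (hV : IsPoissonSpray P V)
    (hc : c ∈ cotangentZero E M) {ε : ℝ} (hε : ε ∈ Icc (0 : ℝ) 1) : thetaForm φ ε c = 0 := by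
  have := FiniteDimensional.complete ℝ E
  rw [thetaForm, flowAverage]
  split_ifs with h0
  · exact liouville_eq_zero hc
  · have h1 : ∀ s ∈ uIcc 0 ε, (formPullback (cotangentModel E) (cotangentModel E) (φ s)
        (liouville E M) c).compContinuousLinearMap
          (tangentIdent (cotangentModel E) c : E × (E →L[ℝ] ℝ) →L[ℝ] _) = 0 := by
      intro s hs
      rw [uIcc_of_le hε.1] at hs
      have h2 : φ s c ∈ cotangentZero E M := by
        rwa [hV.flow_zero hc hU.flow (hU.zero_subset hc) ⟨hs.1, hs.2.trans hε.2⟩]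
      rw [formPullback, liouville_eq_zero h2]
      ext
      rfl
    rw [intervalIntegral.integral_congr (g := fun _ ↦ 0) h1]
    ext
    simp

/-- `Θ` vanishes at this point for all times in `[0, 1]`, and so does its time derivative. Points of
the zero section therefore are rest points of the Moser field. -/
lemma IsPotential.moserField_zero (h : IsPotential φ c δ O' Θ) (hU : IsSprayDomain V φ U)
    (hV : IsPoissonSpray P V) (hc : c ∈ cotangentZero E M)
    (hO : extChartAt (cotangentModel E) c c ∈ O') {ε : ℝ} (hε : ε ∈ Icc (0 : ℝ) 1) :
    moserField Θ (ε, extChartAt (cotangentModel E) c c) = 0 := by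
  have hs := mem_chart_source (ModelProd E (E →L[ℝ] ℝ)) c
  have h1 := h.hasDerivAt (ε := ε) ⟨h.Icc_subset hε, hO⟩
  have h2 : ∀ e ∈ Icc (0 : ℝ) 1, Θ (e, extChartAt (cotangentModel E) c c) = 0 := by
    intro e he
    refine ContinuousLinearMap.ext fun w ↦ ?_
    obtain ⟨v, rfl⟩ := (chartDeriv_bijective (I := cotangentModel E) hs).2 w
    rw [← h.theta e he c hs hO v, hU.thetaForm_zero hV hc he]
    rfl
  have h3 : fderiv ℝ Θ (ε, extChartAt (cotangentModel E) c c) (1, 0) = 0 :=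
    (uniqueDiffOn_Icc zero_lt_one ε hε).eq_deriv _ h1.hasDerivWithinAt
      ((hasDerivWithinAt_const ε (Icc 0 1) 0).congr h2 (h2 ε hε))
  rw [moserField, h3, map_zero, neg_zero]

/-- `Ψ` is a smooth flow of `X` on a neighbourhood `O` of `c` for the times in `[0, 1]`, along which
the forms `ω_{V,ε}` are preserved. -/
structure IsMoserFlow (φ : ℝ → Cotangent E M → Cotangent E M)
    (X : ℝ → Π ξ : Cotangent E M, TangentSpace (cotangentModel E) ξ) (U O : Set (Cotangent E M))
    (Ψ : ℝ → Cotangent E M → Cotangent E M) : Prop where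
  isOpen : IsOpen O
  flow : IsFlowOn (cotangentModel E) X U Ψ O
  smooth : ContMDiffOn (𝓘(ℝ, ℝ).prod (cotangentModel E)) (cotangentModel E) ∞
    (fun p : ℝ × Cotangent E M ↦ Ψ p.1 p.2) (Icc 0 1 ×ˢ O)
  pullback : ∀ ε ∈ Icc (0 : ℝ) 1, ∀ ξ ∈ O,
    formPullback (cotangentModel E) (cotangentModel E) (Ψ ε) (omegaForm φ ε) ξ =
      canonicalForm E M ξ

lemma ContMDiffAt.slice {Ψ : ℝ → Cotangent E M → Cotangent E M} {ε : ℝ} {ξ : Cotangent E M}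
    (h : ContMDiffAt (𝓘(ℝ, ℝ).prod (cotangentModel E))
      (cotangentModel E) ∞ (fun p : ℝ × Cotangent E M ↦ Ψ p.1 p.2) (ε, ξ)) :
    ContMDiffAt (cotangentModel E) (cotangentModel E) ∞ (Ψ ε) ξ :=
  ContMDiffAt.comp ξ (f := fun η ↦ (ε, η)) h (contMDiffAt_const.prodMk contMDiffAt_id)

/-- Near the rest point `c` the flow exists on an interval containing `[0, 1]`. Moser's argument
makes the pulled back forms constant in time, and at time `0` they are `ω_{V,0} = ω₀`. -/
theorem IsSprayDomain.exists_isMoserFlow (hU : IsSprayDomain V φ U) (hV : IsPoissonSpray P V)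
    (hX : ∀ ε ∈ Icc (0 : ℝ) 1, ∀ ξ ∈ U, SolvesMoser φ ε ξ (X ε ξ))
    (hc : c ∈ cotangentZero E M) :
    ∃ O, c ∈ O ∧ ∃ Ψ, IsMoserFlow φ X U O Ψ := by
  have := FiniteDimensional.complete ℝ E
  obtain ⟨δ, O', Θ, hpot, hO, hOU⟩ := hV.exists_isPotential hU.isOpen hU.flow (hU.zero_subset hc)
  have hs := mem_chart_source (ModelProd E (E →L[ℝ] ℝ)) c
  set κ := extChartAt (cotangentModel E) c with hκ
  set S := regularPoints Θ (Ioo (-δ) (1 + δ) ×ˢ O') with hS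
  have hJO : IsOpen (Ioo (-δ) (1 + δ) ×ˢ O') := isOpen_Ioo.prod hpot.isOpen
  have hSo : IsOpen S := isOpen_regularPoints hJO hpot.smooth
  have hXS : ContDiffOn ℝ ∞ (moserField Θ) S := contDiffOn_moserField hJO hpot.smooth
  obtain ⟨η, hη, O₁, hO₁, hcO₁, Z, hZ, hZ0, hZd⟩ := exists_contDiffOn_flow_of_zero hSo hXS
    (z₀ := κ c) fun t ht ↦ ⟨hpot.mem_regularPoints ht hs hO
      (hU.nondegenerate t ht c (hU.zero_subset hc)), hpot.moserField_zero hU hV hc hO ht⟩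
  have hJ : Icc (0 : ℝ) 1 ⊆ Ioo (-η) (1 + η) :=
    fun t ht ↦ ⟨by linarith [ht.1], by linarith [ht.2]⟩
  have hZO : ∀ z ∈ O₁, ∀ t ∈ Icc (0 : ℝ) 1, Z (t, z) ∈ O' :=
    fun z hz t ht ↦ (hZd z hz t (hJ ht)).1.1.2
  have hZt : ∀ z ∈ O₁, ∀ t ∈ Icc (0 : ℝ) 1, Z (t, z) ∈ κ.target :=
    fun z hz t ht ↦ hpot.subset_target (hZO z hz t ht)
  have hZc : ∀ z ∈ O₁, ∀ t ∈ Icc (0 : ℝ) 1, κ.symm (Z (t, z)) ∈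
      (chartAt (ModelProd E (E →L[ℝ] ℝ)) c).source := fun z hz t ht ↦ by
    rw [← extChartAt_source (cotangentModel E)]
    exact κ.map_target (hZt z hz t ht)
  have hZr : ∀ z ∈ O₁, ∀ t ∈ Icc (0 : ℝ) 1, κ (κ.symm (Z (t, z))) = Z (t, z) :=
    fun z hz t ht ↦ κ.right_inv (hZt z hz t ht)
  have hZU : ∀ z ∈ O₁, ∀ t ∈ Icc (0 : ℝ) 1, κ.symm (Z (t, z)) ∈ U :=
    fun z hz t ht ↦ hOU ⟨_, hZO z hz t ht, rfl⟩
  have hZs : ∀ z ∈ O₁, ∀ t ∈ Ioo (-η) (1 + η), ContDiffAt ℝ ∞ Z (t, z) := fun z hz t ht ↦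
    hZ.contDiffAt ((isOpen_Ioo.prod hO₁).mem_nhds ⟨ht, hz⟩)
  have hsmooth : ∀ ε ∈ Icc (0 : ℝ) 1, ∀ ξ ∈ κ.source ∩ κ ⁻¹' O₁,
      ContMDiffAt (𝓘(ℝ, ℝ).prod (cotangentModel E)) (cotangentModel E) ∞
        (fun p : ℝ × Cotangent E M ↦ κ.symm (Z (p.1, κ p.2))) (ε, ξ) := by
    intro ε hε ξ hξ
    have hξ' : ξ ∈ (chartAt (ModelProd E (E →L[ℝ] ℝ)) c).source := by
      rw [← extChartAt_source (cotangentModel E)]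
      exact hξ.1
    have h2 : ContMDiffAt (𝓘(ℝ, ℝ).prod (cotangentModel E)) 𝓘(ℝ, ℝ × (E × (E →L[ℝ] ℝ))) ∞
        (fun p : ℝ × Cotangent E M ↦ (p.1, κ p.2)) (ε, ξ) :=
      contMDiffAt_fst.prodMk_space
        (ContMDiffAt.comp (ε, ξ) (contMDiffAt_extChartAt' hξ') contMDiffAt_snd)
    have h3 := ContMDiffAt.comp (ε, ξ)
      (contMDiffAt_iff_contDiffAt.2 (hZs _ hξ.2 ε (hJ hε))) h2
    exact ContMDiffAt.comp (ε, ξ) ((contMDiffOn_extChartAt_symm c).contMDiffAt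
      ((isOpen_extChartAt_target c).mem_nhds (hZt _ hξ.2 ε hε))) h3
  refine ⟨κ.source ∩ κ ⁻¹' O₁, ⟨mem_extChartAt_source c, hcO₁⟩,
    fun t ξ ↦ κ.symm (Z (t, κ ξ)),
    (continuousOn_extChartAt c).isOpen_inter_preimage (isOpen_extChartAt_source c) hO₁,
    ⟨fun ξ hξ ↦ ?_, fun ξ hξ t ht ↦ hZU _ hξ.2 t ht, fun ξ hξ t ht ↦ ?_⟩,
    fun p hp ↦ (hsmooth p.1 hp.1 p.2 hp.2).contMDiffWithinAt,
    fun ε hε ξ hξ ↦ ?_⟩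
  · rw [hZ0 _ hξ.2, κ.left_inv hξ.1]
  · have h1 := hasMFDerivWithinAt_chart_symm (I := cotangentModel E) (c := c)
      (hZt _ hξ.2 t ht) (hZd _ hξ.2 t (hJ ht)).2
    have h2 := (hpot.solvesMoser_iff_eq ht (hZc _ hξ.2 t ht)
      (by rw [← hκ, hZr _ hξ.2 t ht]; exact hZO _ hξ.2 t ht)
      (hU.nondegenerate t ht _ (hZU _ hξ.2 t ht)) _).1 (hX t ht _ (hZU _ hξ.2 t ht))
    rw [← hκ, hZr _ hξ.2 t ht] at h2
    rw [← h2, chartSymmDeriv_chartDeriv (hZt _ hξ.2 t ht)] at h1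
    exact h1.hasMFDerivWithinAt
  · have hξ' : ξ ∈ (chartAt (ModelProd E (E →L[ℝ] ℝ)) c).source := by
      rw [← extChartAt_source (cotangentModel E)]
      exact hξ.1
    set z := κ ξ with hz
    have hzO : z ∈ O₁ := hξ.2
    have hslice : ∀ t ∈ Ioo (-η) (1 + η), ∀ u : E × (E →L[ℝ] ℝ),
        fderiv ℝ (fun y ↦ Z (t, y)) z u = fderiv ℝ Z (t, z) (0, u) := fun t ht u ↦
      congr($((((hZs z hzO t ht).differentiableAt (by simp)).hasFDerivAt.comp z
        (hasFDerivAt_prodMk_right (𝕜 := ℝ) t z)).fderiv) u)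
    set G : (E × (E →L[ℝ] ℝ)) → (E × (E →L[ℝ] ℝ)) → ℝ → ℝ := fun u v s ↦
      spatialExtDeriv Θ (s, Z (s, z)) (fderiv ℝ Z (s, z) (0, u)) (fderiv ℝ Z (s, z) (0, v)) with hG
    have hGd : ∀ u v, ∀ t ∈ Icc (0 : ℝ) 1, HasDerivAt (G u v) 0 t := by
      intro u v t ht
      have hSt := (hZd z hzO t (hJ ht)).1
      refine hasDerivAt_spatialExtDeriv_flow (X := moserField Θ) (hpot.contDiffAt hSt.1)
        (hZs z hzO t (hJ ht)) (hXS.contDiffAt (hSo.mem_nhds hSt)) ?_ ?_ u v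
      · filter_upwards [(isOpen_Ioo.prod hO₁).mem_nhds (⟨hJ ht, hzO⟩ :
          (t, z) ∈ Ioo (-η) (1 + η) ×ˢ O₁)] with p hp
        have h1 := ((hZs p.2 hp.2 p.1 hp.1).differentiableAt (by simp)).hasFDerivAt.comp_hasDerivAt
          p.1 ((hasDerivAt_id p.1).prodMk (hasDerivAt_const p.1 p.2))
        exact h1.unique (hZd p.2 hp.2 p.1 hp.1).2
      · filter_upwards [hSo.mem_nhds hSt] with p hp
        exact (spatialExtDeriv_eq_iff hp _).2 rfl
    have hGc : ∀ u v, ∀ t ∈ Icc (0 : ℝ) 1, G u v t = G u v 0 := fun u v ↦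
      constant_of_has_deriv_right_zero
        (fun t ht ↦ (hGd u v t ht).continuousAt.continuousWithinAt)
        (fun t ht ↦ (hGd u v t (Ico_subset_Icc_self ht)).hasDerivWithinAt)
    have hZ0' : ∀ u, fderiv ℝ Z (0, z) (0, u) = u := by
      intro u
      rw [← hslice 0 (hJ (by simp))]
      have h1 : (fun y ↦ Z (0, y)) =ᶠ[𝓝 z] id := by
        filter_upwards [hO₁.mem_nhds hzO] with y hy
        exact hZ0 y hy
      rw [h1.fderiv_eq, fderiv_id]
      rfl
    have hder : ∀ u : TangentSpace (cotangentModel E) ξ,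
        chartDeriv (cotangentModel E) c (κ.symm (Z (ε, κ ξ)))
          (mfderiv (cotangentModel E) (cotangentModel E) (fun ξ ↦ κ.symm (Z (ε, κ ξ))) ξ u) =
        fderiv ℝ Z (ε, z) (0, chartDeriv (cotangentModel E) c ξ u) := by
      intro u
      have h1 := fderiv_chart_apply (I := cotangentModel E) (I' := cotangentModel E) (c := c)
        (c' := c) ((ContMDiffAt.slice (Ψ := fun t ξ ↦ κ.symm (Z (t, κ ξ)))
          (hsmooth ε hε ξ hξ)).mdifferentiableAt (by simp)) hξ' (hZc _ hξ.2 ε hε) u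
      refine h1.trans ?_
      rw [← hslice ε (hJ hε)]
      refine congr($(Filter.EventuallyEq.fderiv_eq ?_) _)
      filter_upwards [hO₁.mem_nhds hzO, (isOpen_extChartAt_target c).mem_nhds
        (κ.map_source hξ.1)] with y hy hy'
      rw [← hκ, κ.right_inv hy', hZr y hy ε hε]
    ext v
    have h1 := hpot.omega_apply hε (hZc _ hξ.2 ε hε)
      (by rw [← hκ, hZr _ hξ.2 ε hε]; exact hZO _ hξ.2 ε hε)
      (mfderiv (cotangentModel E) (cotangentModel E) (fun ξ ↦ κ.symm (Z (ε, κ ξ))) ξ (v 0))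
      (mfderiv (cotangentModel E) (cotangentModel E) (fun ξ ↦ κ.symm (Z (ε, κ ξ))) ξ (v 1))
    rw [hder, hder, ← hκ, hZr _ hξ.2 ε hε] at h1
    have h2 := hGc (chartDeriv (cotangentModel E) c ξ (v 0))
      (chartDeriv (cotangentModel E) c ξ (v 1)) ε hε
    have h3 := hpot.omega_apply (ε := 0) (by simp) hξ'
      (by have := hZO z hzO 0 (by simp); rwa [hZ0 z hzO] at this) (v 0) (v 1)
    simp only [hG, hZ0', hZ0 z hzO] at h2
    have h4 : omegaForm φ 0 ξ = canonicalForm E M ξ := if_pos rfl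
    have hv : v = ![v 0, v 1] := by
      funext i; fin_cases i <;> rfl
    rw [h4] at h3
    refine Eq.trans ?_ ((h1.trans (h2.trans h3.symm)).trans (congrArg _ hv.symm))
    refine congrArg (omegaForm φ ε (κ.symm (Z (ε, κ ξ)))) ?_
    funext i
    fin_cases i <;> rfl

end LocalMoserFlow

/-! ### The inverse function theorem on manifolds. -/

section InverseFunction

variable {F : Type*} [NormedAddCommGroup F] [NormedSpace ℝ F] [CompleteSpace F]
  {H : Type*} [TopologicalSpace H] {I : ModelWithCorners ℝ F H} [I.Boundaryless]
  {N : Type*} [TopologicalSpace N] [ChartedSpace H N] [IsManifold I ∞ N] [IsManifold I 1 N]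

/-- The chart at `c` of a manifold without boundary, with values in the model vector space. -/
def extChartHomeomorph (I : ModelWithCorners ℝ F H) [I.Boundaryless] (c : N) :
    OpenPartialHomeomorph N F where
  toPartialEquiv := extChartAt I c
  open_source := isOpen_extChartAt_source c
  open_target := isOpen_extChartAt_target c
  continuousOn_toFun := continuousOn_extChartAt c
  continuousOn_invFun := continuousOn_extChartAt_symm c

/-- The inverse function theorem in a vector space, with a smooth local inverse on an open set. -/
lemma exists_openPartialHomeomorph_of_contDiffOn {g : F → F} {O : Set F} (hO : IsOpen O)
    (hg : ContDiffOn ℝ ∞ g O) {z : F} (hz : z ∈ O) (hb : Function.Bijective (fderiv ℝ g z)) :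
    ∃ G : OpenPartialHomeomorph F F, z ∈ G.source ∧ G.source ⊆ O ∧ (∀ y, G y = g y) ∧
      ContDiffOn ℝ ∞ G.symm G.target := by
  -- Restricting to the points with invertible derivative makes the inverse smooth on its whole
  -- domain, and not only at the image of `z`.
  set A : Set F := O ∩ fderiv ℝ g ⁻¹' range ((↑) : (F ≃L[ℝ] F) → (F →L[ℝ] F)) with hA
  have hAo : IsOpen A := (hg.fderiv_of_isOpen hO (m := ∞) le_rfl).continuousOn.isOpen_inter_preimage
    hO ContinuousLinearEquiv.isOpen
  have hd : ∀ y ∈ O, HasFDerivAt g (fderiv ℝ g y) y := fun y hy ↦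
    ((hg.contDiffAt (hO.mem_nhds hy)).differentiableAt (by simp)).hasFDerivAt
  have hB : ∃ B : F ≃L[ℝ] F, (B : F →L[ℝ] F) = fderiv ℝ g z :=
    ⟨ContinuousLinearEquiv.ofBijective (fderiv ℝ g z)
      (LinearMap.ker_eq_bot.2 hb.1) (LinearMap.range_eq_top.2 hb.2), by ext; rfl⟩
  obtain ⟨B, hB⟩ := hB
  have hBd : HasFDerivAt g (B : F →L[ℝ] F) z := by rw [hB]; exact hd z hz
  set G₀ := (hg.contDiffAt (hO.mem_nhds hz)).toOpenPartialHomeomorph g hBd (by simp) with hG₀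
  refine ⟨G₀.restrOpen A hAo, ⟨ContDiffAt.mem_toOpenPartialHomeomorph_source _ hBd _, hz, B, hB⟩,
    fun y hy ↦ hy.2.1, fun y ↦ rfl, fun y hy ↦ ?_⟩
  have hy' := (G₀.restrOpen A hAo).map_target hy
  obtain ⟨-, hyO, B', hB'⟩ := hy'
  refine ((G₀.restrOpen A hAo).contDiffAt_symm (f₀' := B') hy ?_ ?_).contDiffWithinAt
  · rw [hB']
    exact hd _ hyO
  · exact hg.contDiffAt (hO.mem_nhds hyO)

/-- The inverse function theorem on manifolds. -/
theorem isLocalDiffeomorphAt_of_bijective_mfderiv {f : N → N} {W : Set N} (hW : IsOpen W)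
    (hf : ContMDiffOn I I ∞ f W) {ξ : N} (hξ : ξ ∈ W) (hb : Function.Bijective (mfderiv I I f ξ)) :
    IsLocalDiffeomorphAt I I ∞ f ξ := by
  set κ := extChartAt I ξ with hκ
  set κ' := extChartAt I (f ξ) with hκ'
  have hW' : IsOpen (W ∩ f ⁻¹' κ'.source) :=
    hf.continuousOn.isOpen_inter_preimage hW (isOpen_extChartAt_source (f ξ))
  set O : Set F := κ.target ∩ κ.symm ⁻¹' (W ∩ f ⁻¹' κ'.source) with hO
  have hOo : IsOpen O :=
    (continuousOn_extChartAt_symm ξ).isOpen_inter_preimage (isOpen_extChartAt_target ξ) hW'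
  have hκ's : ContMDiffOn I 𝓘(ℝ, F) ∞ κ' κ'.source := by
    rw [hκ', extChartAt_source]
    exact contMDiffOn_extChartAt
  have hκs : ContMDiffOn I 𝓘(ℝ, F) ∞ κ κ.source := by
    rw [hκ, extChartAt_source]
    exact contMDiffOn_extChartAt
  have hg : ContDiffOn ℝ ∞ (fun z ↦ κ' (f (κ.symm z))) O := by
    rw [← contMDiffOn_iff_contDiffOn]
    exact hκ's.comp (hf.comp ((contMDiffOn_extChartAt_symm ξ).mono inter_subset_left)
      fun z hz ↦ hz.2.1) fun z hz ↦ hz.2.2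
  have hl : κ.symm (κ ξ) = ξ := κ.left_inv (mem_extChartAt_source ξ)
  have hz : κ ξ ∈ O := ⟨mem_extChartAt_target ξ, by
    rw [mem_preimage, hl]; exact ⟨hξ, mem_extChartAt_source (f ξ)⟩⟩
  have hs := mem_chart_source H ξ
  have hs' := mem_chart_source H (f ξ)
  have hbg : Function.Bijective (fderiv ℝ (fun z ↦ κ' (f (κ.symm z))) (κ ξ)) := by
    have h1 := fderiv_chart_apply (I := I) (I' := I) ((hf.contMDiffAt
      (hW.mem_nhds hξ)).mdifferentiableAt (by simp)) hs hs'
    have h2 := (chartDeriv_bijective (I := I) hs').comp hb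
    have h3 : ⇑(chartDeriv I (f ξ) (f ξ)) ∘ ⇑(mfderiv I I f ξ) =
      ⇑(fderiv ℝ (fun z ↦ κ' (f (κ.symm z))) (κ ξ)) ∘ ⇑(chartDeriv I ξ ξ) := funext h1
    rw [h3] at h2
    exact (Function.Bijective.of_comp_iff _ (chartDeriv_bijective (I := I) hs)).1 h2
  obtain ⟨G, hzG, hGO, hGg, hGs⟩ := exists_openPartialHomeomorph_of_contDiffOn hOo hg hz hbg
  set T : OpenPartialHomeomorph N N :=
    (extChartHomeomorph I ξ).trans (G.trans (extChartHomeomorph I (f ξ)).symm) with hT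
  have hTs : ∀ x ∈ T.source, x ∈ κ.source ∧ κ x ∈ G.source ∧ G (κ x) ∈ κ'.target :=
    fun x hx ↦ ⟨hx.1, hx.2.1, hx.2.2⟩
  have hTt : ∀ y ∈ T.target, y ∈ κ'.source ∧ κ' y ∈ G.target ∧ G.symm (κ' y) ∈ κ.target :=
    fun y hy ↦ ⟨hy.1.1, hy.1.2, hy.2⟩
  have hfT : EqOn f T T.source := by
    intro x hx
    obtain ⟨h1, h2, h3⟩ := hTs x hx
    have h4 := (hGO h2).2
    rw [mem_preimage, κ.left_inv h1] at h4
    change f x = κ'.symm (G (κ x))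
    rw [hGg, κ.left_inv h1, κ'.left_inv h4.2]
  refine ⟨⟨T.toPartialEquiv, T.open_source, T.open_target, ?_, ?_⟩, ?_, hfT⟩
  · refine ContMDiffOn.congr (f := f) (hf.mono fun x hx ↦ ?_) fun x hx ↦ (hfT hx).symm
    obtain ⟨h1, h2, h3⟩ := hTs x hx
    have h4 := (hGO h2).2
    rw [mem_preimage, κ.left_inv h1] at h4
    exact h4.1
  · have h1 : ContMDiffOn I 𝓘(ℝ, F) ∞ κ' T.target := hκ's.mono fun y hy ↦ (hTt y hy).1
    have h2 : ContMDiffOn I 𝓘(ℝ, F) ∞ (fun y ↦ G.symm (κ' y)) T.target :=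
      (contMDiffOn_iff_contDiffOn.2 hGs).comp h1 fun y hy ↦ (hTt y hy).2.1
    exact (contMDiffOn_extChartAt_symm ξ).comp h2 fun y hy ↦ (hTt y hy).2.2
  · refine ⟨mem_extChartAt_source ξ, hzG, ?_⟩
    change G (κ ξ) ∈ κ'.target
    rw [hGg, hl]
    exact mem_extChartAt_target (f ξ)

end InverseFunction

/-! ### Gluing the local flows; the symplectic realization. -/

section GlobalMoserFlow

lemma ContinuousLinearMap.bijective_of_injective {F : Type*} [NormedAddCommGroup F]
    [NormedSpace ℝ F] [FiniteDimensional ℝ F] (T : F →L[ℝ] F) (hT : Function.Injective T) :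
    Function.Bijective T :=
  ⟨hT, LinearMap.surjective_of_injective (f := (T : F →ₗ[ℝ] F)) hT⟩

variable {E : Type*} [NormedAddCommGroup E] [NormedSpace ℝ E] [FiniteDimensional ℝ E]
    {M : Type*} [TopologicalSpace M] [T2Space M] [ChartedSpace E M] [IsManifold 𝓘(ℝ, E) ∞ M]
    [IsManifold 𝓘(ℝ, E) 1 M]
    {P : SharpField E M} {V : Π ξ : Cotangent E M, TangentSpace (cotangentModel E) ξ}
    {φ : ℝ → Cotangent E M → Cotangent E M} {U W O : Set (Cotangent E M)}
    {X : ℝ → Π ξ : Cotangent E M, TangentSpace (cotangentModel E) ξ} {c : Cotangent E M}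
    {Φ : ℝ → Cotangent E M → Cotangent E M}

lemma IsMoserFlow.contMDiffOn (h : IsMoserFlow φ X U W Φ) {ε : ℝ} (hε : ε ∈ Icc (0 : ℝ) 1) :
    ContMDiffOn (cotangentModel E) (cotangentModel E) ∞ (Φ ε) W :=
  h.smooth.comp (contMDiffOn_const.prodMk contMDiffOn_id) fun _ hξ ↦ ⟨hε, hξ⟩

lemma IsMoserFlow.mdifferentiableAt (h : IsMoserFlow φ X U W Φ) {ε : ℝ} (hε : ε ∈ Icc (0 : ℝ) 1)
    {ξ : Cotangent E M} (hξ : ξ ∈ W) :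
    MDifferentiableAt (cotangentModel E) (cotangentModel E) (Φ ε) ξ :=
  ((h.contMDiffOn hε).contMDiffAt (h.isOpen.mem_nhds hξ)).mdifferentiableAt (by simp)

lemma IsMoserFlow.subset (h : IsMoserFlow φ X U W Φ) : W ⊆ U := fun ξ hξ ↦ by
  have := h.flow.mem ξ hξ 0 (by simp)
  rwa [h.flow.initial ξ hξ] at this

lemma IsMoserFlow.omegaForm_mfderiv (h : IsMoserFlow φ X U W Φ) {ε : ℝ}
    (hε : ε ∈ Icc (0 : ℝ) 1) {ξ : Cotangent E M} (hξ : ξ ∈ W)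
    (u v : TangentSpace (cotangentModel E) ξ) :
    omegaForm φ ε (Φ ε ξ) ![mfderiv (cotangentModel E) (cotangentModel E) (Φ ε) ξ u,
      mfderiv (cotangentModel E) (cotangentModel E) (Φ ε) ξ v] = canonicalForm E M ξ ![u, v] := by
  rw [← h.pullback ε hε ξ hξ]
  refine congrArg (omegaForm φ ε (Φ ε ξ)) (funext fun i ↦ ?_)
  fin_cases i <;> rfl

/-- A vector killed by the derivative lies in the kernel of the pulled back form, which is the
non-degenerate `ω₀`; both tangent spaces have the same finite dimension. -/
lemma IsMoserFlow.bijective_mfderiv (h : IsMoserFlow φ X U W Φ) {ε : ℝ}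
    (hε : ε ∈ Icc (0 : ℝ) 1) {ξ : Cotangent E M} (hξ : ξ ∈ W) :
    Function.Bijective (mfderiv (cotangentModel E) (cotangentModel E) (Φ ε) ξ) := by
  have hinj : Function.Injective (mfderiv (cotangentModel E) (cotangentModel E) (Φ ε) ξ) := by
    rw [injective_iff_map_eq_zero]
    intro u hu
    refine (canonicalForm_isSymplecticOn W).nondegenerate ξ hξ u fun v ↦ ?_
    rw [← h.omegaForm_mfderiv hε hξ, hu]
    exact (omegaForm φ ε (Φ ε ξ)).map_coord_zero 0 rfl
  exact ContinuousLinearMap.bijective_of_injective (F := E × (E →L[ℝ] ℝ))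
    (mfderiv (cotangentModel E) (cotangentModel E) (Φ ε) ξ) hinj

lemma IsMoserFlow.isLocalDiffeomorphOn (h : IsMoserFlow φ X U W Φ) {ε : ℝ}
    (hε : ε ∈ Icc (0 : ℝ) 1) :
    IsLocalDiffeomorphOn (cotangentModel E) (cotangentModel E) ∞ (Φ ε) W := by
  have := FiniteDimensional.complete ℝ E
  exact fun ξ ↦ isLocalDiffeomorphAt_of_bijective_mfderiv h.isOpen (h.contMDiffOn hε) ξ.2
    (h.bijective_mfderiv hε ξ.2)

/-- Integral curves of `X` starting at the same point, or meeting at some time, are equal. -/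
lemma IsMoserFlow.eq_of_eq (hUo : IsOpen U)
    (hXs : ContMDiffOn (𝓘(ℝ, ℝ).prod (cotangentModel E)) (cotangentModel E).tangent ∞
      (fun p : ℝ × Cotangent E M ↦
        (⟨p.2, X p.1 p.2⟩ : TangentBundle (cotangentModel E) (Cotangent E M)))
      (Icc 0 1 ×ˢ U))
    {Ψ : ℝ → Cotangent E M → Cotangent E M}
    (h : IsMoserFlow φ X U W Φ) (h' : IsMoserFlow φ X U O Ψ) {ξ η : Cotangent E M} (hξ : ξ ∈ W)
    (hη : η ∈ O) {s t : ℝ} (hs : s ∈ Icc (0 : ℝ) 1) (ht : t ∈ Icc (0 : ℝ) 1)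
    (heq : Φ s ξ = Ψ s η) : Φ t ξ = Ψ t η :=
  eqOn_integralCurves (γ₁ := fun t ↦ Φ t ξ) (γ₂ := fun t ↦ Ψ t η) hUo hXs
    (fun t ht ↦ ⟨h.flow.mem ξ hξ t ht, h.flow.deriv ξ hξ t ht⟩)
    (fun t ht ↦ ⟨h'.flow.mem η hη t ht, h'.flow.deriv η hη t ht⟩) hs heq ht

/-- The local flows agree on overlaps by uniqueness of integral curves, so no choice of
neighbourhoods has to be coordinated. -/
theorem IsSprayDomain.exists_isMoserFlow_zero_subset (hU : IsSprayDomain V φ U)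
    (hV : IsPoissonSpray P V)
    (hX : ∀ ε ∈ Icc (0 : ℝ) 1, ∀ ξ ∈ U, SolvesMoser φ ε ξ (X ε ξ)) :
    ∃ W Φ, cotangentZero E M ⊆ W ∧ IsMoserFlow φ X U W Φ := by
  classical
  have hXs := hU.contMDiffOn_moserField hV hX
  choose O hcO Ψ hΨ using fun c : cotangentZero E M ↦ hU.exists_isMoserFlow hV hX c.2
  -- Outside the union of the `O c` the value `ξ` is a mere default.
  set Φ : ℝ → Cotangent E M → Cotangent E M := fun t ξ ↦
    if h : ∃ c, ξ ∈ O c then Ψ h.choose t ξ else ξ with hΦ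
  have hagree : ∀ c, ∀ ξ ∈ O c, ∀ t ∈ Icc (0 : ℝ) 1, Φ t ξ = Ψ c t ξ := by
    intro c ξ hξ t ht
    have h : ∃ c, ξ ∈ O c := ⟨c, hξ⟩
    have h1 : Φ t ξ = Ψ h.choose t ξ := dif_pos h
    rw [h1]
    exact IsMoserFlow.eq_of_eq hU.isOpen hXs (hΨ _) (hΨ c) h.choose_spec hξ
      (s := 0) (by simp) ht
      (by rw [(hΨ _).flow.initial _ h.choose_spec, (hΨ c).flow.initial _ hξ])
  refine ⟨⋃ c, O c, Φ, fun c hc ↦ mem_iUnion.2 ⟨⟨c, hc⟩, hcO ⟨c, hc⟩⟩,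
    isOpen_iUnion fun c ↦ (hΨ c).isOpen, ⟨fun ξ hξ ↦ ?_, fun ξ hξ t ht ↦ ?_, fun ξ hξ t ht ↦ ?_⟩,
    fun p hp ↦ ?_, fun ε hε ξ hξ ↦ ?_⟩
  · obtain ⟨c, hc⟩ := mem_iUnion.1 hξ
    rw [hagree c ξ hc 0 (by simp), (hΨ c).flow.initial ξ hc]
  · obtain ⟨c, hc⟩ := mem_iUnion.1 hξ
    rw [hagree c ξ hc t ht]
    exact (hΨ c).flow.mem ξ hc t ht
  · obtain ⟨c, hc⟩ := mem_iUnion.1 hξ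
    rw [hagree c ξ hc t ht]
    exact ((hΨ c).flow.deriv ξ hc t ht).congr_of_eventuallyEq
      (Filter.eventuallyEq_of_mem self_mem_nhdsWithin fun s hs ↦ hagree c ξ hc s hs)
      (hagree c ξ hc t ht)
  · obtain ⟨c, hc⟩ := mem_iUnion.1 hp.2
    have h1 : Icc (0 : ℝ) 1 ×ˢ O c ∈ 𝓝[Icc (0 : ℝ) 1 ×ˢ ⋃ c, O c] p := by
      have h2 : univ ×ˢ O c ∈ 𝓝 p :=
        (isOpen_univ.prod (hΨ c).isOpen).mem_nhds ⟨mem_univ _, hc⟩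
      filter_upwards [self_mem_nhdsWithin, mem_nhdsWithin_of_mem_nhds h2] with q hq hq'
      exact ⟨hq.1, hq'.2⟩
    refine (((hΨ c).smooth p ⟨hp.1, hc⟩).mono_of_mem_nhdsWithin h1).congr_of_eventuallyEq
      ?_ (hagree c p.2 hc p.1 hp.1)
    filter_upwards [h1] with q hq
    exact hagree c q.2 hq.2 q.1 hq.1
  · obtain ⟨c, hc⟩ := mem_iUnion.1 hξ
    rw [← (hΨ c).pullback ε hε ξ hc]
    refine formPullback_congr ?_ _
    filter_upwards [(hΨ c).isOpen.mem_nhds hc] with η hη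
    exact hagree c η hη ε hε

lemma IsSprayDomain.solution_zero (hU : IsSprayDomain V φ U) (hV : IsPoissonSpray P V)
    (hX : ∀ ε ∈ Icc (0 : ℝ) 1, ∀ ξ ∈ U, SolvesMoser φ ε ξ (X ε ξ))
    (hc : c ∈ cotangentZero E M) {ε : ℝ} (hε : ε ∈ Icc (0 : ℝ) 1) : X ε c = 0 := by
  have := FiniteDimensional.complete ℝ E
  obtain ⟨δ, O', Θ, hpot, hO, -⟩ := hV.exists_isPotential hU.isOpen hU.flow (hU.zero_subset hc)
  have hs := mem_chart_source (ModelProd E (E →L[ℝ] ℝ)) c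
  have h1 := (hpot.solvesMoser_iff_eq hε hs hO (hU.nondegenerate ε hε c (hU.zero_subset hc)) _).1
    (hX ε hε c (hU.zero_subset hc))
  rw [hpot.moserField_zero hU hV hc hO hε] at h1
  exact (chartDeriv_bijective (I := cotangentModel E) hs).1 (h1.trans (map_zero _).symm)

/-- The flow of the solution of the Moser equation fixes the zero section. -/
lemma IsMoserFlow.apply_zero (h : IsMoserFlow φ X U W Φ) (hU : IsSprayDomain V φ U)
    (hV : IsPoissonSpray P V)
    (hX : ∀ ε ∈ Icc (0 : ℝ) 1, ∀ ξ ∈ U, SolvesMoser φ ε ξ (X ε ξ))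
    (hc : c ∈ cotangentZero E M) (hcW : c ∈ W) {ε : ℝ} (hε : ε ∈ Icc (0 : ℝ) 1) : Φ ε c = c := by
  refine eqOn_integralCurves (γ₁ := fun t ↦ Φ t c) (γ₂ := fun _ ↦ c) (s := 0) hU.isOpen
    (hU.contMDiffOn_moserField hV hX)
    (fun t ht ↦ ⟨h.flow.mem c hcW t ht, h.flow.deriv c hcW t ht⟩)
    (fun t ht ↦ ⟨hU.zero_subset hc, ?_⟩) (by simp) (h.flow.initial c hcW) hε
  rw [hU.solution_zero hV hX hc ht]
  refine (hasMFDerivWithinAt_const c _ t).congr_mfderiv ?_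
  ext
  exact (smul_zero (1 : ℝ)).symm

lemma surjective_mfderiv_cotangentProj (ξ : Cotangent E M) :
    Function.Surjective (mfderiv (cotangentModel E) 𝓘(ℝ, E) (cotangentProj E M) ξ) := by
  intro y
  have hs := mem_chart_source E ξ.proj
  obtain ⟨v, hv⟩ := (chartDeriv_bijective (I := cotangentModel E)
    (mem_chart_source (ModelProd E (E →L[ℝ] ℝ)) ξ)).2 (chartDeriv 𝓘(ℝ, E) ξ.proj ξ.proj y, 0)
  refine ⟨v, (chartDeriv_bijective (I := 𝓘(ℝ, E)) hs).1 ?_⟩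
  rw [← cotangent_chartDeriv_fst hs, hv]

/-- `Φ ε` fixes the zero section, whence surjectivity. A Hamiltonian vector for `ω₀` is the preimage
under `TΦ_ε` of the one that `IsSprayDomain.poisson` provides for `ω_{V,ε}`. -/
theorem IsMoserFlow.isSymplecticRealization (h : IsMoserFlow φ X U W Φ) (hP : IsPoisson P)
    (hU : IsSprayDomain V φ U) (hV : IsPoissonSpray P V)
    (hX : ∀ ε ∈ Icc (0 : ℝ) 1, ∀ ξ ∈ U, SolvesMoser φ ε ξ (X ε ξ))
    (hW : cotangentZero E M ⊆ W) {ε : ℝ} (hε : ε ∈ Icc (0 : ℝ) 1) :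
    IsSymplecticRealization (cotangentModel E) (canonicalForm E M) W
      (fun x ↦ (-ε) • P x) (cotangentProj E M ∘ Φ ε) := by
  have hcomp : ∀ ξ ∈ W, mfderiv (cotangentModel E) 𝓘(ℝ, E) (cotangentProj E M ∘ Φ ε) ξ =
      (mfderiv (cotangentModel E) 𝓘(ℝ, E) (cotangentProj E M) (Φ ε ξ)).comp
        (mfderiv (cotangentModel E) (cotangentModel E) (Φ ε) ξ) := fun ξ hξ ↦
    mfderiv_comp ξ (mdifferentiable_cotangentProj _) (h.mdifferentiableAt hε hξ)
  refine ⟨canonicalForm_isSymplecticOn W, ?_, ?_, fun ξ hξ ↦ ?_, fun ξ hξ α ↦ ?_⟩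
  · exact (Bundle.contMDiff_proj _).comp_contMDiffOn (h.contMDiffOn hε)
  · refine eq_univ_of_forall fun x ↦ ?_
    have hc : (⟨x, 0⟩ : Cotangent E M) ∈ cotangentZero E M := rfl
    refine ⟨⟨x, 0⟩, hW hc, ?_⟩
    rw [Function.comp_apply, h.apply_zero hU hV hX hc (hW hc) hε]
  · rw [hcomp ξ hξ]
    exact (surjective_mfderiv_cotangentProj _).comp (h.bijective_mfderiv hε hξ).2
  · obtain ⟨Y', hY', hY''⟩ :=
      IsSprayDomain.poisson hP hV hU (h.flow.mem ξ hξ ε hε) hε α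
    obtain ⟨Y, rfl⟩ := (h.bijective_mfderiv hε hξ).2 Y'
    rw [hcomp ξ hξ]
    refine ⟨Y, fun w ↦ ?_, hY''⟩
    rw [← h.omegaForm_mfderiv hε hξ]
    exact hY' _

end GlobalMoserFlow

end

/-- An injective local diffeomorphism is a diffeomorphism onto an open set, which is how the first
claim is expressed. Any solution `X` is admitted, since its values on `[0, 1] × U` are unique and
the others do not matter. -/
theorem mainTheorem6 {E : Type*} [NormedAddCommGroup E] [NormedSpace ℝ E] [FiniteDimensional ℝ E]
    {M : Type*} [TopologicalSpace M] [T2Space M] [ChartedSpace E M] [IsManifold 𝓘(ℝ, E) ∞ M]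
    (P : SharpField E M) (hP : IsPoisson P)
    (V : Π ξ : Cotangent E M, TangentSpace (cotangentModel E) ξ) (hV : IsPoissonSpray P V) :
    (∃ (φ : ℝ → Cotangent E M → Cotangent E M) (U : Set (Cotangent E M)), IsSprayDomain V φ U) ∧
    ∀ (φ : ℝ → Cotangent E M → Cotangent E M) (U : Set (Cotangent E M)), IsSprayDomain V φ U →
      (∀ ε ∈ Icc (0 : ℝ) 1, ∀ ξ ∈ U,
        ∃! x : TangentSpace (cotangentModel E) ξ, SolvesMoser φ ε ξ x) ∧
      ∀ X : ℝ → Π ξ : Cotangent E M, TangentSpace (cotangentModel E) ξ,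
        (∀ ε ∈ Icc (0 : ℝ) 1, ∀ ξ ∈ U, SolvesMoser φ ε ξ (X ε ξ)) →
        ContMDiffOn (𝓘(ℝ, ℝ).prod (cotangentModel E)) (cotangentModel E).tangent ∞
          (fun p : ℝ × Cotangent E M ↦
            (⟨p.2, X p.1 p.2⟩ : TangentBundle (cotangentModel E) (Cotangent E M)))
          (Icc 0 1 ×ˢ U) ∧
        ∃ (W : Set (Cotangent E M)) (Φ : ℝ → Cotangent E M → Cotangent E M),
          IsOpen W ∧ cotangentZero E M ⊆ W ∧ W ⊆ U ∧
          IsFlowOn (cotangentModel E) X U Φ W ∧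
          ContMDiffOn (𝓘(ℝ, ℝ).prod (cotangentModel E)) (cotangentModel E) ∞
            (fun p : ℝ × Cotangent E M ↦ Φ p.1 p.2) (Icc 0 1 ×ˢ W) ∧
          ∀ ε ∈ Icc (0 : ℝ) 1,
            InjOn (Φ ε) W ∧
            IsLocalDiffeomorphOn (cotangentModel E) (cotangentModel E) ∞ (Φ ε) W ∧
            (∀ ξ ∈ W, formPullback (cotangentModel E) (cotangentModel E) (Φ ε) (omegaForm φ ε) ξ =
              canonicalForm E M ξ) ∧
            IsSymplecticRealization (cotangentModel E) (canonicalForm E M) W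
              (fun x ↦ (-ε) • P x) (cotangentProj E M ∘ Φ ε) := by
  have : IsManifold 𝓘(ℝ, E) 1 M := IsManifold.of_le (n := ∞) (by exact_mod_cast le_top)
  have := FiniteDimensional.complete ℝ E
  refine ⟨hV.exists_isSprayDomain, fun φ U hU ↦
    ⟨fun ε hε ξ hξ ↦ hU.existsUnique_solvesMoser hV hε hξ, fun X hX ↦
      ⟨hU.contMDiffOn_moserField hV hX, ?_⟩⟩⟩
  obtain ⟨W, Φ, hW, h⟩ := hU.exists_isMoserFlow_zero_subset hV hX
  refine ⟨W, Φ, h.isOpen, hW, h.subset, h.flow, h.smooth, fun ε hε ↦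
    ⟨fun ξ hξ η hη heq ↦ ?_, h.isLocalDiffeomorphOn hε, h.pullback ε hε,
      h.isSymplecticRealization hP hU hV hX hW hε⟩⟩
  -- Integral curves that meet at time `ε` coincide at time `0`; this is injectivity.
  have h0 := IsMoserFlow.eq_of_eq hU.isOpen (hU.contMDiffOn_moserField hV hX) h h hξ hη hε
    (t := 0) (by simp) heq
  rwa [h.flow.initial ξ hξ, h.flow.initial η hη] at h0
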